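/- Let $m\ge 0$, $p,q\ge 1$ be integers, $n=p+q$, and let $Q(y)=\sum_{i=1}^p y_i^2-\sum_{i=1}^q y_{p+i}^2$ on $\mathbb{R}^n$. For $E=\mathbb{R}^d$, $\mathcal{D}(E)$ denotes the space of smooth compactly supported functions on $E$ (with values in $\mathbb{K}=\mathbb{R}$ or $\mathbb{C}$), with its usual locally convex inductive limit topology. For $g\in\mathcal{D}(\mathbb{R}^n)$, the mean function $M_Q(g)\in C^\infty(\mathbb{R}^*)\cap L^1(\mathbb{R})$, $\mathbb{R}^*=\mathbb{R}\setminus\{0\}$, is the function determined on $\mathbb{R}^*$ by $$\int_{\mathbb{R}^n}F(Q(y))\,g(y)\,dy=\int_{\mathbb{R}}F(t)\,M_Q(g)(t)\,dt\qquad\text{for all }F\in\mathcal{D}(\mathbb{R}).$$ Define $\eta$ on $\mathbb{R}^*$ by (with $Y$ the Heaviside function) - $\eta(t)=Y(t)\,t^{n/2-1}$ if $p$ is odd and $q$ is even; - $\eta(t)=Y(-t)\,(-t)^{n/2-1}$ if $p$ is even and $q$ is odd; - $\eta(t)=\tfrac12\,\mathrm{sgn}(t)\,t^{n/2-1}$ if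 $p$ and $q$ are even; - $\eta(t)=t^{n/2-1}\log|t|$ if $p$ and $q$ are odd. Let $\mathcal{H}^m_\eta$ be the space of functions on $\mathbb{R}^m\times\mathbb{R}^*$ of the form $(x,t)\mapsto\phi_0(x,t)+\eta(t)\phi_1(x,t)$ with $\phi_0,\phi_1\in\mathcal{D}(\mathbb{R}^m\times\mathbb{R})$. Each $\varphi\in\mathcal{H}^m_\eta$ has a unique sequence $(\varphi_k)_{k\in\mathbb{N}}$ in $\mathcal{D}(\mathbb{R}^m)$, with supports in a common compact set, such that for all $N\in\mathbb{N}$ the function $\varphi(x,t)-\eta(t)\sum_{k=0}^N\varphi_k(x)t^k$ extends to a $C^l$ function on $\mathbb{R}^m\times\mathbb{R}$ for every integer $0\le l<N+\frac n2$. Fix $\chi\in\mathcal{D}(\mathbb{R})$, real-valued and equal to $1$ near $0$, and put $T_N(\varphi)(x,t)=\varphi(x,t)-\chi(t)\eta(t)\sum_{k=0}^N\varphi_k(x)t^k$. For $K\subset\mathbb{R}^m\times\mathbb{R}$ compact, the space $\mathcal{H}^m_{\eta,K}$ of those $\varphi\in\mathcal{H}^m_\eta$ that are supported in $K$ carries the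 topology defined by the seminorms $$\|\varphi\|_{N,l,\mathbf{i}}=\sup_{(x,t)\in\mathbb{R}^m\times\mathbb{R}^*}\bigl|\partial_x^{\mathbf{i}}\partial_t^{l}T_N(\varphi)(x,t)\bigr|\quad\bigl(N,l\in\mathbb{N},\ l<N+\tfrac n2,\ \mathbf{i}\in\mathbb{N}^m\bigr),\qquad B_{k,\mathbf{i}}(\varphi)=\sup_{x}\bigl|\partial_x^{\mathbf{i}}\varphi_k(x)\bigr|\quad(k\in\mathbb{N},\ \mathbf{i}\in\mathbb{N}^m),$$ and $\mathcal{H}^m_\eta$ carries the locally convex inductive limit topology of the spaces $\mathcal{H}^m_{\eta,K}$. **Theorem.** For every $g\in\mathcal{D}(\mathbb{R}^n)$ the mean function $M_Q(g)$ exists. For $f\in\mathcal{D}(\mathbb{R}^m\times\mathbb{R}^n)$ write $f_x(y)=f(x,y)$; then $(x,t)\mapsto M_Q(f_x)(t)$ belongs to $\mathcal{H}^m_\eta$, and the map $$\mathcal{D}(\mathbb{R}^m\times\mathbb{R}^n)\to\mathcal{H}^m_\eta,\qquad f\mapsto\bigl((x,t)\mapsto M_Q(f_x)(t)\bigr)$$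 is continuous and surjective. -/

import Mathlib

open MeasureTheory Set Topology TopologicalSpace
open scoped ContDiff ENNReal

namespace MeanFunction

/-- The Euclidean space `ℝ^d`. -/
abbrev Euc (d : ℕ) : Type := EuclideanSpace ℝ (Fin d)

/-- The space `𝓓(E)` of smooth compactly supported `𝕜`-valued functions on `E`, with its usual
(locally convex inductive limit) topology. -/
abbrev TestFn (E 𝕜 : Type*) [NormedAddCommGroup E] [NormedSpace ℝ E]
    [NormedAddCommGroup 𝕜] [NormedSpace ℝ 𝕜] : Type _ :=
  TestFunction (⊤ : Opens E) 𝕜 ⊤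

/-- The quadratic form of signature `(p, q)` on `ℝ^(p+q)`. -/
def quadForm (p q : ℕ) (y : Euc (p + q)) : ℝ :=
  ∑ i : Fin p, y (Fin.castAdd q i) ^ 2 - ∑ i : Fin q, y (Fin.natAdd p i) ^ 2

/-- The singularity function `η` on `ℝ \ {0}` attached to the signature `(p, q)`, `n = p + q`.
If `p` and `q` have the same parity then `n / 2 - 1` is a natural number (for `n ≥ 2`); otherwise
it is a half-integer and the power is a real power of a positive number. The value at `t = 0` is
never used. -/
noncomputable def eta (p q : ℕ) (t : ℝ) : ℝ :=
  if Odd p ∧ Even q then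
    if 0 < t then t ^ (((p + q : ℕ) : ℝ) / 2 - 1) else 0
  else if Even p ∧ Odd q then
    if t < 0 then (-t) ^ (((p + q : ℕ) : ℝ) / 2 - 1) else 0
  else if Even p ∧ Even q then
    (1 / 2) * Real.sign t * t ^ ((p + q) / 2 - 1)
  else
    t ^ ((p + q) / 2 - 1) * Real.log |t|

section Mean

variable {𝕜 : Type*} [RCLike 𝕜]

/-- `M` is (a representative of) the mean function of `g` with respect to the quadratic form:
`M ∈ C^∞(ℝ \ {0}) ∩ L¹(ℝ)` and `∫ F(Q(y)) g(y) dy = ∫ F(t) M(t) dt` for all `F ∈ 𝓓(ℝ)`. -/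
structure IsMeanFunction (p q : ℕ) (g : Euc (p + q) → 𝕜) (M : ℝ → 𝕜) : Prop where
  contDiffOn : ContDiffOn ℝ ∞ M {0}ᶜ
  integrable : Integrable M
  integral_eq : ∀ F : TestFn ℝ 𝕜,
    ∫ y, F (quadForm p q y) * g y = ∫ t, F t * M t

/-- The defining relation determines the mean function on `ℝ \ {0}`. -/
theorem IsMeanFunction.eq_of_ne_zero {p q : ℕ} {g : Euc (p + q) → 𝕜} {M M' : ℝ → 𝕜}
    (h : IsMeanFunction p q g M) (h' : IsMeanFunction p q g M') {t : ℝ} (ht : t ≠ 0) :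
    M t = M' t := by
  have hae : M =ᵐ[volume] M' := by
    refine ae_eq_of_integral_contDiff_smul_eq h.integrable.locallyIntegrable
      h'.integrable.locallyIntegrable fun F hF hFc => ?_
    let G : TestFn ℝ 𝕜 := ⟨fun s => (F s : 𝕜), (RCLike.ofRealCLM (K := 𝕜)).contDiff.comp hF,
      hFc.comp_left (g := fun r : ℝ => (r : 𝕜)) RCLike.ofReal_zero, fun _ _ => trivial⟩
    have h1 := h.integral_eq G
    rw [h'.integral_eq G] at h1
    have hG : ∀ s, G s = (F s : 𝕜) := fun _ => rfl
    simp only [hG] at h1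
    simpa only [RCLike.real_smul_eq_coe_mul] using h1.symm
  have hres : M =ᵐ[volume.restrict ({0}ᶜ : Set ℝ)] M' := ae_restrict_of_ae hae
  exact Measure.eqOn_open_of_ae_eq hres isOpen_compl_singleton h.contDiffOn.continuousOn
    h'.contDiffOn.continuousOn ht

open Classical in
/-- The mean function `M_Q g` of `g`; only its values on `ℝ \ {0}` are meaningful. -/
noncomputable def mean (p q : ℕ) (g : Euc (p + q) → 𝕜) : ℝ → 𝕜 :=
  if h : ∃ M, IsMeanFunction p q g M then Classical.choose h else 0

end Mean

/-- The set `ℝ^m × (ℝ \ {0})`. -/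
abbrev PuncturedProd (m : ℕ) : Type := Euc m × {t : ℝ // t ≠ 0}

/-- The space `H_η^m` of the functions `(x, t) ↦ φ₀(x, t) + η(t) φ₁(x, t)` on
`ℝ^m × (ℝ \ {0})`, where `φ₀, φ₁ ∈ 𝓓(ℝ^m × ℝ)`. -/
def H (𝕜 : Type*) [RCLike 𝕜] (m p q : ℕ) : Submodule 𝕜 (PuncturedProd m → 𝕜) where
  carrier := {φ | ∃ φ₀ φ₁ : TestFn (Euc m × ℝ) 𝕜, ∀ z : PuncturedProd m,
    φ z = φ₀ (z.1, (z.2 : ℝ)) + (eta p q z.2 : 𝕜) * φ₁ (z.1, (z.2 : ℝ))}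
  zero_mem' := ⟨0, 0, fun z => by simp⟩
  add_mem' := by
    rintro φ ψ ⟨φ₀, φ₁, h⟩ ⟨ψ₀, ψ₁, h'⟩
    refine ⟨φ₀ + ψ₀, φ₁ + ψ₁, fun z => ?_⟩
    simp only [Pi.add_apply, h, h', FunLike.coe_add]
    ring
  smul_mem' := by
    rintro c φ ⟨φ₀, φ₁, h⟩
    refine ⟨c • φ₀, c • φ₁, fun z => ?_⟩
    simp only [Pi.smul_apply, h, FunLike.coe_smul, smul_eq_mul]
    ring

section Space

variable {𝕜 : Type*} [RCLike 𝕜] {m : ℕ}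

/-- `c = (φ_k)` is the sequence of singular coefficients of `φ`: the `φ_k ∈ 𝓓(ℝ^m)` have their
supports in one compact set and, for all `N` and all `l < N + n/2`, the function
`(x, t) ↦ φ(x, t) - η(t) ∑_{k ≤ N} φ_k(x) t^k` extends to a `C^l` function on `ℝ^m × ℝ`. -/
def IsSingularCoeff (p q : ℕ) (φ : PuncturedProd m → 𝕜) (c : ℕ → TestFn (Euc m) 𝕜) : Prop :=
  (∃ K : Compacts (Euc m), ∀ k, tsupport (c k) ⊆ K) ∧
  ∀ N l : ℕ, (l : ℝ) < N + ((p + q : ℕ) : ℝ) / 2 →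
    ∃ G : Euc m × ℝ → 𝕜, ContDiff ℝ l G ∧ ∀ z : PuncturedProd m,
      G (z.1, (z.2 : ℝ)) = φ z -
        (eta p q z.2 : 𝕜) * ∑ k ∈ Finset.range (N + 1), c k z.1 * ((z.2 : ℝ) : 𝕜) ^ k

open Classical in
/-- The singular coefficients `(φ_k)` of `φ` (they exist and are unique for `φ ∈ H_η^m`). -/
noncomputable def singularCoeff (p q : ℕ) (φ : PuncturedProd m → 𝕜) : ℕ → TestFn (Euc m) 𝕜 :=
  if h : ∃ c, IsSingularCoeff p q φ c then Classical.choose h else 0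

open Classical in
/-- Extension by `0` of a function on `ℝ^m × (ℝ \ {0})` to `ℝ^m × ℝ`. -/
noncomputable def extendZero (φ : PuncturedProd m → 𝕜) (z : Euc m × ℝ) : 𝕜 :=
  if h : z.2 ≠ 0 then φ (z.1, ⟨z.2, h⟩) else 0

/-- `T_N(φ)(x, t) = φ(x, t) - χ(t) η(t) ∑_{k ≤ N} φ_k(x) t^k`, to be used for `t ≠ 0`. -/
noncomputable def remainder (p q : ℕ) (χ : ℝ → ℝ) (N : ℕ) (φ : PuncturedProd m → 𝕜)
    (z : Euc m × ℝ) : 𝕜 :=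
  extendZero φ z - (χ z.2 : 𝕜) * (eta p q z.2 : 𝕜) *
    ∑ k ∈ Finset.range (N + 1), singularCoeff p q φ k z.1 * (z.2 : 𝕜) ^ k

/-- The partial derivative `(∂/∂x_1)^{i_1} ⋯ (∂/∂x_m)^{i_m} g`. -/
noncomputable def partialX (i : Fin m → ℕ) (g : Euc m → 𝕜) : Euc m → 𝕜 :=
  (List.finRange m).foldr
    (fun j u => (fun v x => lineDeriv ℝ v x (EuclideanSpace.single j (1 : ℝ)))^[i j] u) g

/-- `‖φ‖_{N,l,i} = sup_{(x,t), t ≠ 0} |∂_x^i ∂_t^l T_N(φ)(x, t)|`. -/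
noncomputable def normT (p q : ℕ) (χ : ℝ → ℝ) (N l : ℕ) (i : Fin m → ℕ)
    (φ : PuncturedProd m → 𝕜) : ℝ≥0∞ :=
  ⨆ z : PuncturedProd m,
    ‖partialX i (fun x => iteratedDeriv l (fun t => remainder p q χ N φ (x, t)) z.2) z.1‖ₑ

/-- `B_{k,i}(φ) = sup_x |∂_x^i φ_k(x)|`. -/
noncomputable def normB (p q : ℕ) (k : ℕ) (i : Fin m → ℕ) (φ : PuncturedProd m → 𝕜) : ℝ≥0∞ :=
  ⨆ x : Euc m, ‖partialX i (singularCoeff p q φ k) x‖ₑ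

end Space

/-- The subspace `H_{η,K}^m` of the functions in `H_η^m` supported in the compact set `K`. -/
def HK (𝕜 : Type*) [RCLike 𝕜] (m p q : ℕ) (K : Compacts (Euc m × ℝ)) :
    Submodule 𝕜 (H 𝕜 m p q) where
  carrier := {φ | ∀ z : PuncturedProd m, (z.1, (z.2 : ℝ)) ∉ K → (φ : PuncturedProd m → 𝕜) z = 0}
  zero_mem' := fun z _ => by simp
  add_mem' := fun {φ ψ} hφ hψ z hz => by simp [hφ z hz, hψ z hz]
  smul_mem' := fun c φ hφ z hz => by simp [hφ z hz]

/-- The topology of `H_{η,K}^m` defined by the seminorms `‖·‖_{N,l,i}` (for `l < N + n/2`) and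
`B_{k,i}`: the coarsest one for which all the maps `φ ↦ P(φ - ψ)`, with `P` one of these
seminorms and `ψ ∈ H_{η,K}^m`, are continuous. -/
@[reducible]
noncomputable def topHK (𝕜 : Type*) [RCLike 𝕜] (m p q : ℕ) (χ : ℝ → ℝ)
    (K : Compacts (Euc m × ℝ)) : TopologicalSpace (HK 𝕜 m p q K) :=
  (⨅ (ψ : HK 𝕜 m p q K) (N : ℕ) (l : ℕ) (i : Fin m → ℕ)
      (_ : (l : ℝ) < N + ((p + q : ℕ) : ℝ) / 2),
    induced (fun φ : HK 𝕜 m p q K =>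
      normT p q χ N l i ((φ - ψ : HK 𝕜 m p q K) : H 𝕜 m p q).1) inferInstance) ⊓
  ⨅ (ψ : HK 𝕜 m p q K) (k : ℕ) (i : Fin m → ℕ),
    induced (fun φ : HK 𝕜 m p q K =>
      normB p q k i ((φ - ψ : HK 𝕜 m p q K) : H 𝕜 m p q).1) inferInstance

/-- The locally convex inductive limit topology on `H_η^m`: the finest locally convex vector space
topology for which all the inclusions `H_{η,K}^m → H_η^m` are continuous. -/
@[reducible]
noncomputable def topH (𝕜 : Type*) [RCLike 𝕜] (m p q : ℕ) (χ : ℝ → ℝ) :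
    TopologicalSpace (H 𝕜 m p q) :=
  sInf {τ : TopologicalSpace (H 𝕜 m p q) |
    (∀ K : Compacts (Euc m × ℝ),
      Continuous[topHK 𝕜 m p q χ K, τ] (Subtype.val : HK 𝕜 m p q K → H 𝕜 m p q)) ∧
    @IsTopologicalAddGroup (H 𝕜 m p q) τ _ ∧
    @ContinuousSMul ℝ (H 𝕜 m p q) _ _ τ ∧
    @LocallyConvexSpace ℝ (H 𝕜 m p q) _ _ _ _ τ}

/-- The function `(x, t) ↦ M_Q(f_x)(t)` on `ℝ^m × (ℝ \ {0})`, where `f_x(y) = f(x, y)`. -/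
noncomputable def meanMap {𝕜 : Type*} [RCLike 𝕜] (m p q : ℕ)
    (f : TestFn (Euc m × Euc (p + q)) 𝕜) : PuncturedProd m → 𝕜 :=
  fun z => mean p q (fun y => f (z.1, y)) z.2

end MeanFunction

/-! In squared polar coordinates `y = (√a ω, √b σ)` the quadratic form is `a - b` and Lebesgue
measure is `¼ a^(p/2-1) b^(q/2-1) da db dω dσ`. Hence `M_Q(f_x)(t)` is the explicit integral `¼ ∫
b^(q/2-1) (b+t)^(p/2-1) A(x, √b, √(b+t)) db` (`meanFn`), where `A(x, s, r)` integrates `f(x, (rω,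
sσ))` over both spheres; `A` is smooth, and even in `s` and in `r`.

Singularity at `t = 0`. Expand `A` by Taylor in `r` and `s`. A remainder divisible by a high power
of `r` or of `s` contributes a `C^l` function (`contDiff_hypInt_of_flat`), odd monomials are absent,
and `r^(2a) s^(2b)` only replaces `(p, q)` by `(p+2a, q+2b)` in a model integral. Each model
integral is smooth plus `C η` with `C ≠ 0` (`betaExpansion`): two recurrences lower `p` or `q` by
two, down to four elementary integrals, one for each parity pattern. Since `η` for `(p+2a, q+2b)` is
`± t^(a+b) η`, the mean function equals `η ∑ t^k c_k(x)` modulo `C^l`, for every `l`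
(`exists_hypInt_expansion`). Borel's lemma provides a test function `φ₁` with these Taylor
coefficients, and `M - η φ₁` extends smoothly across `t = 0`; this is membership in `H`
(`exists_meanFn_eq`). The coefficients are unique because `t^k η` is not `C^l` for some `l < k +
n/2` (`not_contDiff_eta`).

Surjectivity. The mean function of `u(x, Q(y)) h(|y'|², |y''|²)` is `u` times a function of `t`
alone (`meanFn_radial`). Localising `h` where neither `|y'|` nor `|y''|` is small gives every smooth
`u`; taking for `h` a product of cut-offs gives a factor `A + C η` near `0`, and `C ≠ 0` allows the
part `η φ₁` to be produced modulo smooth functions (`exists_meanMap_eq`).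

Continuity is soft. The space `𝓓_K` is Fréchet, hence barrelled. The values `M(x, t)` for `t ≠ 0`
and the coefficients `c_k(x)` are continuous linear functionals of `f`; so are their derivatives, as
pointwise limits of difference quotients (Banach–Steinhaus). The seminorms of the target are suprema
of such functionals, and on a barrelled space the supremum of a pointwise bounded family is
continuous (`continuous_iSup_sub`). Thus only finiteness for each single `f` has to be known, and it
follows from the structure of `H` (`exists_remainder_eq`). -/

namespace MeanFunction

/-! ### Integrals depending smoothly on parameters -/

section ParametricIntegral

variable {Ω : Type*} [MeasurableSpace Ω] {μ : Measure Ω} {V : Type*} [NormedAddCommGroup V]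
  [NormedSpace ℝ V] [SecondCountableTopology V] [MeasurableSpace V] [BorelSpace V]
  {Z : Type} [NormedAddCommGroup Z] [NormedSpace ℝ Z] [FiniteDimensional ℝ Z]

theorem integrable_smul_comp {G : Type*} [NormedAddCommGroup G] [NormedSpace ℝ G]
    {w : Ω → ℝ} (hw : Integrable w μ) {ι : Ω → V} (hι : Measurable ι) {C : Set V}
    (hC : IsCompact C) (hιC : ∀ᵐ o ∂μ, ι o ∈ C) {F : V → G} (hF : Continuous F) :
    Integrable (fun o => w o • F (ι o)) μ := by
  obtain ⟨M, hM⟩ := hC.exists_bound_of_continuousOn hF.continuousOn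
  refine Integrable.smul_bdd hw M ?_ ?_
  · exact (hF.comp_stronglyMeasurable hι.stronglyMeasurable).aestronglyMeasurable
  · filter_upwards [hιC] with o ho using hM _ ho

theorem continuous_integral_param {G : Type*} [NormedAddCommGroup G] [NormedSpace ℝ G]
    {w : Ω → ℝ} (hw : Integrable w μ) {ι : Ω → V} (hι : Measurable ι) {C : Set V}
    (hC : IsCompact C) (hιC : ∀ᵐ o ∂μ, ι o ∈ C) {F : Z × V → G} (hF : Continuous F) :
    Continuous fun z => ∫ o, w o • F (z, ι o) ∂μ := by
  have : ProperSpace Z := FiniteDimensional.proper ℝ Z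
  refine continuous_iff_continuousAt.2 fun z₀ => ?_
  obtain ⟨M, hM⟩ := ((isCompact_closedBall z₀ 1).prod hC).exists_bound_of_continuousOn
    hF.continuousOn
  refine continuousAt_of_dominated (bound := fun o => ‖w o‖ * M) ?_ ?_ (hw.norm.mul_const M) ?_
  · refine Filter.Eventually.of_forall fun z => ?_
    exact (integrable_smul_comp hw hι hC hιC (F := fun v => F (z, v))
      (by fun_prop)).aestronglyMeasurable
  · filter_upwards [Metric.closedBall_mem_nhds z₀ one_pos] with z hz
    filter_upwards [hιC] with o ho
    rw [norm_smul]
    gcongr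
    exact hM _ ⟨hz, ho⟩
  · refine Filter.Eventually.of_forall fun o => ?_
    exact Continuous.continuousAt (by fun_prop)

/-- Differentiation under the integral sign; compactness of `C` and of a closed ball in `Z` supplies
the dominating function. All singular behaviour in `o` is confined to the integrable weight `w` and
the merely measurable map `ι`, so that later `w` may blow up and `ι` may involve square roots. The
target `G` is generalised in the induction because the derivative takes values in `Z →L[ℝ] G`. -/
theorem contDiff_integral_param_nat (l : ℕ) : ∀ {G : Type*} [NormedAddCommGroup G]
    [NormedSpace ℝ G] [CompleteSpace G]
    {w : Ω → ℝ} (_ : Integrable w μ) {ι : Ω → V} (_ : Measurable ι) {C : Set V}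
    (_ : IsCompact C) (_ : ∀ᵐ o ∂μ, ι o ∈ C) {F : Z × V → G} (_ : ContDiff ℝ l F),
    ContDiff ℝ l fun z => ∫ o, w o • F (z, ι o) ∂μ := by
  have : ProperSpace Z := FiniteDimensional.proper ℝ Z
  induction l with
  | zero =>
    intro G _ _ _ w hw ι hι C hC hιC F hF
    exact contDiff_zero.2 (continuous_integral_param hw hι hC hιC hF.continuous)
  | succ l ih =>
    intro G _ _ _ w hw ι hι C hC hιC F hF
    set F' : Z × V → Z →L[ℝ] G := fun z => (fderiv ℝ F z).comp (ContinuousLinearMap.inl ℝ Z V)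
      with hF'def
    have hF' : ContDiff ℝ l F' :=
      (hF.fderiv_right (m := l) (by norm_cast)).clm_comp contDiff_const
    have hd : ∀ z v, HasFDerivAt (fun z => F (z, v)) (F' (z, v)) z := fun z v =>
      ((hF.differentiable (by simp)) (z, v)).hasFDerivAt.comp z (hasFDerivAt_prodMk_left z v)
    rw [Nat.cast_succ]
    refine contDiff_succ_iff_hasFDerivAt.2 ⟨_, ih hw hι hC hιC hF', fun z₀ => ?_⟩
    obtain ⟨M, hM⟩ := ((isCompact_closedBall z₀ 1).prod hC).exists_bound_of_continuousOn
      hF'.continuous.continuousOn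
    refine hasFDerivAt_integral_of_dominated_of_fderiv_le (bound := fun o => ‖w o‖ * M)
      (F' := fun z o => w o • F' (z, ι o))
      (Metric.closedBall_mem_nhds z₀ one_pos) ?_ ?_ ?_ ?_ (hw.norm.mul_const M) ?_
    · refine Filter.Eventually.of_forall fun z => ?_
      exact (integrable_smul_comp hw hι hC hιC (F := fun v => F (z, v))
        (hF.continuous.comp (by fun_prop))).aestronglyMeasurable
    · exact integrable_smul_comp hw hι hC hιC (F := fun v => F (z₀, v))
        (hF.continuous.comp (by fun_prop))
    · exact (integrable_smul_comp hw hι hC hιC (F := fun v => F' (z₀, v))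
        (hF'.continuous.comp (by fun_prop))).aestronglyMeasurable
    · filter_upwards [hιC] with o ho z hz
      rw [norm_smul]
      gcongr
      exact hM _ ⟨hz, ho⟩
    · exact Filter.Eventually.of_forall fun o z _ => (hd z (ι o)).const_smul (w o)

/-- Smooth dependence of an integral on parameters. -/
theorem contDiff_integral_param {G : Type*} [NormedAddCommGroup G]
    [NormedSpace ℝ G] [CompleteSpace G]
    {w : Ω → ℝ} (hw : Integrable w μ) {ι : Ω → V} (hι : Measurable ι) {C : Set V}
    (hC : IsCompact C) (hιC : ∀ᵐ o ∂μ, ι o ∈ C) {F : Z × V → G} (hF : ContDiff ℝ ∞ F) :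
    ContDiff ℝ ∞ fun z => ∫ o, w o • F (z, ι o) ∂μ :=
  contDiff_infty.2 fun l => contDiff_integral_param_nat l hw hι hC hιC (contDiff_infty.1 hF l)

end ParametricIntegral

/-! ### Products with functions vanishing near `0` -/

section Flat

variable {G : Type*} [NormedAddCommGroup G] [NormedSpace ℝ G]

theorem contDiff_inv_mul_of_eventuallyEq_zero {ζ : ℝ → ℝ} (hζ : ContDiff ℝ ∞ ζ)
    (h0 : ζ =ᶠ[𝓝 0] 0) (u : ℝ → ℝ) (hu : ∀ t ≠ 0, ContDiffAt ℝ ∞ u t) :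
    ContDiff ℝ ∞ fun t => ζ t * u t := by
  refine contDiff_iff_contDiffAt.2 fun t => ?_
  rcases eq_or_ne t 0 with rfl | ht
  · refine (contDiffAt_const (c := (0 : ℝ))).congr_of_eventuallyEq ?_
    filter_upwards [h0] with s hs
    simp [hs]
  · exact hζ.contDiffAt.mul (hu t ht)

theorem contDiff_div_pow_of_eventuallyEq_zero {ζ : ℝ → ℝ} (hζ : ContDiff ℝ ∞ ζ)
    (h0 : ζ =ᶠ[𝓝 0] 0) (n : ℕ) : ContDiff ℝ ∞ fun t => ζ t * (t ^ n)⁻¹ :=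
  contDiff_inv_mul_of_eventuallyEq_zero hζ h0 _ fun t ht =>
    (contDiffAt_id.pow n).inv (pow_ne_zero n ht)

end Flat

/-! ### Hadamard quotients and Taylor coefficients -/

section Hadamard

variable {Y : Type} [NormedAddCommGroup Y] [NormedSpace ℝ Y] 
  {G : Type*} [NormedAddCommGroup G] [NormedSpace ℝ G]

/-- The Hadamard quotient `(g(y, t) - g(y, 0)) / t`. -/
noncomputable def hquot (g : Y × ℝ → G) (z : Y × ℝ) : G :=
  ∫ θ in Ioc (0 : ℝ) 1, (1 : ℝ) • fderiv ℝ g (z.1, z.2 * θ) (0, 1)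

theorem contDiff_hquot [FiniteDimensional ℝ Y] [CompleteSpace G] {g : Y × ℝ → G}
    (hg : ContDiff ℝ ∞ g) : ContDiff ℝ ∞ (hquot g) := by
  refine contDiff_integral_param (Z := Y × ℝ) (μ := volume.restrict (Ioc (0 : ℝ) 1))
    (w := fun _ => 1)
    (ι := fun θ : ℝ => θ) (F := fun z : (Y × ℝ) × ℝ => fderiv ℝ g (z.1.1, z.1.2 * z.2) (0, 1))
    (integrable_const _) measurable_id (isCompact_Icc (a := (0 : ℝ)) (b := 1)) ?_ ?_
  · filter_upwards [ae_restrict_mem measurableSet_Ioc] with θ hθ using ⟨hθ.1.le, hθ.2⟩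
  · have : ContDiff ℝ ∞ (fderiv ℝ g) := hg.fderiv_right (by simp)
    exact (this.comp (by fun_prop)).clm_apply contDiff_const

theorem eq_add_smul_hquot [CompleteSpace G] {g : Y × ℝ → G} (hg : ContDiff ℝ ∞ g) (y : Y) (t : ℝ) :
    g (y, t) = g (y, 0) + t • hquot g (y, t) := by
  have hd : ∀ θ : ℝ, HasDerivAt (fun θ => g (y, t * θ))
      (t • fderiv ℝ g (y, t * θ) (0, 1)) θ := by
    intro θ
    have h1 := (hg.differentiable (by simp) (y, t * θ)).hasFDerivAt
    have h2 : HasDerivAt (fun θ : ℝ => (y, t * θ)) ((0 : Y), t * 1) θ :=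
      (hasDerivAt_const θ y).prodMk ((hasDerivAt_id θ).const_mul t)
    have h3 := h1.comp_hasDerivAt θ h2
    have : ((0 : Y), t * 1) = t • ((0 : Y), (1 : ℝ)) := by simp
    rw [this, map_smul] at h3
    exact h3
  have hc : Continuous fun θ : ℝ => t • fderiv ℝ g (y, t * θ) (0, 1) := by
    have : Continuous (fderiv ℝ g) := hg.continuous_fderiv (by simp)
    have h2 : Continuous fun θ : ℝ => fderiv ℝ g (y, t * θ) := this.comp (by fun_prop)
    exact (h2.clm_apply continuous_const).const_smul t
  have := intervalIntegral.integral_eq_sub_of_hasDerivAt (fun θ _ => hd θ)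
    (hc.intervalIntegrable 0 1)
  rw [intervalIntegral.integral_of_le zero_le_one] at this
  simp only [mul_one, mul_zero] at this
  simp only [hquot, one_smul]
  rw [← integral_smul, this]
  abel

/-- The `k`-th Taylor coefficient in the last variable at `0`. -/
noncomputable def tcoeff (g : Y × ℝ → G) (k : ℕ) (y : Y) : G := (hquot^[k] g) (y, 0)

theorem contDiff_hquot_iterate [FiniteDimensional ℝ Y] [CompleteSpace G] {g : Y × ℝ → G}
    (hg : ContDiff ℝ ∞ g) (k : ℕ) : ContDiff ℝ ∞ (hquot^[k] g) := by
  induction k with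
  | zero => exact hg
  | succ k ih => rw [Function.iterate_succ_apply']; exact contDiff_hquot ih

theorem contDiff_tcoeff [FiniteDimensional ℝ Y] [CompleteSpace G] {g : Y × ℝ → G}
    (hg : ContDiff ℝ ∞ g) (k : ℕ) : ContDiff ℝ ∞ (tcoeff g k) :=
  (contDiff_hquot_iterate hg k).comp (by fun_prop)

/-- Taylor's formula in the last variable, with smooth remainder. -/
theorem eq_sum_tcoeff_add [FiniteDimensional ℝ Y] [CompleteSpace G] {g : Y × ℝ → G}
    (hg : ContDiff ℝ ∞ g) (K : ℕ) (y : Y) (t : ℝ) :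
    g (y, t) = ∑ k ∈ Finset.range K, t ^ k • tcoeff g k y + t ^ K • (hquot^[K] g) (y, t) := by
  induction K with
  | zero => simp
  | succ K ih =>
    rw [ih, Finset.sum_range_succ, add_assoc, tcoeff, Function.iterate_succ_apply',
      eq_add_smul_hquot (contDiff_hquot_iterate hg K) y t, smul_add, smul_smul, pow_succ]

/-- Differentiation in `t` reverses parity, so every Hadamard quotient multiplies the parity sign by
`-1`; this is what kills the odd Taylor coefficients of an even function. -/
theorem hquot_neg {g : Y × ℝ → G} {c : ℝ} (h : ∀ y t, g (y, -t) = c • g (y, t)) :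
    ∀ y t, hquot g (y, -t) = (-c) • hquot g (y, t) := by
  intro y t
  have key : ∀ z : Y × ℝ, fderiv ℝ g (z.1, -z.2) (0, 1) = (-c) • fderiv ℝ g z (0, 1) := by
    intro z
    let e : (Y × ℝ) ≃L[ℝ] (Y × ℝ) :=
      (ContinuousLinearEquiv.refl ℝ Y).prodCongr (ContinuousLinearEquiv.neg ℝ)
    have he : g ∘ e = c • g := by
      funext z
      exact h z.1 z.2
    have h1 : fderiv ℝ (g ∘ e) z = (fderiv ℝ g (e z)).comp (e : (Y × ℝ) →L[ℝ] (Y × ℝ)) :=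
      e.comp_right_fderiv
    rw [he, fderiv_const_smul_field] at h1
    have h2 := congrArg (fun L => L ((0 : Y), (-1 : ℝ))) h1
    have h3 : ((0 : Y), (-1 : ℝ)) = -((0 : Y), (1 : ℝ)) := by simp
    simp only [ContinuousLinearMap.comp_apply, FunLike.coe_smul, Pi.smul_apply] at h2
    have h4 : e ((0 : Y), (-1 : ℝ)) = ((0 : Y), (1 : ℝ)) := by simp [e]
    have h5 : e z = (z.1, -z.2) := rfl
    rw [ContinuousLinearEquiv.coe_coe, h4, h5, h3, map_neg, smul_neg] at h2
    rw [← h2, neg_smul]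
  simp only [hquot, one_smul]
  rw [← integral_smul]
  refine integral_congr_ae (Filter.Eventually.of_forall fun θ => ?_)
  simpa using key (y, t * θ)

theorem tcoeff_odd_eq_zero [CompleteSpace G] {g : Y × ℝ → G}
    (h : ∀ y t, g (y, -t) = g (y, t)) {k : ℕ} (hk : Odd k) (y : Y) : tcoeff g k y = 0 := by
  have key : ∀ k : ℕ, ∀ y t, (hquot^[k] g) (y, -t) = ((-1 : ℝ) ^ k) • (hquot^[k] g) (y, t) := by
    intro k
    induction k with
    | zero => simpa using h
    | succ k ih =>
      intro y t
      rw [Function.iterate_succ_apply', hquot_neg ih, pow_succ, mul_neg_one]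
  have := key k y 0
  rw [neg_zero, hk.neg_one_pow, neg_smul, one_smul] at this
  have h2 : (2 : ℝ) • (hquot^[k] g) (y, 0) = 0 := by
    rw [two_smul]
    nth_rewrite 2 [this]
    exact add_neg_cancel _
  exact (smul_eq_zero.1 h2).resolve_left two_ne_zero

end Hadamard

/-! ### Borel's lemma with parameters -/

section Borel

variable {X : Type*} [NormedAddCommGroup X] [NormedSpace ℝ X]
  {G : Type*} [NormedAddCommGroup G] [NormedSpace ℝ G]

/-- A smooth real cut-off function equal to `1` on `[-R, R]`, vanishing outside `(-2R, 2R)`. -/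
theorem exists_cutoff (R : ℝ) (hR : 0 < R) : ∃ κ : ℝ → ℝ, ContDiff ℝ ∞ κ ∧
    (∀ t, |t| ≤ R → κ t = 1) ∧ (∀ t, 2 * R ≤ |t| → κ t = 0) := by
  let f : ContDiffBump (0 : ℝ) := ⟨R, 2 * R, hR, by linarith⟩
  refine ⟨f, f.contDiff, fun t ht => f.one_of_mem_closedBall ?_, fun t ht => f.zero_of_le_dist ?_⟩
  · simpa using ht
  · simpa using ht

/-- Every derivative costs at most a factor `ε⁻¹` while the prefactor gains `ε^n`, a net gain as
soon as `i < n`. The condition `ε ≤ 1` enters because the variable in `X` is not rescaled. -/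
theorem norm_iteratedFDeriv_dilate_le {v : X × ℝ → G} (hv : ContDiff ℝ ∞ v) {C : ℝ} {i : ℕ}
    (hC : ∀ z, ‖iteratedFDeriv ℝ i v z‖ ≤ C) {ε : ℝ} (hε : 0 < ε) (hε1 : ε ≤ 1) (n : ℕ)
    (z : X × ℝ) :
    ‖iteratedFDeriv ℝ i (fun z : X × ℝ => ε ^ n • v (z.1, z.2 / ε)) z‖ ≤ ε ^ n * (C * ε⁻¹ ^ i) := by
  let L : X × ℝ →L[ℝ] X × ℝ :=
    (ContinuousLinearMap.fst ℝ X ℝ).prod (ε⁻¹ • ContinuousLinearMap.snd ℝ X ℝ)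
  have hL : ‖L‖ ≤ ε⁻¹ := by
    refine ContinuousLinearMap.opNorm_le_bound _ (by positivity) fun z => ?_
    have h1 : 1 ≤ ε⁻¹ := (one_le_inv₀ hε).2 hε1
    simp only [L, ContinuousLinearMap.prod_apply, ContinuousLinearMap.coe_fst',
      FunLike.coe_smul, Pi.smul_apply, ContinuousLinearMap.coe_snd', Prod.norm_def, norm_smul,
      Real.norm_of_nonneg (inv_nonneg.2 hε.le)]
    refine max_le ?_ ?_
    · calc ‖z.1‖ ≤ max ‖z.1‖ ‖z.2‖ := le_max_left _ _
        _ ≤ ε⁻¹ * max ‖z.1‖ ‖z.2‖ := le_mul_of_one_le_left (by positivity) h1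
    · gcongr
      exact le_max_right _ _
  have hfun : (fun z : X × ℝ => ε ^ n • v (z.1, z.2 / ε)) = (ε ^ n) • (v ∘ L) := by
    funext z
    simp [L, div_eq_inv_mul]
  have hcd : ContDiff ℝ i (v ∘ L) := (contDiff_infty.1 hv i).comp L.contDiff
  rw [hfun, iteratedFDeriv_const_smul_apply hcd.contDiffAt, norm_smul,
    L.iteratedFDeriv_comp_right (contDiff_infty.1 hv i) z le_rfl,
    Real.norm_of_nonneg (by positivity)]
  gcongr
  refine (ContinuousMultilinearMap.norm_compContinuousLinearMap_le _ _).trans ?_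
  simp only [Finset.prod_const, Finset.card_univ, Fintype.card_fin]
  have : 0 ≤ C := (norm_nonneg _).trans (hC z)
  gcongr
  exact hC _

/-- Borel's lemma with parameters. -/
theorem exists_contDiff_expansion [CompleteSpace G] (c : ℕ → X → G)
    (hc : ∀ k, ContDiff ℝ ∞ (c k)) {K : Set X} (hK : IsCompact K)
    (hcK : ∀ k, ∀ x ∉ K, c k x = 0) :
    ∃ φ : X × ℝ → G, ContDiff ℝ ∞ φ ∧ (∀ z : X × ℝ, z ∉ K ×ˢ Icc (-1 : ℝ) 1 → φ z = 0) ∧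
      ∀ N : ℕ, ∃ ψ : X × ℝ → G, ContDiff ℝ ∞ ψ ∧
        ∀ x t, φ (x, t) = ∑ k ∈ Finset.range N, t ^ k • c k x + t ^ N • ψ (x, t) := by
  obtain ⟨χ, hχ, hχ1, hχ0⟩ := exists_cutoff (1 / 2) (by norm_num)
  norm_num at hχ0
  -- The power `n` of `t` is decoupled from the index `k`: dividing the tail of the series by `t^N`
  -- leaves the terms `u (k + N) k`, whose sum must be smooth as well.
  let v : ℕ → ℕ → X × ℝ → G := fun k n z => (z.2 ^ n * χ z.2) • c k z.1
  have hv : ∀ k n, ContDiff ℝ ∞ (v k n) := fun k n =>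
    ((contDiff_snd.pow n).mul (hχ.comp contDiff_snd)).smul ((hc k).comp contDiff_fst)
  have hvs : ∀ k n, HasCompactSupport (v k n) := fun k n => by
    refine HasCompactSupport.intro (hK.prod (isCompact_Icc (a := (-1 : ℝ)) (b := 1))) fun z hz => ?_
    by_cases h1 : z.1 ∈ K
    · have h2 : z.2 ∉ Icc (-1 : ℝ) 1 := fun h2 => hz ⟨h1, h2⟩
      have : 1 ≤ |z.2| := by
        by_contra! h
        exact h2 (abs_le.1 h.le)
      simp [v, hχ0 _ this]
    · simp [v, hcK k _ h1]
  have hB : ∀ k n i, ∃ C, ∀ z, ‖iteratedFDeriv ℝ i (v k n) z‖ ≤ C := fun k n i =>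
    ((hvs k n).iteratedFDeriv i).exists_bound_of_continuous
      ((hv k n).continuous_iteratedFDeriv (by exact_mod_cast le_top))
  choose B hB using hB
  have hB0 : ∀ k n i, 0 ≤ B k n i := fun k n i => (norm_nonneg _).trans (hB k n i 0)
  let S : ℕ → ℝ := fun k => ∑ n ∈ Finset.range (k + 1), ∑ i ∈ Finset.range (k + 1), B k n i
  have hS0 : ∀ k, 0 ≤ S k := fun k =>
    Finset.sum_nonneg fun n _ => Finset.sum_nonneg fun i _ => hB0 k n i
  have hBS : ∀ k n i, n ≤ k → i ≤ k → B k n i ≤ S k := fun k n i hn hi =>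
    (Finset.single_le_sum (f := fun i => B k n i) (fun i _ => hB0 k n i)
      (Finset.mem_range.2 (Nat.lt_succ_of_le hi))).trans
    (Finset.single_le_sum (f := fun n => ∑ i ∈ Finset.range (k + 1), B k n i)
      (fun n _ => Finset.sum_nonneg fun i _ => hB0 k n i)
      (Finset.mem_range.2 (Nat.lt_succ_of_le hn)))
  -- `S k` dominates every `B k n i` with `n, i ≤ k`, so this choice gives `ε k * B k n i ≤
  -- (1/2)^k`.
  let ε : ℕ → ℝ := fun k => (1 / 2) ^ k * (1 + S k)⁻¹
  have hε : ∀ k, 0 < ε k := fun k => by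
    have := hS0 k
    positivity
  have hε1 : ∀ k, ε k ≤ 1 := fun k => by
    have h1 : (1 + S k)⁻¹ ≤ 1 := inv_le_one_of_one_le₀ (by linarith [hS0 k])
    have h2 : ((1 : ℝ) / 2) ^ k ≤ 1 := pow_le_one₀ (by norm_num) (by norm_num)
    have h3 : 0 ≤ (1 + S k)⁻¹ := inv_nonneg.2 (by linarith [hS0 k])
    exact mul_le_one₀ h2 h3 h1
  let u : ℕ → ℕ → X × ℝ → G := fun k n z => (z.2 ^ n * χ (z.2 / ε k)) • c k z.1
  have huv : ∀ k n, u k n = fun z => ε k ^ n • v k n (z.1, z.2 / ε k) := fun k n => by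
    funext z
    simp only [u, v, smul_smul, div_pow]
    congr 1
    have := (hε k).ne'
    field_simp
  have hu : ∀ k n, ContDiff ℝ ∞ (u k n) := fun k n =>
    ((contDiff_snd.pow n).mul (hχ.comp (contDiff_snd.div_const _))).smul ((hc k).comp contDiff_fst)
  have hub : ∀ k n i, i < n → n ≤ k → ∀ z, ‖iteratedFDeriv ℝ i (u k n) z‖ ≤ (1 / 2) ^ k := by
    intro k n i hin hnk z
    rw [huv]
    refine (norm_iteratedFDeriv_dilate_le (hv k n) (hB k n i) (hε k) (hε1 k) n z).trans ?_
    obtain ⟨d, rfl⟩ := Nat.exists_eq_add_of_lt hin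
    have h1 : ε k ^ (i + d + 1) * (B k (i + d + 1) i * (ε k)⁻¹ ^ i)
        = ε k ^ d * (ε k * B k (i + d + 1) i) := by
      have hh : ε k ^ i * (ε k)⁻¹ ^ i = 1 := by
        rw [← mul_pow, mul_inv_cancel₀ (hε k).ne', one_pow]
      linear_combination (ε k ^ (d + 1) * B k (i + d + 1) i) * hh
    have h2 : ε k * B k (i + d + 1) i ≤ (1 / 2) ^ k := by
      have h3 : B k (i + d + 1) i ≤ 1 + S k := by
        linarith [hBS k (i + d + 1) i hnk (by omega)]
      calc ε k * B k (i + d + 1) i ≤ ε k * (1 + S k) := by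
            have := (hε k).le
            gcongr
        _ = (1 / 2) ^ k := by
            have : 1 + S k ≠ 0 := by linarith [hS0 k]
            simp only [ε]
            field_simp
    rw [h1]
    calc ε k ^ d * (ε k * B k (i + d + 1) i) ≤ 1 * (ε k * B k (i + d + 1) i) := by
          have h5 : ε k ^ d ≤ 1 := pow_le_one₀ (hε k).le (hε1 k)
          have h6 : 0 ≤ ε k * B k (i + d + 1) i := mul_nonneg (hε k).le (hB0 _ _ _)
          gcongr
      _ ≤ _ := by rw [one_mul]; exact h2
  have hsum2 : Summable fun k : ℕ => ((1 : ℝ) / 2) ^ k :=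
    summable_geometric_of_lt_one (by norm_num) (by norm_num)
  have hT : ∀ N, ContDiff ℝ ∞ fun z => ∑' k, u (k + N) k z := by
    intro N
    refine contDiff_tsum_of_eventually (N := ⊤) (v := fun _ k => (1 / 2) ^ k) (fun k => hu _ _)
      (fun _ _ => hsum2) fun i _ => ?_
    rw [Nat.cofinite_eq_atTop]
    filter_upwards [Filter.eventually_gt_atTop i] with k hk z
    refine (hub (k + N) k i hk (by omega) z).trans ?_
    exact pow_le_pow_of_le_one (by norm_num) (by norm_num) (by omega)
  refine ⟨fun z => ∑' k, u k k z, hT 0, fun z hz => ?_, fun N => ?_⟩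
  · have : ∀ k, u k k z = 0 := fun k => by
      by_cases h1 : z.1 ∈ K
      · have h2 : z.2 ∉ Icc (-1 : ℝ) 1 := fun h2 => hz ⟨h1, h2⟩
        have h3 : 1 < |z.2| := by
          by_contra! h
          exact h2 (abs_le.1 h)
        have h4 : 1 ≤ |z.2 / ε k| := by
          rw [abs_div, abs_of_pos (hε k), one_le_div (hε k)]
          exact (hε1 k).trans h3.le
        simp [u, hχ0 _ h4]
      · simp [u, hcK k _ h1]
    simp [this]
  -- The first `N` terms are `t^k χ(t / ε k) c_k` instead of `t^k c_k`; the discrepancy vanishes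
  -- near `t = 0` and is therefore divisible by `t^N`.
  · have hflat : ∀ k, ContDiff ℝ ∞ fun t : ℝ => (χ (t / ε k) - 1) * (t ^ N)⁻¹ := fun k => by
      refine contDiff_div_pow_of_eventuallyEq_zero
        ((hχ.comp (contDiff_id.div_const _)).sub contDiff_const) ?_ N
      filter_upwards [Metric.ball_mem_nhds (0 : ℝ) (half_pos (hε k))] with t ht
      have : |t / ε k| ≤ 1 / 2 := by
        rw [mem_ball_zero_iff, Real.norm_eq_abs] at ht
        rw [abs_div, abs_of_pos (hε k), div_le_iff₀ (hε k)]
        linarith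
      simp [hχ1 _ this]
    refine ⟨fun z => ∑' k, u (k + N) k z + ∑ k ∈ Finset.range N,
      (z.2 ^ k * ((χ (z.2 / ε k) - 1) * (z.2 ^ N)⁻¹)) • c k z.1, ?_, fun x t => ?_⟩
    · refine (hT N).add (ContDiff.sum fun k _ => ?_)
      exact ((contDiff_snd.pow k).mul ((hflat k).comp contDiff_snd)).smul ((hc k).comp contDiff_fst)
    · have hs : Summable fun k => u k k (x, t) := by
        refine Summable.of_norm_bounded_eventually_nat hsum2 ?_
        filter_upwards [Filter.eventually_gt_atTop 0] with k hk
        simpa using hub k k 0 hk le_rfl (x, t)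
      have h1 : ∑' k, u (k + N) (k + N) (x, t) = t ^ N • ∑' k, u (k + N) k (x, t) := by
        rw [← tsum_const_smul'' (t ^ N)]
        refine tsum_congr fun k => ?_
        simp only [u, smul_smul]
        congr 1
        ring
      change ∑' k, u k k (x, t) = _
      rw [smul_add, ← hs.sum_add_tsum_nat_add N, h1, Finset.smul_sum, add_comm (t ^ N • _),
        ← add_assoc, ← Finset.sum_add_distrib]
      congr 1
      refine Finset.sum_congr rfl fun k _ => ?_
      simp only [u, smul_smul, ← add_smul]
      congr 1
      rcases eq_or_ne t 0 with rfl | ht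
      · have : χ 0 = 1 := hχ1 0 (by simp)
        simp [this]
      · field_simp
        ring
end Borel

/-! ### Smoothness of functions of `√t` -/

section Sqrt

variable {Y : Type} [NormedAddCommGroup Y] [NormedSpace ℝ Y]

/-- Each derivative in `t` costs two powers of `√t`: the derivative is again a sum of terms of the
same shape, with exponents `K` and `K - 2`. The convention `√t = 0` for `t < 0` makes the formula
valid on both sides of `0`. -/
theorem contDiff_sqrt_pow_smul (l : ℕ) : ∀ {G : Type*} [NormedAddCommGroup G] [NormedSpace ℝ G]
    {R : Y × ℝ → G} (_ : ContDiff ℝ ∞ R) {K : ℕ} (_ : 2 * l < K),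
    ContDiff ℝ l fun z : Y × ℝ => √z.2 ^ K • R (z.1, √z.2) := by
  induction l with
  | zero =>
    intro G _ _ R hR K _
    refine contDiff_zero.2 ?_
    have := hR.continuous
    fun_prop
  | succ l ih =>
    intro G _ _ R hR K hK
    have hdR : ContDiff ℝ ∞ (fderiv ℝ R) := hR.fderiv_right (by simp)
    let A : Y × ℝ → (Y × ℝ →L[ℝ] G) := fun z => (fderiv ℝ R z).comp
      ((ContinuousLinearMap.inl ℝ Y ℝ).comp (ContinuousLinearMap.fst ℝ Y ℝ))
    let B : Y × ℝ → (Y × ℝ →L[ℝ] G) := fun z => (ContinuousLinearMap.snd ℝ Y ℝ).smulRight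
      ((1 / 2 : ℝ) • ((K : ℝ) • R z + z.2 • fderiv ℝ R z (0, 1)))
    have hA : ContDiff ℝ ∞ A := hdR.clm_comp contDiff_const
    have hB : ContDiff ℝ ∞ B := by
      refine contDiff_const.smulRight (((hR.const_smul _).add
        (contDiff_snd.smul (hdR.clm_apply contDiff_const))).const_smul _)
    rw [Nat.cast_succ]
    refine contDiff_succ_iff_hasFDerivAt.2
      ⟨fun z => √z.2 ^ K • A (z.1, √z.2) + √z.2 ^ (K - 2) • B (z.1, √z.2),
      (ih hA (by omega)).add (ih hB (by omega)), fun z => ?_⟩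
    rcases lt_or_ge 0 z.2 with hz | hz
    · have hs : HasFDerivAt (fun z : Y × ℝ => √z.2)
          ((1 / (2 * √z.2)) • ContinuousLinearMap.snd ℝ Y ℝ) z :=
        (hasFDerivAt_snd (𝕜 := ℝ) (p := z)).sqrt hz.ne'
      have hR1 : HasFDerivAt (fun z : Y × ℝ => R (z.1, √z.2)) _ z :=
        ((hR.differentiable (by simp)) (z.1, √z.2)).hasFDerivAt.comp z
          ((hasFDerivAt_fst (𝕜 := ℝ) (p := z)).prodMk hs)
      refine ((hs.pow K).smul hR1).congr_fderiv ?_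
      have h0 : √z.2 ≠ 0 := (Real.sqrt_pos.2 hz).ne'
      ext w
      · simp [A, B]
      · have e1 : ((0 : Y), (√z.2)⁻¹ * 2⁻¹) = ((√z.2)⁻¹ * 2⁻¹) • ((0 : Y), (1 : ℝ)) := by simp
        obtain ⟨k, rfl⟩ : ∃ k, K = k + 2 := ⟨K - 2, by omega⟩
        simp only [A, B, Nat.add_sub_cancel, FunLike.coe_add, Pi.add_apply,
          FunLike.coe_smul, Pi.smul_apply, ContinuousLinearMap.comp_apply,
          ContinuousLinearMap.prod_apply, ContinuousLinearMap.inr_apply,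
          ContinuousLinearMap.coe_fst', ContinuousLinearMap.coe_snd',
          ContinuousLinearMap.smulRight_apply, one_div, mul_inv_rev,
          smul_eq_mul, mul_one, e1, map_smul, map_zero, smul_zero, zero_add,
          nsmul_eq_mul, smul_smul, smul_add]
        rw [add_comm]
        congr 2
        · field_simp
          exact pow_succ' _ _
        · field_simp
          ring
    -- For `z.2 ≤ 0` the function and its claimed derivative vanish at `z`. Nearby, `√^K` splits as
    -- `√^2`, which is `O(‖z' - z‖)`, times `√^(K-2)`, which tends to `0`.
    · have hz0 : √z.2 = 0 := Real.sqrt_eq_zero_of_nonpos hz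
      have hK2 : K - 2 ≠ 0 := by omega
      beta_reduce
      rw [hz0, zero_pow (by omega), zero_pow hK2, zero_smul, zero_smul, add_zero]
      rw [hasFDerivAt_iff_isLittleO]
      simp only [hz0, zero_pow (show K ≠ 0 by omega), zero_smul, sub_zero,
        zero_apply]
      have hg : Continuous fun z : Y × ℝ => √z.2 ^ (K - 2) • R (z.1, √z.2) := by
        have := hR.continuous
        fun_prop
      have ho : (fun z' : Y × ℝ => √z'.2 ^ (K - 2) • R (z'.1, √z'.2)) =o[𝓝 z]
          fun _ => (1 : ℝ) := by
        rw [Asymptotics.isLittleO_one_iff]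
        have := hg.tendsto z
        simpa [hz0, zero_pow hK2] using this
      have hO : (fun z' : Y × ℝ => √z'.2 ^ 2) =O[𝓝 z] fun z' => ‖z' - z‖ := by
        refine Asymptotics.IsBigO.of_bound 1 (Filter.Eventually.of_forall fun z' => ?_)
        rw [one_mul, norm_norm, Real.norm_of_nonneg (by positivity)]
        rcases le_or_gt 0 z'.2 with h | h
        · rw [Real.sq_sqrt h]
          calc z'.2 ≤ |(z' - z).2| := by
                rw [Prod.snd_sub]
                exact (by linarith : z'.2 ≤ z'.2 - z.2).trans (le_abs_self _)
            _ ≤ ‖z' - z‖ := by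
                rw [← Real.norm_eq_abs]
                exact norm_snd_le _
        · rw [Real.sqrt_eq_zero_of_nonpos h.le]
          simp
      have := hO.smul_isLittleO ho
      simp only [smul_eq_mul, mul_one, smul_smul, ← pow_add] at this
      rw [show 2 + (K - 2) = K by omega] at this
      exact this.of_norm_right

end Sqrt

/-! ### The radial weights `a^(p/2-1)` -/

section Weight

/-- The weight `a ↦ a^(p/2-1)` for `a > 0`, extended by `0`. -/
noncomputable def wt (p : ℕ) (a : ℝ) : ℝ := √a ^ p / a

theorem wt_nonpos {p : ℕ} (hp : 0 < p) {a : ℝ} (ha : a ≤ 0) : wt p a = 0 := by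
  simp [wt, Real.sqrt_eq_zero_of_nonpos ha, hp.ne']

theorem wt_nonneg {p : ℕ} (hp : 0 < p) (a : ℝ) : 0 ≤ wt p a := by
  rcases le_or_gt 0 a with h | h
  · unfold wt; positivity
  · exact (wt_nonpos hp h.le).ge

theorem wt_add (p i : ℕ) (a : ℝ) : wt (p + i) a = √a ^ i * wt p a := by
  simp only [wt, pow_add]; ring

theorem wt_add_two {p : ℕ} (hp : 0 < p) (a : ℝ) : wt (p + 2) a = a * wt p a := by
  rcases le_or_gt a 0 with h | h
  · rw [wt_nonpos hp h, wt_nonpos (by omega) h, mul_zero]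
  · rw [wt_add, Real.sq_sqrt h.le]

theorem wt_add_two_eq {p : ℕ} (hp : 0 < p) (a : ℝ) : wt (p + 2) a = √a ^ p := by
  rcases le_or_gt a 0 with h | h
  · rw [wt_nonpos (by omega) h, Real.sqrt_eq_zero_of_nonpos h, zero_pow hp.ne']
  · rw [wt_add, Real.sq_sqrt h.le, wt, mul_div_cancel₀ _ h.ne']

theorem measurable_wt (p : ℕ) : Measurable (wt p) := by
  unfold wt; fun_prop

theorem wt_eq_rpow (p : ℕ) {a : ℝ} (ha : 0 < a) : wt p a = a ^ ((p : ℝ) / 2 - 1) := by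
  rw [wt, Real.rpow_sub_one ha.ne', Real.sqrt_eq_rpow, ← Real.rpow_natCast, ← Real.rpow_mul ha.le]
  congr 2
  ring

theorem intervalIntegrable_wt {p : ℕ} (hp : 0 < p) (a b : ℝ) :
    IntervalIntegrable (wt p) volume a b := by
  have h0 : ∀ c, IntervalIntegrable (wt p) volume 0 c := by
    intro c
    rcases le_total c 0 with hc | hc
    · refine (intervalIntegrable_const (c := (0 : ℝ))).congr ?_
      intro x hx
      rw [uIoc_of_ge hc] at hx
      exact (wt_nonpos hp hx.2).symm
    · have : IntervalIntegrable (fun x : ℝ => x ^ ((p : ℝ) / 2 - 1)) volume 0 c := by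
        refine intervalIntegral.intervalIntegrable_rpow' ?_
        have : (1 : ℝ) ≤ p := by exact_mod_cast hp
        linarith
      refine this.congr ?_
      intro x hx
      rw [uIoc_of_le hc] at hx
      exact (wt_eq_rpow p hx.1).symm
  exact (h0 a).symm.trans (h0 b)

theorem integrableOn_wt {p : ℕ} (hp : 0 < p) (a b : ℝ) : IntegrableOn (wt p) (Ioc a b) := by
  rcases le_total a b with h | h
  · exact (intervalIntegrable_iff_integrableOn_Ioc_of_le h).1 (intervalIntegrable_wt hp a b)
  · rw [Ioc_eq_empty (not_lt.2 h)]; exact integrableOn_empty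

theorem contDiffAt_wt (p : ℕ) {a : ℝ} (ha : 0 < a) : ContDiffAt ℝ ∞ (wt p) a :=
  ((contDiffAt_id.sqrt ha.ne').pow p).div contDiffAt_id ha.ne'

end Weight

/-! ### The integral along hyperbolas: flat integrands -/

section Operator

variable {X : Type} [NormedAddCommGroup X] [NormedSpace ℝ X]
  {G : Type*} [NormedAddCommGroup G] [NormedSpace ℝ G]

/-- The integral of `h((x, s), r)`, `s = √b`, `r = √(b + t)`, along the hyperbola `r² - s² = t`. -/
noncomputable def hypInt (p q : ℕ) (h : (X × ℝ) × ℝ → G) (z : X × ℝ) : G :=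
  ∫ b, (wt q b * wt p (b + z.2)) • h ((z.1, √b), √(b + z.2))

/-- Translating `b` by `t` exchanges the two radii. Whatever is shown about the behaviour in `r`
thereby transfers to `s`. -/
theorem hypInt_swap (p q : ℕ) (h : (X × ℝ) × ℝ → G) (x : X) (t : ℝ) :
    hypInt p q h (x, t) = hypInt q p (fun w => h ((w.1.1, w.2), w.1.2)) (x, -t) := by
  simp only [hypInt]
  rw [← integral_add_right_eq_self (μ := volume)
    (fun b => (wt p b * wt q (b + -t)) • h ((x, √(b + -t)), √b)) t]
  simp only [add_neg_cancel_right, mul_comm (wt p _)]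

/-- The factor `wt q b` is an integrable weight independent of the parameters, and `wt p (b + t)`
combines with `r^K` into `√(b + t)^(K + p - 2)`, to which `contDiff_sqrt_pow_smul` applies. The
factorisation of `h` matters only for `r > 0`, since the weight vanishes when `b + t ≤ 0`. -/
theorem contDiff_hypInt_of_flat [FiniteDimensional ℝ X] [CompleteSpace G] {p q : ℕ} (hp : 0 < p)
    (hq : 0 < q) {h R : (X × ℝ) × ℝ → G} (hR : ContDiff ℝ ∞ R) {K l : ℕ} (hK : 2 * l < K + p - 2)
    (hhR : ∀ w, 0 < w.2 → h w = w.2 ^ K • R w) {S : ℝ}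
    (hS : ∀ w, S ≤ w.1.2 → h w = 0) : ContDiff ℝ l (hypInt p q h) := by
  have hcore : ∀ (z : X × ℝ) (b : ℝ), wt p (b + z.2) • h ((z.1, √b), √(b + z.2)) =
      √(z.2 + b) ^ (K + p - 2) • R ((z.1, √b), √(z.2 + b)) := by
    intro z b
    rw [add_comm z.2 b]
    rcases le_or_gt (b + z.2) 0 with ha | ha
    · rw [wt_nonpos hp ha, Real.sqrt_eq_zero_of_nonpos ha, zero_pow (by omega), zero_smul,
        zero_smul]
    · rw [hhR _ (Real.sqrt_pos.2 ha), smul_smul, mul_comm, ← wt_add,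
        show p + K = (K + p - 2) + 2 by omega, wt_add_two_eq (by omega)]
  have hfun : hypInt p q h = fun z : X × ℝ => ∫ b in Ioc 0 (S ^ 2), wt q b •
      (√(z.2 + b) ^ (K + p - 2) • R ((z.1, √b), √(z.2 + b))) := by
    funext z
    rw [setIntegral_eq_integral_of_forall_compl_eq_zero]
    · refine integral_congr_ae (Filter.Eventually.of_forall fun b => ?_)
      simp only [mul_smul]
      congr 1
      exact hcore z b
    · intro b hb
      rw [← hcore z b]
      rcases le_or_gt b 0 with hb0 | hb0
      · rw [wt_nonpos hq hb0, zero_smul]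
      · have h1 : S ^ 2 < b := by
          by_contra! h1
          exact hb ⟨hb0, h1⟩
        have h2 : S ≤ √b := (le_abs_self S).trans (Real.abs_le_sqrt h1.le)
        rw [hS _ h2, smul_zero, smul_zero]
  rw [hfun]
  have key := contDiff_sqrt_pow_smul (Y := X × ℝ) l hR hK
  -- Both `b` and `√b` are recorded as integration variables, so the failure of `√b` to be smooth at
  -- `b = 0` plays no role.
  refine contDiff_integral_param_nat (Z := X × ℝ) (V := ℝ × ℝ) l
    (ι := fun b : ℝ => (b, √b)) (C := Icc 0 (S ^ 2) ×ˢ Icc 0 |S|)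
    (F := fun z : (X × ℝ) × (ℝ × ℝ) => √(z.1.2 + z.2.1) ^ (K + p - 2) •
      R ((z.1.1, z.2.2), √(z.1.2 + z.2.1))) (integrableOn_wt hq 0 (S ^ 2)) (by fun_prop)
    (isCompact_Icc.prod isCompact_Icc) ?_ ?_
  · filter_upwards [ae_restrict_mem measurableSet_Ioc] with b hb
    refine ⟨⟨hb.1.le, hb.2⟩, Real.sqrt_nonneg _, ?_⟩
    rw [← Real.sqrt_sq_eq_abs]
    exact Real.sqrt_le_sqrt hb.2
  · exact key.comp (f := fun z : (X × ℝ) × (ℝ × ℝ) => ((z.1.1, z.2.2), z.1.2 + z.2.1))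
      (by fun_prop)

end Operator

/-! ### The integral along hyperbolas away from `t = 0` -/

section Operator

variable {X : Type} [NormedAddCommGroup X] [NormedSpace ℝ X]
  {G : Type*} [NormedAddCommGroup G] [NormedSpace ℝ G]

/-- For `t > 0` the radius `r = √(b + t)` stays away from `0`, so removing from `h` a neighbourhood
of `r = 0` does not change the integral near `z`. What is left is divisible by every power of `r`,
and the flat case gives any order of differentiability. -/
theorem contDiffAt_hypInt_of_pos [FiniteDimensional ℝ X] [CompleteSpace G] {p q : ℕ} (hp : 0 < p)
    (hq : 0 < q) {h : (X × ℝ) × ℝ → G} (hh : ContDiff ℝ ∞ h) {S : ℝ}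
    (hS : ∀ w, S ≤ w.1.2 → h w = 0) {z : X × ℝ} (hz : 0 < z.2) :
    ContDiffAt ℝ ∞ (hypInt p q h) z := by
  refine contDiffAt_infty.2 fun l => ?_
  set δ := √(z.2 / 2) / 2 with hδ
  have hδ0 : 0 < δ := by positivity
  obtain ⟨κ, hκ, hκ1, hκ0⟩ := exists_cutoff δ hδ0
  have hζ : ContDiff ℝ ∞ fun r => 1 - κ r := contDiff_const.sub hκ
  have hζ0 : (fun r => 1 - κ r) =ᶠ[𝓝 0] 0 := by
    filter_upwards [Metric.ball_mem_nhds (0 : ℝ) hδ0] with r hr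
    rw [mem_ball_zero_iff, Real.norm_eq_abs] at hr
    simp [hκ1 r hr.le]
  have hR : ContDiff ℝ ∞ fun w : (X × ℝ) × ℝ => ((1 - κ w.2) * (w.2 ^ (2 * l + 3))⁻¹) • h w :=
    ((contDiff_div_pow_of_eventuallyEq_zero hζ hζ0 (2 * l + 3)).comp contDiff_snd).smul hh
  have h1 := contDiff_hypInt_of_flat (h := fun w => (1 - κ w.2) • h w) hp hq hR
    (K := 2 * l + 3) (l := l) (by omega) (S := S) (fun w hw => by
      rw [smul_smul]
      congr 1
      field_simp) (fun w hw => by rw [hS w hw, smul_zero])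
  refine h1.contDiffAt.congr_of_eventuallyEq ?_
  have : ∀ᶠ w : X × ℝ in 𝓝 z, z.2 / 2 < w.2 :=
    continuous_snd.continuousAt.eventually (lt_mem_nhds (by linarith))
  filter_upwards [this] with w hw
  refine integral_congr_ae (Filter.Eventually.of_forall fun b => ?_)
  dsimp only
  rcases le_or_gt b 0 with hb | hb
  · rw [wt_nonpos hq hb, zero_mul, zero_smul, zero_smul]
  · have : 2 * δ ≤ |√(b + w.2)| := by
      rw [abs_of_nonneg (Real.sqrt_nonneg _), hδ, mul_div_cancel₀ _ two_ne_zero]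
      exact Real.sqrt_le_sqrt (by linarith)
    rw [hκ0 _ this, sub_zero, one_smul]

theorem contDiffAt_hypInt [FiniteDimensional ℝ X] [CompleteSpace G] {p q : ℕ} (hp : 0 < p)
    (hq : 0 < q) {h : (X × ℝ) × ℝ → G} (hh : ContDiff ℝ ∞ h) {S : ℝ}
    (hS : ∀ w, S ≤ w.1.2 → h w = 0) (hS' : ∀ w, S ≤ w.2 → h w = 0) {z : X × ℝ} (hz : z.2 ≠ 0) :
    ContDiffAt ℝ ∞ (hypInt p q h) z := by
  rcases lt_or_gt_of_ne hz with h0 | h0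
  · have h1 : hypInt p q h = (hypInt q p fun w => h ((w.1.1, w.2), w.1.2)) ∘
        fun z : X × ℝ => (z.1, -z.2) := by
      funext z
      exact hypInt_swap p q h z.1 z.2
    rw [h1]
    refine ContDiffAt.comp z ?_ (by fun_prop)
    have h0' : 0 < ((z.1, -z.2) : X × ℝ).2 := by simpa using h0
    exact contDiffAt_hypInt_of_pos (X := X) (h := fun w => h ((w.1.1, w.2), w.1.2)) hq hp
      (hh.comp (by fun_prop)) (S := S) (fun w hw => hS' _ hw) h0'
  · exact contDiffAt_hypInt_of_pos hp hq hh hS h0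

/-- For `t ≠ 0` the singularities at `b = 0` and `b = -t` are separated: at the lower end `max 0
(-t)` of the support only one factor is singular, and that one is integrable. -/
theorem integrableOn_wt_mul_wt {p q : ℕ} (hp : 0 < p) (hq : 0 < q) {t : ℝ} (ht : t ≠ 0) (B : ℝ) :
    IntegrableOn (fun b => wt q b * wt p (b + t)) (Iic B) := by
  have hz : ∀ b ≤ max 0 (-t), wt q b * wt p (b + t) = 0 := by
    intro b hb
    rcases le_max_iff.1 hb with h | h
    · rw [wt_nonpos hq h, zero_mul]
    · rw [wt_nonpos hp (by linarith : b + t ≤ 0), mul_zero]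
  have h1 : IntegrableOn (fun b => wt q b * wt p (b + t)) (Iic (max 0 (-t))) :=
    integrableOn_zero.congr_fun (fun b hb => (hz b hb).symm) measurableSet_Iic
  have h2 : IntegrableOn (fun b => wt q b * wt p (b + t)) (Ioc (max 0 (-t)) B) := by
    rcases lt_or_gt_of_ne ht with h0 | h0
    · rw [max_eq_right (by linarith)]
      refine IntegrableOn.continuousOn_mul_of_subset (K := Icc (-t) B) (fun b hb => ?_) ?_
        isCompact_Icc measurableSet_Ioc Ioc_subset_Icc_self
      · exact (contDiffAt_wt q (by linarith [hb.1] : 0 < b)).continuousAt.continuousWithinAt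
      · rcases le_total (-t) B with h | h
        · have := (intervalIntegrable_wt hp 0 (B + t)).comp_add_right t
          rw [zero_sub, add_sub_cancel_right] at this
          exact (intervalIntegrable_iff_integrableOn_Ioc_of_le h).1 this
        · rw [Ioc_eq_empty (not_lt.2 h)]; exact integrableOn_empty
    · rw [max_eq_left (by linarith)]
      refine IntegrableOn.mul_continuousOn_of_subset (K := Icc 0 B) (integrableOn_wt hq 0 B)
        (fun b hb => ?_) measurableSet_Ioc isCompact_Icc Ioc_subset_Icc_self
      have : 0 < b + t := by linarith [hb.1]
      exact ((contDiffAt_wt p this).continuousAt.comp (f := fun b => b + t)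
        (by fun_prop)).continuousWithinAt
  refine (h1.union h2).mono_set fun b hb => ?_
  rcases le_or_gt b (max 0 (-t)) with h | h
  · exact Or.inl h
  · exact Or.inr ⟨h, hb⟩

theorem integrable_hypInt {p q : ℕ} (hp : 0 < p)
    (hq : 0 < q) {h : (X × ℝ) × ℝ → G} (hh : Continuous h) {S : ℝ}
    (hS : ∀ w, S ≤ w.1.2 → h w = 0) {z : X × ℝ} (hz : z.2 ≠ 0) :
    Integrable fun b => (wt q b * wt p (b + z.2)) • h ((z.1, √b), √(b + z.2)) := by
  have h1 : IntegrableOn (fun b => wt q b * wt p (b + z.2)) (Ioc 0 (S ^ 2)) :=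
    (integrableOn_wt_mul_wt hp hq hz (S ^ 2)).mono_set fun b hb => hb.2
  have h2 := integrable_smul_comp (ι := fun b : ℝ => b) h1 measurable_id
    (isCompact_Icc (a := 0) (b := S ^ 2)) ?_ (F := fun b => h ((z.1, √b), √(b + z.2))) (by fun_prop)
  · refine (integrable_indicator_iff measurableSet_Ioc).2 h2 |>.congr ?_
    refine Filter.Eventually.of_forall fun b => ?_
    by_cases hb : b ∈ Ioc 0 (S ^ 2)
    · rw [indicator_of_mem hb]
    · rw [indicator_of_notMem hb]
      beta_reduce
      rcases le_or_gt b 0 with hb0 | hb0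
      · rw [wt_nonpos hq hb0, zero_mul, zero_smul]
      · have h1 : S ^ 2 < b := by
          by_contra! h1
          exact hb ⟨hb0, h1⟩
        have h2 : S ≤ √b := (le_abs_self S).trans (Real.abs_le_sqrt h1.le)
        rw [hS _ h2, smul_zero]
  · filter_upwards [ae_restrict_mem measurableSet_Ioc] with b hb using ⟨hb.1.le, hb.2⟩

end Operator

/-! ### The singularity of the incomplete Beta integral -/

section Beta

/-- The incomplete Beta-type integral `∫ b^(q/2-1) (b+t)^(p/2-1) db` over `b ≤ 1`. -/
noncomputable def betaInt (p q : ℕ) (t : ℝ) : ℝ := ∫ b in Iic (1 : ℝ), wt q b * wt p (b + t)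

/-- The integrand vanishes for `b ≤ max 0 (-t)`. It may blow up at that endpoint, so the fundamental
theorem of calculus is used with an antiderivative that is only continuous there. -/
theorem betaInt_eq_sub {p q : ℕ} (hp : 0 < p) (hq : 0 < q) {t : ℝ} (ht : t ≠ 0) (ht1 : -1 < t)
    {f F : ℝ → ℝ} (hF : ContinuousOn F (Icc (max 0 (-t)) 1))
    (hf : ∀ b ≤ (1 : ℝ), f b = wt q b * wt p (b + t))
    (hd : ∀ b, 0 < b → 0 < b + t → HasDerivAt F (f b) b) :
    ∫ b in Iic (1 : ℝ), wt q b * wt p (b + t) = F 1 - F (max 0 (-t)) := by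
  have hc : max 0 (-t) ≤ 1 := max_le zero_le_one (by linarith)
  have hsub : Ioc (max 0 (-t)) 1 ⊆ Iic 1 := fun b hb => hb.2
  have h1 : ∫ b in Iic (1 : ℝ), wt q b * wt p (b + t) =
      ∫ b in Ioc (max 0 (-t)) 1, wt q b * wt p (b + t) := by
    refine (setIntegral_eq_of_subset_of_forall_sdiff_eq_zero measurableSet_Iic hsub ?_)
    intro b hb
    have : b ≤ max 0 (-t) := by
      by_contra! h
      exact hb.2 ⟨h, hb.1⟩
    rcases le_max_iff.1 this with h | h
    · rw [wt_nonpos hq h, zero_mul]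
    · rw [wt_nonpos hp (by linarith : b + t ≤ 0), mul_zero]
  rw [h1, ← intervalIntegral.integral_of_le hc]
  refine intervalIntegral.integral_eq_sub_of_hasDerivAt_of_le hc hF (fun b hb => ?_)
    ((intervalIntegrable_iff_integrableOn_Ioc_of_le hc).2
      ((integrableOn_wt_mul_wt hp hq ht 1).mono_set hsub))
  rw [← hf b hb.2.le]
  have h2 := (le_max_left 0 (-t)).trans_lt hb.1
  have h3 := (le_max_right 0 (-t)).trans_lt hb.1
  exact hd b h2 (by linarith)

theorem hasDerivAt_wt_add_two {q : ℕ} (hq : 0 < q) {b : ℝ} (hb : 0 < b) :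
    HasDerivAt (wt (q + 2)) (q / 2 * wt q b) b := by
  have h1 : wt (q + 2) = fun b => √b ^ q := funext fun b => wt_add_two_eq hq b
  rw [h1]
  refine ((Real.hasDerivAt_sqrt hb.ne').pow q).congr_deriv ?_
  have h0 : √b ≠ 0 := (Real.sqrt_pos.2 hb).ne'
  obtain ⟨k, rfl⟩ : ∃ k, q = k + 1 := ⟨q - 1, by omega⟩
  have h2 : wt (k + 1) b = √b ^ (k + 1) / (√b) ^ 2 := by rw [Real.sq_sqrt hb.le, wt]
  rw [h2, Nat.add_sub_cancel]
  field_simp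
  exact (pow_succ _ _).symm

theorem continuous_wt_add_two {q : ℕ} (hq : 0 < q) : Continuous (wt (q + 2)) := by
  have h1 : wt (q + 2) = fun b => √b ^ q := funext fun b => wt_add_two_eq hq b
  rw [h1]
  fun_prop

/-- Integrate `wt (p + 2) (b + t) = (b + t) * wt p (b + t)`. With `betaInt_parts` this is a linear
system for the integrals with indices `(p + 2, q)` and `(p, q + 2)`, solvable because `p + q ≠ 0`.
-/
theorem betaInt_add_two {p q : ℕ} (hp : 0 < p) (hq : 0 < q) {t : ℝ} (ht : t ≠ 0) :
    betaInt (p + 2) q t = betaInt p (q + 2) t + t * betaInt p q t := by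
  unfold betaInt
  rw [← integral_const_mul, ← integral_add (integrableOn_wt_mul_wt hp (by omega) ht 1)
    ((integrableOn_wt_mul_wt hp hq ht 1).const_mul t)]
  refine integral_congr_ae (Filter.Eventually.of_forall fun b => ?_)
  simp only [wt_add_two hp, wt_add_two hq]
  ring

/-- The left side integrates the derivative of `wt (q + 2) b * wt (p + 2) (b + t)`, whose boundary
value at `max 0 (-t)` is zero. -/
theorem betaInt_parts {p q : ℕ} (hp : 0 < p) (hq : 0 < q) {t : ℝ} (ht : t ≠ 0) (ht1 : -1 < t) :
    q / 2 * betaInt (p + 2) q t + p / 2 * betaInt p (q + 2) t = wt (p + 2) (1 + t) := by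
  have hi1 := integrableOn_wt_mul_wt (p := p + 2) (by omega) hq ht 1
  have hi2 := integrableOn_wt_mul_wt (q := q + 2) hp (by omega) ht 1
  have hc : max 0 (-t) ≤ 1 := max_le zero_le_one (by linarith)
  have hsub : Ioc (max 0 (-t)) 1 ⊆ Iic 1 := fun b hb => hb.2
  have hz : ∀ b ≤ max 0 (-t), ∀ p q : ℕ, 0 < p → 0 < q → wt q b * wt p (b + t) = 0 := by
    intro b hb p q hp hq
    rcases le_max_iff.1 hb with h | h
    · rw [wt_nonpos hq h, zero_mul]
    · rw [wt_nonpos hp (by linarith : b + t ≤ 0), mul_zero]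
  unfold betaInt
  rw [← integral_const_mul, ← integral_const_mul, ← integral_add (hi1.const_mul _)
    (hi2.const_mul _)]
  have h1 : ∫ b in Iic (1 : ℝ), (q / 2 * (wt q b * wt (p + 2) (b + t)) +
        p / 2 * (wt (q + 2) b * wt p (b + t))) =
      ∫ b in Ioc (max 0 (-t)) 1, (q / 2 * (wt q b * wt (p + 2) (b + t)) +
        p / 2 * (wt (q + 2) b * wt p (b + t))) := by
    refine (setIntegral_eq_of_subset_of_forall_sdiff_eq_zero measurableSet_Iic hsub ?_)
    intro b hb
    have : b ≤ max 0 (-t) := by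
      by_contra! h
      exact hb.2 ⟨h, hb.1⟩
    rw [hz b this _ _ (by omega) hq, hz b this _ _ hp (by omega)]
    ring
  rw [h1, ← intervalIntegral.integral_of_le hc]
  rw [intervalIntegral.integral_eq_sub_of_hasDerivAt_of_le
    (f := fun b => wt (q + 2) b * wt (p + 2) (b + t)) hc]
  · rw [hz _ le_rfl _ _ (by omega) (by omega), sub_zero]
    have : wt (q + 2) 1 = 1 := by simp [wt]
    rw [this, one_mul]
  · exact ((continuous_wt_add_two hq).mul ((continuous_wt_add_two hp).comp
      (by fun_prop))).continuousOn
  · intro b hb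
    have h2 := (le_max_left 0 (-t)).trans_lt hb.1
    have h3 := (le_max_right 0 (-t)).trans_lt hb.1
    have h4 : HasDerivAt (fun b => wt (p + 2) (b + t)) (p / 2 * wt p (b + t)) b :=
      (hasDerivAt_wt_add_two hp (by linarith : 0 < b + t)).comp_add_const b t
    refine ((hasDerivAt_wt_add_two hq h2).mul h4).congr_deriv ?_
    ring
  · exact (intervalIntegrable_iff_integrableOn_Ioc_of_le hc).2
      (IntegrableOn.mono_set (Integrable.add (hi1.const_mul _) (hi2.const_mul _)) hsub)

/-- Only the parities of the indices and their sum enter `η`. The sign appears for `p` even and `q`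
odd, where the power is one of `-t`. -/
theorem eta_congr_add_two {p q p' q' : ℕ} (hp : Even p' ↔ Even p) (hq : Even q' ↔ Even q)
    (h0 : 0 < p) (h0' : 0 < q) (h : p' + q' = p + q + 2) {t : ℝ} (ht : t ≠ 0) :
    eta p' q' t = (if Even p ∧ Odd q then -1 else 1) * t * eta p q t := by
  have e1 : (((p' + q' : ℕ) : ℝ) / 2 - 1) = ((p + q : ℕ) : ℝ) / 2 - 1 + 1 := by
    rw [h]; push_cast; ring
  have e2 : (p' + q') / 2 - 1 = (p + q) / 2 - 1 + 1 := by omega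
  simp only [eta, ← Nat.not_even_iff_odd, hp, hq, e1, e2]
  by_cases hpe : Even p <;> by_cases hqe : Even q <;>
    simp only [hpe, hqe, not_true_eq_false, not_false_eq_true, and_true, and_false, true_and,
      false_and, if_true, if_false, and_self]
  · ring
  · rcases lt_or_gt_of_ne ht with h1 | h1
    · rw [if_pos h1, if_pos h1, Real.rpow_add_one (by linarith)]
      ring
    · rw [if_neg h1.not_gt, if_neg h1.not_gt, mul_zero]
  · rcases lt_or_gt_of_ne ht with h1 | h1
    · rw [if_neg h1.not_gt, if_neg h1.not_gt, mul_zero]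
    · rw [if_pos h1, if_pos h1, Real.rpow_add_one (by linarith)]
      ring
  · ring

/-- `betaInt p q` is, near `0`, the sum of a smooth function and of a non-zero multiple of `η`. -/
def BetaExpansion (p q : ℕ) : Prop :=
  ∃ (A : ℝ → ℝ) (C : ℝ), ContDiffOn ℝ ∞ A (Ioo (-1) 1) ∧ C ≠ 0 ∧
    ∀ t, t ≠ 0 → |t| < 1 → betaInt p q t = A t + C * eta p q t

theorem contDiffOn_wt_one_add (p : ℕ) : ContDiffOn ℝ ∞ (fun t => wt p (1 + t)) (Ioo (-1) 1) :=
  fun t ht => ((contDiffAt_wt p (by linarith [ht.1] : 0 < 1 + t)).comp t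
    (by fun_prop)).contDiffWithinAt

/-- Eliminating `betaInt p (q + 2) t` from the two recurrences gives `(p + q)/2 * betaInt (p + 2) q
t = wt (p + 2) (1 + t) + p/2 * t * betaInt p q t`. The first term is smooth for `|t| < 1`, and
multiplication by `t` turns `η` into `±` the next `η`, so the constant is multiplied by `± p/(p + q)
≠ 0`. -/
theorem betaExpansion_step_left {p q : ℕ} (hp : 0 < p) (hq : 0 < q) (h : BetaExpansion p q) :
    BetaExpansion (p + 2) q := by
  obtain ⟨A, C, hA, hC, hAC⟩ := h
  have hp' : (0 : ℝ) < p := by exact_mod_cast hp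
  have hq' : (0 : ℝ) < q := by exact_mod_cast hq
  have he : ((if Even p ∧ Odd q then -1 else 1 : ℝ)) * (if Even p ∧ Odd q then -1 else 1) = 1 := by
    split_ifs <;> norm_num
  refine ⟨fun t => 2 / (p + q) * (wt (p + 2) (1 + t) + p / 2 * (t * A t)),
    p / (p + q) * (if Even p ∧ Odd q then -1 else 1) * C, ?_, ?_, fun t ht ht1 => ?_⟩
  · exact contDiffOn_const.mul ((contDiffOn_wt_one_add _).add
      (contDiffOn_const.mul (contDiffOn_id.mul hA)))
  · refine mul_ne_zero (mul_ne_zero (by positivity) ?_) hC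
    split_ifs <;> norm_num
  · have h1 := betaInt_add_two hp hq ht
    have h2 := betaInt_parts hp hq ht (abs_lt.1 ht1).1
    rw [eta_congr_add_two (by simp [Nat.even_add]) Iff.rfl hp hq (by omega) ht]
    rw [hAC t ht ht1] at h1
    have h3 : (p + q) / 2 * betaInt (p + 2) q t =
        wt (p + 2) (1 + t) + p / 2 * (t * (A t + C * eta p q t)) := by
      rw [← h2]
      linear_combination (p / 2 : ℝ) * h1
    have h4 : betaInt (p + 2) q t = 2 / (p + q) * ((p + q) / 2 * betaInt (p + 2) q t) := by
      field_simp
    rw [h4, h3]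
    field_simp
    linear_combination (-(p : ℝ) * t * C * eta p q t) * he

/-- The same elimination, now of `betaInt (p + 2) q t`, multiplies the constant by `∓ q/(p + q)`. -/
theorem betaExpansion_step_right {p q : ℕ} (hp : 0 < p) (hq : 0 < q) (h : BetaExpansion p q) :
    BetaExpansion p (q + 2) := by
  obtain ⟨A, C, hA, hC, hAC⟩ := h
  have hp' : (0 : ℝ) < p := by exact_mod_cast hp
  have hq' : (0 : ℝ) < q := by exact_mod_cast hq
  have he : ((if Even p ∧ Odd q then -1 else 1 : ℝ)) * (if Even p ∧ Odd q then -1 else 1) = 1 := by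
    split_ifs <;> norm_num
  refine ⟨fun t => 2 / (p + q) * (wt (p + 2) (1 + t) - q / 2 * (t * A t)),
    -(q / (p + q) * (if Even p ∧ Odd q then -1 else 1) * C), ?_, ?_, fun t ht ht1 => ?_⟩
  · exact contDiffOn_const.mul ((contDiffOn_wt_one_add _).sub
      (contDiffOn_const.mul (contDiffOn_id.mul hA)))
  · refine neg_ne_zero.2 (mul_ne_zero (mul_ne_zero (by positivity) ?_) hC)
    split_ifs <;> norm_num
  · have h1 := betaInt_add_two hp hq ht
    have h2 := betaInt_parts hp hq ht (abs_lt.1 ht1).1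
    rw [eta_congr_add_two Iff.rfl (by simp [Nat.even_add]) hp hq (by omega) ht]
    rw [hAC t ht ht1] at h1
    have h3 : (p + q) / 2 * betaInt p (q + 2) t =
        wt (p + 2) (1 + t) - q / 2 * (t * (A t + C * eta p q t)) := by
      rw [← h2]
      linear_combination (-q / 2 : ℝ) * h1
    have h4 : betaInt p (q + 2) t = 2 / (p + q) * ((p + q) / 2 * betaInt p (q + 2) t) := by
      field_simp
    rw [h4, h3]
    field_simp
    linear_combination ((q : ℝ) * t * C * eta p q t) * he

theorem wt_two {a : ℝ} (ha : 0 < a) : wt 2 a = 1 := by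
  rw [wt, Real.sq_sqrt ha.le, div_self ha.ne']

theorem wt_one {a : ℝ} (ha : 0 < a) : wt 1 a = 1 / √a := by
  rw [wt, pow_one, Real.sqrt_div_self', one_div]

/-- On its support the integrand is `1`, so the integral is `1 - max 0 (-t) = 1 + t/2 - |t|/2`. -/
theorem betaExpansion_two_two : BetaExpansion 2 2 := by
  refine ⟨fun t => 1 + t / 2, -1, by fun_prop, by norm_num, fun t ht ht1 => ?_⟩
  rw [betaInt, betaInt_eq_sub two_pos two_pos ht (abs_lt.1 ht1).1 (F := fun b => b)
    (by fun_prop) (fun b _ => rfl) (fun b hb hbt => by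
      rw [wt_two hb, wt_two hbt, one_mul]; exact hasDerivAt_id b)]
  have : eta 2 2 t = 1 / 2 * Real.sign t * t := by
    simp [eta, show ¬ Odd 2 by decide, show Even 2 by decide]
  rw [this]
  rcases lt_or_gt_of_ne ht with h | h
  · rw [max_eq_right (by linarith), Real.sign_of_neg h]; ring
  · rw [max_eq_left (by linarith), Real.sign_of_pos h]; ring

theorem sqrt_eq_rpow_half {n : ℕ} (hn : n = 3) (a : ℝ) : a ^ ((n : ℝ) / 2 - 1) = √a := by
  rw [hn, Real.sqrt_eq_rpow]; norm_num

theorem betaExpansion_one_two : BetaExpansion 1 2 := by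
  refine ⟨fun t => 2 * √(1 + t), -2, ?_, by norm_num, fun t ht ht1 => ?_⟩
  · intro t ht
    exact (contDiffAt_const.mul ((contDiffAt_const.add contDiffAt_id).sqrt
      (by simp only [id]; linarith [ht.1]))).contDiffWithinAt
  rw [betaInt, betaInt_eq_sub one_pos two_pos ht (abs_lt.1 ht1).1 (F := fun b => 2 * √(b + t))
    (by fun_prop) (fun b _ => rfl) (fun b hb hbt => by
      rw [wt_two hb, wt_one hbt]
      refine (((hasDerivAt_id b).add_const t).sqrt hbt.ne').const_mul 2 |>.congr_deriv ?_
      simp only [id]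
      field_simp)]
  have : eta 1 2 t = √t := by
    simp only [eta, odd_one, even_two, and_self, if_true]
    split_ifs with h
    · exact sqrt_eq_rpow_half rfl t
    · exact (Real.sqrt_eq_zero_of_nonpos (not_lt.1 h)).symm
  rw [this]
  rcases lt_or_gt_of_ne ht with h | h
  · rw [max_eq_right (by linarith), neg_add_cancel, Real.sqrt_zero, Real.sqrt_eq_zero_of_nonpos h.le]
    ring
  · rw [max_eq_left (by linarith), zero_add]; ring

theorem betaExpansion_two_one : BetaExpansion 2 1 := by
  refine ⟨fun t => 2, -2, by fun_prop, by norm_num, fun t ht ht1 => ?_⟩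
  rw [betaInt, betaInt_eq_sub two_pos one_pos ht (abs_lt.1 ht1).1 (F := fun b => 2 * √b)
    (by fun_prop) (fun b _ => rfl) (fun b hb hbt => by
      rw [wt_two hbt, wt_one hb]
      refine (Real.hasDerivAt_sqrt hb.ne').const_mul 2 |>.congr_deriv ?_
      field_simp)]
  have : eta 2 1 t = √(-t) := by
    simp only [eta, show ¬ Odd 2 by decide, odd_one, even_two, and_self, if_true, false_and,
      if_false]
    split_ifs with h
    · exact sqrt_eq_rpow_half rfl (-t)
    · exact (Real.sqrt_eq_zero_of_nonpos (by linarith)).symm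
  rw [this]
  rcases lt_or_gt_of_ne ht with h | h
  · rw [max_eq_right (by linarith), Real.sqrt_one]; ring
  · rw [max_eq_left (by linarith), Real.sqrt_eq_zero_of_nonpos (by linarith : -t ≤ 0),
      Real.sqrt_zero, Real.sqrt_one]; ring

/-- The antiderivative `2 log (√b + √(b + t))` equals `log |t|` at the lower endpoint, whatever the
sign of `t`. -/
theorem betaExpansion_one_one : BetaExpansion 1 1 := by
  refine ⟨fun t => 2 * Real.log (1 + √(1 + t)), -1, ?_, by norm_num, fun t ht ht1 => ?_⟩
  · intro t ht
    refine (contDiffAt_const.mul ((contDiffAt_const.add ((contDiffAt_const.add contDiffAt_id).sqrt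
      ?_)).log ?_)).contDiffWithinAt
    · simp only [id]; linarith [ht.1]
    · positivity
  have hpos : ∀ b ∈ Icc (max 0 (-t)) 1, √b + √(b + t) ≠ 0 := by
    intro b hb
    have h2 := (le_max_left 0 (-t)).trans hb.1
    have h3 := (le_max_right 0 (-t)).trans hb.1
    rcases lt_or_gt_of_ne ht with h | h
    · have : 0 < √b := Real.sqrt_pos.2 (by linarith)
      positivity
    · have : 0 < √(b + t) := Real.sqrt_pos.2 (by linarith)
      positivity
  rw [betaInt, betaInt_eq_sub one_pos one_pos ht (abs_lt.1 ht1).1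
    (F := fun b => 2 * Real.log (√b + √(b + t)))
    (ContinuousOn.mul continuousOn_const (ContinuousOn.log (by fun_prop) hpos)) (fun b _ => rfl)
    (fun b hb hbt => by
      have h1 := Real.sqrt_pos.2 hb
      have h2 := Real.sqrt_pos.2 hbt
      rw [wt_one hb, wt_one hbt]
      refine (((Real.hasDerivAt_sqrt hb.ne').add
        (((hasDerivAt_id b).add_const t).sqrt hbt.ne')).log
        (by simp only [id, Pi.add_apply]; positivity)).const_mul 2 |>.congr_deriv ?_
      simp only [id, Pi.add_apply]
      field_simp
      ring)]
  have : eta 1 1 t = Real.log |t| := by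
    simp [eta, show ¬ Even 1 by decide]
  rw [this]
  rcases lt_or_gt_of_ne ht with h | h
  · rw [max_eq_right (by linarith), Real.sqrt_one, neg_add_cancel, Real.sqrt_zero, add_zero,
      Real.log_sqrt (by linarith), abs_of_neg h]; ring
  · rw [max_eq_left (by linarith), Real.sqrt_one, Real.sqrt_zero, zero_add, zero_add,
      Real.log_sqrt h.le, abs_of_pos h]; ring

/-- Steps of two end at the four signatures with indices in `{1, 2}`, which represent the four
branches of `η`. -/
theorem betaExpansion : ∀ {p q : ℕ}, 0 < p → 0 < q → BetaExpansion p q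
  | 1, 1, _, _ => betaExpansion_one_one
  | 1, 2, _, _ => betaExpansion_one_two
  | 2, 1, _, _ => betaExpansion_two_one
  | 2, 2, _, _ => betaExpansion_two_two
  | p + 3, q, _, hq => betaExpansion_step_left (by omega) hq (betaExpansion (by omega) hq)
  | 1, q + 3, hp, _ => betaExpansion_step_right hp (by omega) (betaExpansion hp (by omega))
  | 2, q + 3, hp, _ => betaExpansion_step_right hp (by omega) (betaExpansion hp (by omega))

end Beta

/-! ### Splitting `ℝ^(p+q)` as a product -/

section Join

variable (p q : ℕ)

/-- The identification `ℝ^p × ℝ^q → ℝ^(p+q)`. -/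
noncomputable def join : Euc p × Euc q →L[ℝ] Euc (p + q) :=
  LinearMap.toContinuousLinearMap
    { toFun := fun y => WithLp.toLp 2 (Fin.append y.1 y.2)
      map_add' := fun y z => by
        ext i
        refine Fin.addCases (fun i => ?_) (fun i => ?_) i <;> simp
      map_smul' := fun c y => by
        ext i
        refine Fin.addCases (fun i => ?_) (fun i => ?_) i <;> simp }

variable {p q}

@[simp] theorem join_castAdd (y : Euc p × Euc q) (i : Fin p) :
    join p q y (Fin.castAdd q i) = y.1 i := by simp [join]

@[simp] theorem join_natAdd (y : Euc p × Euc q) (i : Fin q) :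
    join p q y (Fin.natAdd p i) = y.2 i := by simp [join]

theorem quadForm_join (y : Euc p × Euc q) :
    quadForm p q (join p q y) = ‖y.1‖ ^ 2 - ‖y.2‖ ^ 2 := by
  simp [quadForm, EuclideanSpace.real_norm_sq_eq]

theorem measurePreserving_join : MeasurePreserving (join p q) := by
  have h1 : MeasurePreserving (Prod.map (WithLp.ofLp (p := 2)) (WithLp.ofLp (p := 2)) :
      Euc p × Euc q → (Fin p → ℝ) × (Fin q → ℝ)) :=
    (PiLp.volume_preserving_ofLp (Fin p)).prod (PiLp.volume_preserving_ofLp (Fin q))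
  have h2 := volume_measurePreserving_sumPiEquivProdPi_symm
    (fun _ : Fin p ⊕ Fin q => ℝ)
  have h3 := volume_measurePreserving_piCongrLeft (fun _ : Fin (p + q) => ℝ)
    (finSumFinEquiv (m := p) (n := q))
  have h4 := PiLp.volume_preserving_toLp (Fin (p + q))
  convert h4.comp (h3.comp (h2.comp h1)) using 1
  funext y
  refine PiLp.ext fun i => ?_
  refine Fin.addCases (fun i => ?_) (fun i => ?_) i
  · rw [join_castAdd]
    simp only [Function.comp_apply]
    rw [← finSumFinEquiv_apply_left, MeasurableEquiv.coe_piCongrLeft,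
      Equiv.piCongrLeft_apply_apply]
    rfl
  · rw [join_natAdd]
    simp only [Function.comp_apply]
    rw [← finSumFinEquiv_apply_right, MeasurableEquiv.coe_piCongrLeft,
      Equiv.piCongrLeft_apply_apply]
    rfl

end Join

/-! ### Bipolar coordinates with squared radii -/

section Polar

/-- Substitute `r = √a`. Squared radii are preferred because the quadratic form becomes the linear
expression `a - b`. -/
theorem lintegral_Ioi_pow (p : ℕ) (hp : 0 < p) (g : ℝ → ℝ≥0∞) :
    ∫⁻ r in Ioi (0 : ℝ), ENNReal.ofReal (r ^ (p - 1)) * g r =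
      ∫⁻ a, ENNReal.ofReal (wt p a / 2) * g √a := by
  have himg : (fun a : ℝ => √a) '' Ioi 0 = Ioi 0 := by
    ext r
    constructor
    · rintro ⟨a, ha, rfl⟩
      exact Real.sqrt_pos.2 ha
    · intro hr
      exact ⟨r ^ 2, pow_pos (mem_Ioi.1 hr) 2, Real.sqrt_sq (le_of_lt hr)⟩
  have h1 := lintegral_image_eq_lintegral_abs_deriv_mul (s := Ioi 0) (f := fun a : ℝ => √a)
    (f' := fun a => 1 / (2 * √a)) measurableSet_Ioi
    (fun a ha => (Real.hasDerivAt_sqrt (ne_of_gt ha)).hasDerivWithinAt)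
    (fun a ha b hb h => (Real.sqrt_inj (le_of_lt ha) (le_of_lt hb)).1 h)
    (fun r => ENNReal.ofReal (r ^ (p - 1)) * g r)
  rw [himg] at h1
  rw [h1, ← lintegral_indicator measurableSet_Ioi]
  refine lintegral_congr fun a => ?_
  by_cases ha : a ∈ Ioi (0 : ℝ)
  · rw [indicator_of_mem ha, ← mul_assoc, ← ENNReal.ofReal_mul (abs_nonneg _)]
    have ha' : 0 < a := ha
    have h0 : 0 < √a := Real.sqrt_pos.2 ha'
    congr 2
    rw [abs_of_pos (by positivity)]
    obtain ⟨k, rfl⟩ : ∃ k, p = k + 1 := ⟨p - 1, by omega⟩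
    have : wt (k + 1) a = √a ^ (k + 1) / √a ^ 2 := by rw [Real.sq_sqrt ha'.le, wt]
    rw [this, Nat.add_sub_cancel]
    field_simp
    ring
  · rw [indicator_of_notMem ha, wt_nonpos hp (not_lt.1 ha)]
    simp

/-- The unit sphere of `ℝ^p`. -/
abbrev Sph (p : ℕ) : Type := Metric.sphere (0 : Euc p) 1

/-- The surface measure of the unit sphere of `ℝ^p`. -/
noncomputable abbrev sphMeas (p : ℕ) : Measure (Sph p) := (volume : Measure (Euc p)).toSphere

theorem lintegral_polar {p : ℕ} (hp : 0 < p) {f : Euc p → ℝ≥0∞} (hf : Measurable f) :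
    ∫⁻ y, f y = ∫⁻ a, ENNReal.ofReal (wt p a / 2) * ∫⁻ o : Sph p, f (√a • (o : Euc p))
      ∂(sphMeas p) := by
  have : Nontrivial (Euc p) := by
    have : Nonempty (Fin p) := ⟨⟨0, hp⟩⟩
    infer_instance
  have h1 := (Measure.measurePreserving_homeomorphUnitSphereProd (volume : Measure (Euc p)))
  have h2 := h1.symm (homeomorphUnitSphereProd (Euc p)).toMeasurableEquiv
  have h3 : ∫⁻ y, f y = ∫⁻ y : ({0}ᶜ : Set (Euc p)), f y ∂(Measure.comap Subtype.val volume) := by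
    rw [lintegral_subtype_comap (measurableSet_singleton _).compl,
      Measure.restrict_eq_self_of_ae_mem]
    exact compl_mem_ae_iff.2 (measure_singleton 0)
  have hfc : ∀ r : ℝ, Measurable fun o : Sph p => f (r • (o : Euc p)) := fun r =>
    hf.comp (measurable_subtype_coe.const_smul r)
  rw [h3, ← h2.lintegral_comp (f := fun y => f (y : Euc p))
    (hf.comp measurable_subtype_coe), lintegral_prod_symm]
  · have h4 : ∀ r : Ioi (0 : ℝ), ∀ o : Sph p,
        (((homeomorphUnitSphereProd (Euc p)).toMeasurableEquiv.symm (o, r) :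
          ({0}ᶜ : Set (Euc p))) : Euc p) = (r : ℝ) • (o : Euc p) := fun r o => by
      exact homeomorphUnitSphereProd_symm_apply_coe (Euc p) (o, r)
    simp only [h4, finrank_euclideanSpace, Fintype.card_fin]
    have hm : Measurable fun r : ℝ => ∫⁻ o : Sph p, f (r • (o : Euc p)) ∂(sphMeas p) := by
      refine Measurable.lintegral_prod_right' (f := fun z : ℝ × Sph p => f (z.1 • (z.2 : Euc p))) ?_
      exact hf.comp (by fun_prop)
    have hpw : Measurable fun r : ℝ => ENNReal.ofReal (r ^ (p - 1)) := by fun_prop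
    rw [Measure.volumeIoiPow, lintegral_withDensity_eq_lintegral_mul]
    · have := lintegral_subtype_comap (μ := volume) (measurableSet_Ioi (a := (0 : ℝ)))
        (fun r => ENNReal.ofReal (r ^ (p - 1)) * ∫⁻ o : Sph p, f (r • (o : Euc p)) ∂(sphMeas p))
      simp only [Pi.mul_apply]
      rw [this]
      exact lintegral_Ioi_pow p hp _
    · exact hpw.comp measurable_subtype_coe
    · exact hm.comp measurable_subtype_coe
  · exact (hf.comp (measurable_subtype_coe.comp
      (homeomorphUnitSphereProd (Euc p)).toMeasurableEquiv.symm.measurable)).aemeasurable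

/-- The measure `½ a^(p/2-1) da` on `(0, ∞)`. -/
noncomputable def radMeas (p : ℕ) : Measure ℝ :=
  volume.withDensity fun a => ENNReal.ofReal (wt p a / 2)

theorem measurable_radDensity (p : ℕ) : Measurable fun a => ENNReal.ofReal (wt p a / 2) :=
  ((measurable_wt p).div_const 2).ennreal_ofReal

instance (p : ℕ) : SFinite (radMeas p) := by unfold radMeas; infer_instance

/-- Bipolar coordinates on `ℝ^(p+q)`. -/
noncomputable def bipolar (p q : ℕ) (z : (Sph p × Sph q) × (ℝ × ℝ)) : Euc (p + q) :=
  join p q (√z.2.1 • (z.1.1 : Euc p), √z.2.2 • (z.1.2 : Euc q))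

theorem measurable_bipolar (p q : ℕ) : Measurable (bipolar p q) := by
  unfold bipolar
  exact (join p q).continuous.measurable.comp (by fun_prop)

/-- Polar coordinates in each factor, followed by Tonelli. Nonnegative integrals characterise the
measure, and a measure-preserving map transports integrability as well as integrals. Negative `a` or
`b` are harmless because the radial measures give them no mass. -/
theorem measurePreserving_bipolar {p q : ℕ} (hp : 0 < p) (hq : 0 < q) :
    MeasurePreserving (bipolar p q)
      (((sphMeas p).prod (sphMeas q)).prod ((radMeas p).prod (radMeas q))) volume := by
  refine ⟨measurable_bipolar p q, Measure.ext_of_lintegral _ fun f hf => ?_⟩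
  have hfj : Measurable fun y => f (join p q y) := hf.comp (join p q).continuous.measurable
  rw [lintegral_map hf (measurable_bipolar p q), ← measurePreserving_join.lintegral_comp hf,
    Measure.volume_eq_prod, lintegral_prod _ hfj.aemeasurable,
    lintegral_prod_symm' (fun z => f (bipolar p q z)) (hf.comp (measurable_bipolar p q))]
  have hM : ∀ p (g : ℝ → ℝ≥0∞), Measurable g →
      ∫⁻ a, g a ∂(radMeas p) = ∫⁻ a, ENNReal.ofReal (wt p a / 2) * g a := fun p g hg => by
    rw [radMeas, lintegral_withDensity_eq_lintegral_mul _ (measurable_radDensity p) hg]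
    rfl
  have m1 : Measurable fun z : (ℝ × ℝ) × (Sph p × Sph q) => f (bipolar p q (z.2, z.1)) :=
    (hf.comp (measurable_bipolar p q)).comp measurable_swap
  have m2 : Measurable fun w : ℝ × ℝ => ∫⁻ o : Sph p × Sph q, f (bipolar p q (o, w))
      ∂((sphMeas p).prod (sphMeas q)) := m1.lintegral_prod_right'
  rw [lintegral_prod _ m2.aemeasurable]
  have m3 : Measurable fun a : ℝ => ∫⁻ b, ∫⁻ o : Sph p × Sph q, f (bipolar p q (o, (a, b)))
      ∂((sphMeas p).prod (sphMeas q)) ∂(radMeas q) := m2.lintegral_prod_right'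
  rw [hM p _ m3, lintegral_polar hp]
  · refine lintegral_congr fun a => ?_
    congr 1
    rw [hM q (fun b => ∫⁻ o : Sph p × Sph q, f (bipolar p q (o, (a, b)))
      ∂((sphMeas p).prod (sphMeas q))) (m2.comp measurable_prodMk_left)]
    have m4 : ∀ b, Measurable fun o : Sph p × Sph q => f (bipolar p q (o, (a, b))) := fun b =>
      m1.comp measurable_prodMk_left
    have e1 : ∀ b, ENNReal.ofReal (wt q b / 2) * ∫⁻ o : Sph p × Sph q, f (bipolar p q (o, (a, b)))
        ∂((sphMeas p).prod (sphMeas q)) = ∫⁻ o : Sph p, ENNReal.ofReal (wt q b / 2) *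
          ∫⁻ o' : Sph q, f (bipolar p q ((o, o'), (a, b))) ∂(sphMeas q) ∂(sphMeas p) := by
      intro b
      rw [lintegral_prod _ (m4 b).aemeasurable, lintegral_const_mul]
      exact (m4 b).lintegral_prod_right'
    have m5 : Measurable fun z : ℝ × Sph p => ENNReal.ofReal (wt q z.1 / 2) *
          ∫⁻ o' : Sph q, f (bipolar p q ((z.2, o'), (a, z.1))) ∂(sphMeas q) := by
      refine ((measurable_radDensity q).comp measurable_fst).mul ?_
      exact Measurable.lintegral_prod_right' (f := fun z : (ℝ × Sph p) × Sph q =>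
        f (bipolar p q ((z.1.2, z.2), (a, z.1.1)))) (hf.comp ((measurable_bipolar p q).comp
          (by fun_prop)))
    simp_rw [e1]
    rw [lintegral_lintegral_swap m5.aemeasurable]
    refine lintegral_congr fun o => ?_
    rw [lintegral_polar hq]
    · rfl
    · exact hfj.comp measurable_prodMk_left
  · exact hfj.lintegral_prod_right'

end Polar

/-! ### Spherical averages and the explicit mean function -/

section Average

open scoped Pointwise in
-- The surface measure of a set is a multiple of the volume of the cone over it, and `y ↦ -y`
-- preserves volume. This makes the averages even in each radius.
theorem measurePreserving_neg_sph (p : ℕ) :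
    MeasurePreserving (fun o : Sph p => -o) (sphMeas p) (sphMeas p) := by
  have hm : Measurable fun o : Sph p => -o := continuous_neg.measurable
  refine ⟨hm, Measure.ext fun s hs => ?_⟩
  rw [Measure.map_apply hm hs, Measure.toSphere_apply' _ (hm hs), Measure.toSphere_apply' _ hs]
  congr 1
  rw [← Measure.measure_neg]
  congr 1
  ext y
  simp only [Set.mem_neg, Set.mem_smul, mem_image, mem_preimage]
  constructor
  · rintro ⟨a, ha, _, ⟨o, ho, rfl⟩, h⟩
    exact ⟨a, ha, _, ⟨-o, ho, rfl⟩, by rw [coe_neg_sphere, smul_neg, h, neg_neg]⟩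
  · rintro ⟨a, ha, _, ⟨o, ho, rfl⟩, h⟩
    exact ⟨a, ha, _, ⟨-o, by simpa using ho, rfl⟩, by rw [coe_neg_sphere, smul_neg, h]⟩

variable {X : Type} [NormedAddCommGroup X] [NormedSpace ℝ X]
  {G : Type*} [NormedAddCommGroup G] [NormedSpace ℝ G] {p q : ℕ}

/-- The integral of `f(x, (rω, sσ))` over the product of the unit spheres, as a function of
`((x, s), r)`. -/
noncomputable def sphAvg (p q : ℕ) (f : X × Euc (p + q) → G) (w : (X × ℝ) × ℝ) : G :=
  ∫ o : Sph p × Sph q, (1 : ℝ) • f (w.1.1, join p q (w.2 • (o.1 : Euc p), w.1.2 • (o.2 : Euc q)))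
    ∂((sphMeas p).prod (sphMeas q))

theorem contDiff_sphAvg [FiniteDimensional ℝ X] [CompleteSpace G] {f : X × Euc (p + q) → G}
    (hf : ContDiff ℝ ∞ f) : ContDiff ℝ ∞ (sphAvg p q f) := by
  refine contDiff_integral_param (Z := (X × ℝ) × ℝ) (V := Euc p × Euc q)
    (w := fun _ => 1) (ι := fun o : Sph p × Sph q => ((o.1 : Euc p), (o.2 : Euc q)))
    (F := fun z => f (z.1.1.1, join p q (z.1.2 • z.2.1, z.1.1.2 • z.2.2))) (integrable_const _)
    (by fun_prop) ((isCompact_sphere (0 : Euc p) 1).prod (isCompact_sphere (0 : Euc q) 1))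
    (Filter.Eventually.of_forall fun o => ⟨o.1.2, o.2.2⟩) ?_
  exact hf.comp (by fun_prop)

theorem sphAvg_neg_right (f : X × Euc (p + q) → G) (y : X × ℝ) (r : ℝ) :
    sphAvg p q f (y, -r) = sphAvg p q f (y, r) := by
  have h := (measurePreserving_neg_sph p).prod (MeasurePreserving.id (sphMeas q))
  have he : MeasurableEmbedding (Prod.map (fun o : Sph p => -o) (id : Sph q → Sph q)) :=
    ((Homeomorph.neg (Sph p)).prodCongr (Homeomorph.refl (Sph q))).measurableEmbedding
  unfold sphAvg
  rw [← h.integral_comp he]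
  simp

theorem sphAvg_neg_left (f : X × Euc (p + q) → G) (x : X) (s r : ℝ) :
    sphAvg p q f ((x, -s), r) = sphAvg p q f ((x, s), r) := by
  have h := (MeasurePreserving.id (sphMeas p)).prod (measurePreserving_neg_sph q)
  have he : MeasurableEmbedding (Prod.map (id : Sph p → Sph p) (fun o : Sph q => -o)) :=
    ((Homeomorph.refl (Sph p)).prodCongr (Homeomorph.neg (Sph q))).measurableEmbedding
  unfold sphAvg
  rw [← h.integral_comp he]
  simp

theorem norm_join_sq (y : Euc p × Euc q) : ‖join p q y‖ ^ 2 = ‖y.1‖ ^ 2 + ‖y.2‖ ^ 2 := by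
  simp [EuclideanSpace.real_norm_sq_eq, Fin.sum_univ_add]

theorem sphAvg_eq_zero {f : X × Euc (p + q) → G} (w : (X × ℝ) × ℝ)
    (h : ∀ y, quadForm p q y = w.2 ^ 2 - w.1.2 ^ 2 → ‖y‖ ^ 2 = w.2 ^ 2 + w.1.2 ^ 2 →
      f (w.1.1, y) = 0) : sphAvg p q f w = 0 := by
  refine (integral_congr_ae (Filter.Eventually.of_forall fun o => ?_)).trans (integral_zero _ _)
  simp only [one_smul]
  refine h _ ?_ ?_
  · rw [quadForm_join]; simp [norm_smul]
  · rw [norm_join_sq]; simp [norm_smul]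

theorem sphAvg_eq_zero_of_le {f : X × Euc (p + q) → G} {S : ℝ} (hS0 : 0 ≤ S)
    (hS : ∀ x y, S ≤ ‖y‖ → f (x, y) = 0) (w : (X × ℝ) × ℝ) (hw : S ≤ |w.1.2| ∨ S ≤ |w.2|) :
    sphAvg p q f w = 0 := by
  refine sphAvg_eq_zero w fun y _ hy => hS _ _ ?_
  refine le_of_sq_le_sq ?_ (norm_nonneg y)
  rw [hy]
  rcases hw with h | h
  · have := pow_le_pow_left₀ hS0 h 2
    rw [sq_abs] at this
    nlinarith [sq_nonneg w.2]
  · have := pow_le_pow_left₀ hS0 h 2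
    rw [sq_abs] at this
    nlinarith [sq_nonneg w.1.2]

/-- The mean function of `f(x, ·)` at `t`, by an explicit integral. -/
noncomputable def meanFn (p q : ℕ) (f : X × Euc (p + q) → G) (z : X × ℝ) : G :=
  (1 / 4 : ℝ) • hypInt p q (sphAvg p q f) z

theorem contDiffAt_meanFn [FiniteDimensional ℝ X] [CompleteSpace G] (hp : 0 < p) (hq : 0 < q)
    {f : X × Euc (p + q) → G} (hf : ContDiff ℝ ∞ f) {S : ℝ} (hS0 : 0 ≤ S)
    (hS : ∀ x y, S ≤ ‖y‖ → f (x, y) = 0) {z : X × ℝ} (hz : z.2 ≠ 0) :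
    ContDiffAt ℝ ∞ (meanFn p q f) z :=
  contDiffAt_const.smul (contDiffAt_hypInt hp hq (contDiff_sphAvg hf)
    (fun w hw => sphAvg_eq_zero_of_le hS0 hS w (Or.inl (hw.trans (le_abs_self _))))
    (fun w hw => sphAvg_eq_zero_of_le hS0 hS w (Or.inr (hw.trans (le_abs_self _)))) hz)

theorem meanFn_eq_zero (hp : 0 < p) (hq : 0 < q) {f : X × Euc (p + q) → G} {z : X × ℝ}
    (h : ∀ y, quadForm p q y = z.2 → f (z.1, y) = 0) : meanFn p q f z = 0 := by
  rw [meanFn, hypInt]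
  refine smul_eq_zero_of_right _ ((integral_congr_ae (Filter.Eventually.of_forall
    fun b => ?_)).trans (integral_zero _ _))
  rcases le_or_gt b 0 with hb | hb
  · rw [wt_nonpos hq hb, zero_mul, zero_smul]
  rcases le_or_gt (b + z.2) 0 with hb' | hb'
  · rw [wt_nonpos hp hb', mul_zero, zero_smul]
  rw [sphAvg_eq_zero, smul_zero]
  intro y hy _
  refine h y ?_
  rw [hy, Real.sq_sqrt hb.le, Real.sq_sqrt hb'.le]
  ring

end Average

/-! ### The explicit integral represents the mean function -/

section Mean

variable {X : Type} [NormedAddCommGroup X] [NormedSpace ℝ X] {𝕜 : Type*} [RCLike 𝕜] {p q : ℕ}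

/-- After bipolar coordinates the shear `(t, b) ↦ (t + b, b)` preserves Lebesgue measure and makes
the value `t` of the quadratic form a coordinate. The factor `1/4` is the product of the two radial
densities' halves. Integrability is recorded together with the formula because Fubini is applied to
it. -/
theorem integral_quadForm_aux (hp : 0 < p) (hq : 0 < q) {f : X × Euc (p + q) → 𝕜}
    (hf : Continuous f) {S : ℝ} (hS : ∀ x y, S ≤ ‖y‖ → f (x, y) = 0) (x : X) {F : ℝ → 𝕜}
    (hF : Continuous F) :
    Integrable (fun z : ℝ × ℝ => F z.1 * ((1 / 4 : ℝ) •
      ((wt q z.2 * wt p (z.2 + z.1)) • sphAvg p q f ((x, √z.2), √(z.2 + z.1))))) ∧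
    ∫ y, F (quadForm p q y) * f (x, y) = ∫ z : ℝ × ℝ, F z.1 * ((1 / 4 : ℝ) •
      ((wt q z.2 * wt p (z.2 + z.1)) • sphAvg p q f ((x, √z.2), √(z.2 + z.1)))) := by
  have hQ : Continuous (quadForm p q) := by unfold quadForm; fun_prop
  set g : Euc (p + q) → 𝕜 := fun y => F (quadForm p q y) * f (x, y) with hg
  have hgc : Continuous g := (hF.comp hQ).mul (by fun_prop)
  have hgs : HasCompactSupport g := by
    refine HasCompactSupport.intro (isCompact_closedBall (0 : Euc (p + q)) S) fun y hy => ?_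
    have : S ≤ ‖y‖ := by
      by_contra! h
      exact hy (by simpa using h.le)
    simp [g, hS x y this]
  have hgi : Integrable g := hgc.integrable_of_hasCompactSupport hgs
  have hmp := measurePreserving_bipolar hp hq
  have hgi2 : Integrable (g ∘ bipolar p q)
      (((sphMeas p).prod (sphMeas q)).prod ((radMeas p).prod (radMeas q))) :=
    (hmp.integrable_comp hgc.aestronglyMeasurable).2 hgi
  have h1 : ∫ y, g y = ∫ w, ∫ o, g (bipolar p q (o, w)) ∂((sphMeas p).prod (sphMeas q))
      ∂((radMeas p).prod (radMeas q)) := by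
    rw [← integral_prod_symm (fun z => g (bipolar p q z)) hgi2]
    rw [← hmp.map_eq, integral_map hmp.measurable.aemeasurable]
    · rw [hmp.map_eq]; exact hgc.aestronglyMeasurable
  have h2 : Integrable (fun w => ∫ o, g (bipolar p q (o, w)) ∂((sphMeas p).prod (sphMeas q)))
      ((radMeas p).prod (radMeas q)) := hgi2.integral_prod_right
  have hden : (radMeas p).prod (radMeas q) = (volume : Measure (ℝ × ℝ)).withDensity
      fun z => ENNReal.ofReal (wt p z.1 / 2) * ENNReal.ofReal (wt q z.2 / 2) := by
    rw [radMeas, radMeas, prod_withDensity (measurable_radDensity p) (measurable_radDensity q)]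
    rfl
  have hdm : Measurable fun z : ℝ × ℝ =>
      ENNReal.ofReal (wt p z.1 / 2) * ENNReal.ofReal (wt q z.2 / 2) :=
    ((measurable_radDensity p).comp measurable_fst).mul
      ((measurable_radDensity q).comp measurable_snd)
  have hdf : ∀ᵐ z : ℝ × ℝ, ENNReal.ofReal (wt p z.1 / 2) * ENNReal.ofReal (wt q z.2 / 2) < ⊤ :=
    Filter.Eventually.of_forall fun z => ENNReal.mul_lt_top ENNReal.ofReal_lt_top
      ENNReal.ofReal_lt_top
  rw [hden] at h1 h2
  rw [integrable_withDensity_iff_integrable_smul' hdm hdf] at h2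
  rw [integral_withDensity_eq_integral_toReal_smul hdm hdf] at h1
  have hsh := measurePreserving_add_prod (volume : Measure ℝ) (volume : Measure ℝ)
  have hemb : MeasurableEmbedding fun z : ℝ × ℝ => (z.1 + z.2, z.2) := by
    let e : ℝ × ℝ ≃ₜ ℝ × ℝ :=
      { toFun := fun z => (z.1 + z.2, z.2)
        invFun := fun z => (z.1 - z.2, z.2)
        left_inv := fun z => by simp
        right_inv := fun z => by simp
        continuous_toFun := by fun_prop
        continuous_invFun := by fun_prop }
    exact e.measurableEmbedding
  have hfun : ∀ z : ℝ × ℝ, (ENNReal.ofReal (wt p (z.1 + z.2) / 2) *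
      ENNReal.ofReal (wt q z.2 / 2)).toReal • ∫ o, g (bipolar p q (o, (z.1 + z.2, z.2)))
        ∂((sphMeas p).prod (sphMeas q)) = F z.1 * ((1 / 4 : ℝ) •
      ((wt q z.2 * wt p (z.2 + z.1)) • sphAvg p q f ((x, √z.2), √(z.2 + z.1)))) := by
    intro z
    rw [ENNReal.toReal_mul, ENNReal.toReal_ofReal (by linarith [wt_nonneg hp (z.1 + z.2)]),
      ENNReal.toReal_ofReal (by linarith [wt_nonneg hq z.2]), add_comm z.1 z.2]
    rcases le_or_gt z.2 0 with hb | hb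
    · rw [wt_nonpos hq hb]; simp
    rcases le_or_gt (z.2 + z.1) 0 with ha | ha
    · rw [wt_nonpos hp ha]; simp
    have hin : ∀ o : Sph p × Sph q, g (bipolar p q (o, (z.2 + z.1, z.2))) =
        F z.1 * f (x, bipolar p q (o, (z.2 + z.1, z.2))) := by
      intro o
      have : quadForm p q (bipolar p q (o, (z.2 + z.1, z.2))) = z.1 := by
        rw [bipolar, quadForm_join]
        simp [norm_smul, Real.sq_sqrt hb.le, Real.sq_sqrt ha.le]
      rw [hg]
      dsimp only
      rw [this]
    simp_rw [hin]
    rw [integral_const_mul, ← mul_smul_comm]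
    have : sphAvg p q f ((x, √z.2), √(z.2 + z.1)) =
        ∫ o, f (x, bipolar p q (o, (z.2 + z.1, z.2))) ∂((sphMeas p).prod (sphMeas q)) := by
      simp only [sphAvg, one_smul, bipolar]
    rw [this, smul_smul]
    congr 2
    ring
  constructor
  · have := hsh.integrable_comp_of_integrable h2
    refine this.congr (Filter.Eventually.of_forall fun z => ?_)
    exact hfun z
  · rw [h1, Measure.volume_eq_prod, ← hsh.integral_comp hemb]
    exact integral_congr_ae (Filter.Eventually.of_forall hfun)

/-- The explicit integral is the mean function. -/
theorem isMeanFunction_meanFn [FiniteDimensional ℝ X] (hp : 0 < p) (hq : 0 < q)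
    {f : X × Euc (p + q) → 𝕜} (hf : ContDiff ℝ ∞ f) {S : ℝ} (hS0 : 0 ≤ S)
    (hS : ∀ x y, S ≤ ‖y‖ → f (x, y) = 0) (x : X) :
    IsMeanFunction p q (fun y => f (x, y)) fun t => meanFn p q f (x, t) where
  contDiffOn := fun t ht => ((contDiffAt_meanFn hp hq hf hS0 hS (z := (x, t)) ht).comp t
    (contDiffAt_const.prodMk contDiffAt_id)).contDiffWithinAt
  integrable := by
    have h := (integral_quadForm_aux hp hq hf.continuous hS x (F := fun _ => 1)
      continuous_const).1
    simp only [one_mul] at h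
    have := Integrable.integral_prod_left h
    refine this.congr (Filter.Eventually.of_forall fun t => ?_)
    simp only [meanFn, hypInt]
    rw [integral_smul]
  integral_eq := fun F => by
    have h := integral_quadForm_aux hp hq hf.continuous hS x (F := F) F.continuous
    rw [h.2, Measure.volume_eq_prod, integral_prod _ h.1]
    refine integral_congr_ae (Filter.Eventually.of_forall fun t => ?_)
    simp only [meanFn, hypInt]
    rw [integral_const_mul, integral_smul]

theorem IsMeanFunction.mean {g : Euc (p + q) → 𝕜} {M : ℝ → 𝕜} (h : IsMeanFunction p q g M) :
    IsMeanFunction p q g (mean p q g) := by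
  have hex : ∃ M, IsMeanFunction p q g M := ⟨M, h⟩
  rw [MeanFunction.mean, dif_pos hex]
  exact Classical.choose_spec hex

theorem exists_bound_of_testFn {X : Type} [NormedAddCommGroup X] [NormedSpace ℝ X] {n : ℕ}
    (f : TestFn (X × Euc n) 𝕜) : ∃ S : ℝ, 0 < S ∧ ∀ x y, S ≤ ‖y‖ → f (x, y) = 0 := by
  obtain ⟨R, hR⟩ := f.hasCompactSupport.isCompact.isBounded.exists_norm_le
  refine ⟨|R| + 1, by positivity, fun x y hy => ?_⟩
  by_contra h
  have h1 := hR (x, y) (subset_tsupport _ h)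
  have h2 : ‖y‖ ≤ ‖(x, y)‖ := norm_snd_le (x, y)
  linarith [le_abs_self R]

theorem isMeanFunction_mean (hp : 0 < p) (hq : 0 < q) (g : TestFn (Euc (p + q)) 𝕜) :
    IsMeanFunction p q g (mean p q g) := by
  obtain ⟨R, hR⟩ := g.hasCompactSupport.isCompact.isBounded.exists_norm_le
  -- A dummy parameter in `ℝ`, on which the function does not depend, reduces this to the parametric
  -- case.
  refine (isMeanFunction_meanFn (X := ℝ) (f := fun z => g z.2) hp hq
    (g.contDiff.comp contDiff_snd) (S := |R| + 1) (by positivity) (fun _ y hy => ?_) 0).mean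
  by_contra h
  have h1 := hR y (subset_tsupport _ h)
  linarith [le_abs_self R]

theorem meanMap_eq {m : ℕ} (hp : 0 < p) (hq : 0 < q) (f : TestFn (Euc m × Euc (p + q)) 𝕜)
    (z : PuncturedProd m) : meanMap m p q f z = meanFn p q f (z.1, (z.2 : ℝ)) := by
  obtain ⟨S, hS0, hS⟩ := exists_bound_of_testFn f
  have h := isMeanFunction_meanFn hp hq f.contDiff hS0.le hS z.1
  exact h.mean.eq_of_ne_zero h z.2.2

end Mean

/-! ### Regularity of `η` -/

section Eta

/-- The sign in the relation between `η` in the dimensions `n + 2` and `n`. -/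
def etaSign (p q : ℕ) : ℝ := if Even p ∧ Odd q then -1 else 1

theorem etaSign_mul_self (p q : ℕ) : etaSign p q * etaSign p q = 1 := by
  unfold etaSign; split_ifs <;> norm_num

theorem eta_zero (p q : ℕ) : eta p q 0 = 0 := by
  simp [eta]

theorem eta_congr_add_even {p q : ℕ} (h0 : 0 < p) (h0' : 0 < q) {t : ℝ} (ht : t ≠ 0) (k : ℕ) :
    ∀ {p' q' : ℕ}, (Even p' ↔ Even p) → (Even q' ↔ Even q) → p' + q' = p + q + 2 * k →
      eta p' q' t = etaSign p q ^ k * t ^ k * eta p q t := by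
  induction k with
  | zero =>
    intro p' q' hp hq h
    have h' : p' + q' = p + q := by omega
    simp only [eta, ← Nat.not_even_iff_odd, hp, hq, h', pow_zero, one_mul]
  | succ k ih =>
    intro p' q' hp hq h
    have hpk : Even (p + 2 * k) ↔ Even p := by simp [Nat.even_add]
    rw [eta_congr_add_two (p := p + 2 * k) (q := q) (hp.trans hpk.symm) hq (by omega) h0'
      (by omega) ht, ih hpk Iff.rfl (by omega)]
    have hs : (if Even (p + 2 * k) ∧ Odd q then (-1 : ℝ) else 1) = etaSign p q := by
      simp only [etaSign, hpk]
    rw [hs, pow_succ, pow_succ]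
    ring

/-- Each derivative lowers the power by one, up to a polynomial. The derivative formula holds even
at `t = 0`: the value `log 0 = 0` makes the slope there `t^k log t`, which tends to `0`. -/
theorem contDiff_pow_mul_log (l : ℕ) : ∀ d, l < d →
    ContDiff ℝ l fun t : ℝ => t ^ d * Real.log t := by
  induction l with
  | zero =>
    intro d hd
    obtain ⟨k, rfl⟩ : ∃ k, d = k + 1 := ⟨d - 1, by omega⟩
    refine contDiff_zero.2 ?_
    simp_rw [pow_succ, mul_assoc]
    exact (continuous_pow k).mul Real.continuous_mul_log
  | succ l ih =>
    intro d hd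
    obtain ⟨k, rfl⟩ : ∃ k, d = k + 1 := ⟨d - 1, by omega⟩
    have hder : ∀ t : ℝ, HasDerivAt (fun t : ℝ => t ^ (k + 1) * Real.log t)
        ((k + 1) * (t ^ k * Real.log t) + t ^ k) t := by
      intro t
      rcases eq_or_ne t 0 with rfl | ht
      · have hk : k ≠ 0 := by omega
        have hc : Continuous fun t : ℝ => t ^ k * Real.log t :=
          (ih k (by omega)).continuous
        rw [hasDerivAt_iff_tendsto_slope]
        have h1 := (hc.tendsto 0).mono_left (nhdsWithin_le_nhds (s := {0}ᶜ))
        simp only [Real.log_zero, mul_zero, zero_pow hk, add_zero] at h1 ⊢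
        refine h1.congr' ?_
        filter_upwards [self_mem_nhdsWithin] with t ht
        have : t ≠ 0 := ht
        rw [slope_def_field]
        simp only [Real.log_zero, mul_zero, sub_zero]
        field_simp
        ring
      · refine ((hasDerivAt_pow (k + 1) t).mul (Real.hasDerivAt_log ht)).congr_deriv ?_
        push_cast
        field_simp
        ring
    rw [Nat.cast_succ]
    refine contDiff_succ_iff_hasFDerivAt.2 ⟨fun t => ContinuousLinearMap.toSpanSingleton ℝ
      ((k + 1) * (t ^ k * Real.log t) + t ^ k), ?_, fun t => (hder t).hasFDerivAt⟩
    have h1 : ContDiff ℝ l fun t : ℝ => (k + 1) * (t ^ k * Real.log t) + t ^ k :=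
      (contDiff_const.mul (ih k (by omega))).add (contDiff_id.pow k)
    exact (ContinuousLinearMap.toSpanSingletonCLE (𝕜 := ℝ) (E := ℝ)).contDiff.comp h1

theorem contDiff_sqrt_pow {l K : ℕ} (h : 2 * l < K) : ContDiff ℝ l fun t : ℝ => √t ^ K := by
  have h1 := contDiff_sqrt_pow_smul (Y := ℝ) (G := ℝ) l (R := fun _ => 1) contDiff_const h
  have h2 := h1.comp (f := fun t : ℝ => ((0 : ℝ), t)) (by fun_prop)
  simpa [Function.comp_def] using h2

/-- The bound on `l` says `l < n/2 - 1`. Except for the logarithmic branch, `η` is a combination of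
powers of `√t` and `√(-t)`, each extended by `0` to the other half-line. -/
theorem contDiff_eta {p q l : ℕ} (hp : 0 < p) (hq : 0 < q) (h : 2 * l + 2 < p + q) :
    ContDiff ℝ l (eta p q) := by
  have hpow : ∀ t : ℝ, 0 < t → t ^ (((p + q : ℕ) : ℝ) / 2 - 1) = √t ^ (p + q - 2) := by
    intro t ht
    rw [Real.sqrt_eq_rpow, ← Real.rpow_natCast, ← Real.rpow_mul ht.le, Nat.cast_sub (by omega)]
    congr 1
    push_cast
    ring
  rcases Nat.even_or_odd p with hpe | hpo <;> rcases Nat.even_or_odd q with hqe | hqo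
  · obtain ⟨a, rfl⟩ := hpe
    obtain ⟨b, rfl⟩ := hqe
    have hd : (a + a + (b + b)) / 2 - 1 = a + b - 1 := by omega
    have : eta (a + a) (b + b) = fun t => 1 / 2 * (√t ^ (2 * (a + b - 1)) -
        (-1) ^ (a + b - 1) * √(-t) ^ (2 * (a + b - 1))) := by
      funext t
      have hd0 : a + b - 1 ≠ 0 := by omega
      simp only [eta, Nat.not_odd_iff_even.2 (Even.add_self a), Nat.not_odd_iff_even.2
        (Even.add_self b), Even.add_self, false_and, and_false, if_false, and_self, if_true, hd,
        pow_mul]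
      rcases lt_trichotomy t 0 with h | h | h
      · rw [Real.sign_of_neg h, Real.sqrt_eq_zero_of_nonpos h.le, Real.sq_sqrt (by linarith),
          ← mul_pow, zero_pow two_ne_zero, zero_pow hd0]
        ring
      · simp [h, hd0]
      · rw [Real.sign_of_pos h, Real.sqrt_eq_zero_of_nonpos (by linarith : -t ≤ 0),
          Real.sq_sqrt h.le, zero_pow two_ne_zero, zero_pow hd0]
        ring
    rw [this]
    have h1 := contDiff_sqrt_pow (l := l) (K := 2 * (a + b - 1)) (by omega)
    exact contDiff_const.mul (h1.sub (contDiff_const.mul (h1.comp contDiff_neg)))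
  · have : eta p q = fun t => √(-t) ^ (p + q - 2) := by
      funext t
      simp only [eta, Nat.not_odd_iff_even.2 hpe, hpe, hqo, false_and, and_self, if_false, if_true]
      split_ifs with h
      · exact hpow _ (by linarith)
      · rw [Real.sqrt_eq_zero_of_nonpos (by linarith), zero_pow (by omega)]
    rw [this]
    exact (contDiff_sqrt_pow (by omega)).comp contDiff_neg
  · have : eta p q = fun t => √t ^ (p + q - 2) := by
      funext t
      simp only [eta, hpo, hqe, and_self, if_true]
      split_ifs with h
      · exact hpow _ h
      · rw [Real.sqrt_eq_zero_of_nonpos (by linarith), zero_pow (by omega)]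
    rw [this]
    exact contDiff_sqrt_pow (by omega)
  · have : eta p q = fun t => t ^ ((p + q) / 2 - 1) * Real.log t := by
      funext t
      simp only [eta, Nat.not_even_iff_odd.2 hpo, Nat.not_even_iff_odd.2 hqo, false_and, and_false,
        if_false, Real.log_abs]
    rw [this]
    obtain ⟨a, ha⟩ := hpo
    obtain ⟨b, hb⟩ := hqo
    exact contDiff_pow_mul_log l _ (by omega)

/-- Up to sign, `t^N η` is the function `η` of the signature `(p + 2N, q)`. -/
theorem contDiff_eta_mul_pow {p q l N : ℕ} (hp : 0 < p) (hq : 0 < q)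
    (h : 2 * l + 2 < 2 * N + p + q) : ContDiff ℝ l fun t => eta p q t * t ^ N := by
  have : (fun t => eta p q t * t ^ N) = fun t => etaSign p q ^ N * eta (p + 2 * N) q t := by
    funext t
    rcases eq_or_ne t 0 with rfl | ht
    · simp [eta_zero]
    · rw [eta_congr_add_even (p' := p + 2 * N) hp hq ht N (by simp [Nat.even_add]) Iff.rfl
        (by omega)]
      have := congrArg (· ^ N) (etaSign_mul_self p q)
      simp only [mul_pow, one_pow] at this
      linear_combination (-(eta p q t * t ^ N)) * this
  rw [this]
  exact contDiff_const.mul (contDiff_eta (by omega) hq (by omega))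

theorem contDiffAt_eta (p q : ℕ) {t : ℝ} (ht : t ≠ 0) : ContDiffAt ℝ ∞ (eta p q) t := by
  rcases lt_or_gt_of_ne ht with h | h
  · have hev : ∀ᶠ s in 𝓝 t, s < 0 := gt_mem_nhds h
    unfold eta
    split_ifs
    · refine (contDiffAt_const (c := (0 : ℝ))).congr_of_eventuallyEq ?_
      filter_upwards [hev] with s hs
      rw [if_neg hs.not_gt]
    · refine (contDiffAt_id.neg.rpow_const_of_ne (p := ((p + q : ℕ) : ℝ) / 2 - 1)
        (by simp [ht])).congr_of_eventuallyEq ?_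
      filter_upwards [hev] with s hs
      rw [if_pos hs]
      rfl
    · refine (contDiffAt_const (c := (-1 / 2 : ℝ)).mul
        (contDiffAt_id.pow ((p + q) / 2 - 1))).congr_of_eventuallyEq ?_
      filter_upwards [hev] with s hs
      rw [Real.sign_of_neg hs]
      simp only [id]
      ring
    · simp only [Real.log_abs]
      exact (contDiffAt_id.pow _).mul (Real.contDiffAt_log.2 ht)
  · have hev : ∀ᶠ s in 𝓝 t, 0 < s := lt_mem_nhds h
    unfold eta
    split_ifs
    · refine (contDiffAt_id.rpow_const_of_ne (p := ((p + q : ℕ) : ℝ) / 2 - 1)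
        ht).congr_of_eventuallyEq ?_
      filter_upwards [hev] with s hs
      rw [if_pos hs]
      rfl
    · refine (contDiffAt_const (c := (0 : ℝ))).congr_of_eventuallyEq ?_
      filter_upwards [hev] with s hs
      rw [if_neg hs.not_gt]
    · refine (contDiffAt_const (c := (1 / 2 : ℝ)).mul
        (contDiffAt_id.pow ((p + q) / 2 - 1))).congr_of_eventuallyEq ?_
      filter_upwards [hev] with s hs
      rw [Real.sign_of_pos hs]
      simp only [id]
      ring
    · simp only [Real.log_abs]
      exact (contDiffAt_id.pow _).mul (Real.contDiffAt_log.2 ht)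

end Eta

/-! ### The model integral with cut-offs -/

section Model

open Classical in
/-- The constant of the singular part of `betaInt p q`. -/
noncomputable def betaC (p q : ℕ) : ℝ :=
  if h : BetaExpansion p q then h.choose_spec.choose else 0

theorem betaC_spec {p q : ℕ} (hp : 0 < p) (hq : 0 < q) : betaC p q ≠ 0 ∧
    ∃ A : ℝ → ℝ, ContDiffOn ℝ ∞ A (Ioo (-1) 1) ∧
      ∀ t, t ≠ 0 → |t| < 1 → betaInt p q t = A t + betaC p q * eta p q t := by
  have h := betaExpansion hp hq
  have h1 := h.choose_spec.choose_spec
  rw [betaC, dif_pos h]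
  exact ⟨h1.2.1, _, h1.1, h1.2.2⟩

/-- The model integral, with the cut-off `κ`. -/
noncomputable def modelInt (p q : ℕ) (κ : ℝ → ℝ) (t : ℝ) : ℝ :=
  ∫ b, wt q b * wt p (b + t) * (κ b * κ (b + t))

theorem contDiffAt_wt_of_ne {p : ℕ} (hp : 0 < p) {a : ℝ} (ha : a ≠ 0) :
    ContDiffAt ℝ ∞ (wt p) a := by
  rcases lt_or_gt_of_ne ha with h | h
  · refine (contDiffAt_const (c := (0 : ℝ))).congr_of_eventuallyEq ?_
    filter_upwards [gt_mem_nhds h] with s hs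
    exact wt_nonpos hp hs.le
  · exact contDiffAt_wt p h

/-- For `b > 1` and `t > -1` the argument `b + t` is locally bounded away from `0`, so `wt p` can be
replaced by a smooth function. -/
theorem contDiffOn_modelInt_tail {p q : ℕ} (hp : 0 < p) (hq : 0 < q) {κ : ℝ → ℝ}
    (hκ : ContDiff ℝ ∞ κ) (B : ℝ) : ContDiffOn ℝ ∞
      (fun t => ∫ b in Ioc 1 B, wt q b * wt p (b + t) * (κ b * κ (b + t))) (Ioo (-1) 1) := by
  intro t₀ ht₀
  refine ContDiffAt.contDiffWithinAt ?_
  obtain ⟨ρ, hρ, hρ1, hρ0⟩ := exists_cutoff ((1 + t₀) / 4) (by linarith [ht₀.1])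
  have hζ : ContDiff ℝ ∞ fun a => (1 - ρ a) * wt p a := by
    refine contDiff_inv_mul_of_eventuallyEq_zero (contDiff_const.sub hρ) ?_ _
      fun t ht => contDiffAt_wt_of_ne hp ht
    filter_upwards [Metric.ball_mem_nhds (0 : ℝ) (by linarith [ht₀.1] : 0 < (1 + t₀) / 4)]
      with r hr
    rw [mem_ball_zero_iff, Real.norm_eq_abs] at hr
    simp [hρ1 r hr.le]
  have hsm : ContDiff ℝ ∞ fun t : ℝ => ∫ b in Ioc 1 B, wt q b •
      (((1 - ρ (b + t)) * wt p (b + t)) * (κ b * κ (b + t))) := by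
    refine contDiff_integral_param (Z := ℝ) (V := ℝ) (ι := fun b => b) (C := Icc 1 B)
      (F := fun z => ((1 - ρ (z.2 + z.1)) * wt p (z.2 + z.1)) * (κ z.2 * κ (z.2 + z.1)))
      (integrableOn_wt hq 1 B) measurable_id isCompact_Icc ?_ ?_
    · filter_upwards [ae_restrict_mem measurableSet_Ioc] with b hb using ⟨hb.1.le, hb.2⟩
    · exact (hζ.comp (contDiff_snd.add contDiff_fst)).mul
        ((hκ.comp contDiff_snd).mul (hκ.comp (contDiff_snd.add contDiff_fst)))
  refine hsm.contDiffAt.congr_of_eventuallyEq ?_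
  filter_upwards [lt_mem_nhds (by linarith [ht₀.1] : -1 + (1 + t₀) / 2 < t₀)] with t ht
  refine setIntegral_congr_fun measurableSet_Ioc fun b hb => ?_
  have : ρ (b + t) = 0 := hρ0 _ (le_abs.2 (Or.inl (by linarith [hb.1])))
  simp only [this, sub_zero, one_mul, smul_eq_mul]
  ring

/-- On `0 < b ≤ 1` with `|t| < 1` one has `|b + t| ≤ 2`, so both cut-offs are `1` and that part is
`betaInt`; the remaining part is smooth. -/
theorem modelInt_expansion {p q : ℕ} (hp : 0 < p) (hq : 0 < q) {κ : ℝ → ℝ}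
    (hκ : ContDiff ℝ ∞ κ) (hκ1 : ∀ t, |t| ≤ 2 → κ t = 1) {B : ℝ}
    (hκ0 : ∀ t, B ≤ |t| → κ t = 0) :
    ∃ A : ℝ → ℝ, ContDiffOn ℝ ∞ A (Ioo (-1) 1) ∧
      ∀ t, t ≠ 0 → |t| < 1 → modelInt p q κ t = A t + betaC p q * eta p q t := by
  obtain ⟨-, A, hA, hAt⟩ := betaC_spec hp hq
  refine ⟨fun t => A t + ∫ b in Ioc 1 B, wt q b * wt p (b + t) * (κ b * κ (b + t)),
    hA.add (contDiffOn_modelInt_tail hp hq hκ B), fun t ht ht1 => ?_⟩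
  have ht1' := abs_lt.1 ht1
  have e1 : ∀ b ∈ Iic (1 : ℝ), wt q b * wt p (b + t) * (κ b * κ (b + t)) =
      wt q b * wt p (b + t) := by
    intro b hb
    rcases le_or_gt b 0 with h | h
    · rw [wt_nonpos hq h]; ring
    · have hb1 : b ≤ 1 := hb
      rw [hκ1 b (abs_le.2 ⟨by linarith, by linarith⟩),
        hκ1 (b + t) (abs_le.2 ⟨by linarith, by linarith⟩)]
      ring
  have i1 : IntegrableOn (fun b => wt q b * wt p (b + t) * (κ b * κ (b + t))) (Iic 1) :=
    (integrableOn_wt_mul_wt hp hq ht 1).congr_fun (fun b hb => (e1 b hb).symm) measurableSet_Iic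
  have i2 : IntegrableOn (fun b => wt q b * wt p (b + t) * (κ b * κ (b + t))) (Ioc 1 B) := by
    refine IntegrableOn.mul_continuousOn_of_subset (K := Icc 1 B)
      ((integrableOn_wt_mul_wt hp hq ht B).mono_set fun b hb => hb.2) ?_
      measurableSet_Ioc isCompact_Icc Ioc_subset_Icc_self
    have := hκ.continuous
    fun_prop
  have hdisj : Disjoint (Iic (1 : ℝ)) (Ioc 1 B) := by
    rw [Set.disjoint_left]
    intro b hb hb'
    exact absurd hb'.1 (not_lt.2 hb)
  have h1 : modelInt p q κ t = ∫ b in Iic 1 ∪ Ioc 1 B,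
      wt q b * wt p (b + t) * (κ b * κ (b + t)) := by
    rw [setIntegral_eq_integral_of_forall_compl_eq_zero]
    · rfl
    · intro b hb
      have hb1 : 1 < b := by
        by_contra! h
        exact hb (Or.inl h)
      have hb2 : B < b := by
        by_contra! h
        exact hb (Or.inr ⟨hb1, h⟩)
      rw [hκ0 b (hb2.le.trans (le_abs_self b))]
      ring
  rw [h1, setIntegral_union hdisj measurableSet_Ioc i1 i2, setIntegral_congr_fun measurableSet_Iic e1]
  have := hAt t ht ht1
  rw [betaInt] at this
  rw [this]
  ring

end Model

/-! ### Taylor coefficients depend only on one slice -/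

section HadamardSlices

variable {Y : Type} [NormedAddCommGroup Y] [NormedSpace ℝ Y]
  {G : Type*} [NormedAddCommGroup G] [NormedSpace ℝ G]

theorem hquot_eq_deriv {g : Y × ℝ → G} (hg : ContDiff ℝ ∞ g) (y : Y) (t : ℝ) :
    hquot g (y, t) = ∫ θ in Ioc (0 : ℝ) 1, deriv (fun t => g (y, t)) (t * θ) := by
  simp only [hquot, one_smul]
  congr 1
  funext θ
  have h1 := (hg.differentiable (by simp) (y, t * θ)).hasFDerivAt
  have h2 : HasDerivAt (fun t : ℝ => (y, t)) ((0 : Y), (1 : ℝ)) (t * θ) :=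
    (hasDerivAt_const _ y).prodMk (hasDerivAt_id _)
  exact (h1.comp_hasDerivAt (t * θ) h2).deriv.symm

/-- Hadamard quotients involve only the derivative along the line with `y` fixed. Comparing two
different base points is what transfers evenness in `s` to the coefficients in `r`. -/
theorem tcoeff_congr [FiniteDimensional ℝ Y] [CompleteSpace G] {g g' : Y × ℝ → G}
    (hg : ContDiff ℝ ∞ g) (hg' : ContDiff ℝ ∞ g') {y y' : Y}
    (h : ∀ t, g (y, t) = g' (y', t)) (k : ℕ) : tcoeff g k y = tcoeff g' k y' := by
  have key : ∀ k : ℕ, ∀ t, (hquot^[k] g) (y, t) = (hquot^[k] g') (y', t) := by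
    intro k
    induction k with
    | zero => exact h
    | succ k ih =>
      intro t
      rw [Function.iterate_succ_apply', Function.iterate_succ_apply',
        hquot_eq_deriv (contDiff_hquot_iterate hg k), hquot_eq_deriv (contDiff_hquot_iterate hg' k),
        funext ih]
  exact key k 0

theorem tcoeff_eq_zero [FiniteDimensional ℝ Y] [CompleteSpace G] {g : Y × ℝ → G}
    (hg : ContDiff ℝ ∞ g) {y : Y} (h : ∀ t, g (y, t) = 0) (k : ℕ) : tcoeff g k y = 0 := by
  have h1 : ∀ k : ℕ, hquot^[k] (0 : Y × ℝ → G) = 0 := by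
    intro k
    induction k with
    | zero => rfl
    | succ k ih =>
      rw [Function.iterate_succ_apply', ih]
      funext z
      simp [hquot]
  rw [tcoeff_congr hg (g' := 0) contDiff_const (y' := y) h k, tcoeff, h1 k]
  rfl

end HadamardSlices

/-! ### Expansion of the hyperbolic integral at `t = 0` -/

section Expansion

variable {X : Type} [NormedAddCommGroup X] [NormedSpace ℝ X]
  {G : Type*} [NormedAddCommGroup G] [NormedSpace ℝ G]

/-- Where the weights are nonzero, powers of `r = √(b + t)` and `s = √b` are absorbed by raising
their indices. -/
theorem hypInt_monomial {p q : ℕ} (hp : 0 < p) (hq : 0 < q) (κ : ℝ → ℝ) (i j : ℕ) (F : X → G)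
    [CompleteSpace G] (x : X) (t : ℝ) :
    hypInt p q (fun w => (κ (w.2 ^ 2) * κ (w.1.2 ^ 2) * (w.2 ^ i * w.1.2 ^ j)) • F w.1.1) (x, t) =
      modelInt (p + i) (q + j) κ t • F x := by
  rw [hypInt, modelInt, ← integral_smul_const]
  congr 1
  funext b
  simp only [smul_smul]
  congr 1
  rcases le_or_gt b 0 with hb | hb
  · rw [wt_nonpos hq hb, wt_nonpos (by omega) hb]; ring
  rcases le_or_gt (b + t) 0 with hbt | hbt
  · rw [wt_nonpos hp hbt, wt_nonpos (by omega) hbt]; ring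
  rw [Real.sq_sqrt hb.le, Real.sq_sqrt hbt.le, wt_add, wt_add]
  ring

theorem hypInt_add {p q : ℕ} (hp : 0 < p) (hq : 0 < q) {h h' : (X × ℝ) × ℝ → G}
    (hh : Continuous h) (hh' : Continuous h') {S : ℝ} (hS : ∀ w, S ≤ w.1.2 → h w = 0)
    (hS' : ∀ w, S ≤ w.1.2 → h' w = 0) {z : X × ℝ} (hz : z.2 ≠ 0) :
    hypInt p q (fun w => h w + h' w) z = hypInt p q h z + hypInt p q h' z := by
  simp only [hypInt, smul_add]
  exact integral_add (integrable_hypInt hp hq hh hS hz) (integrable_hypInt hp hq hh' hS' hz)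

theorem hypInt_sum {p q : ℕ} (hp : 0 < p) (hq : 0 < q) {ι : Type*} (s : Finset ι)
    {h : ι → (X × ℝ) × ℝ → G} (hh : ∀ i, Continuous (h i)) {S : ℝ}
    (hS : ∀ i w, S ≤ w.1.2 → h i w = 0) {z : X × ℝ} (hz : z.2 ≠ 0) :
    hypInt p q (fun w => ∑ i ∈ s, h i w) z = ∑ i ∈ s, hypInt p q (h i) z := by
  simp only [hypInt, Finset.smul_sum]
  exact integral_finsetSum _ fun i _ => integrable_hypInt hp hq (hh i) (hS i) hz

/-- Taylor expansion of the integrand reduces `hypInt` to model integrals, up to a `C^l` term. -/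
theorem exists_hypInt_eq_modelInt [FiniteDimensional ℝ X] [CompleteSpace G] {p q : ℕ} (hp : 0 < p)
    (hq : 0 < q) {A : (X × ℝ) × ℝ → G} (hA : ContDiff ℝ ∞ A) {S R : ℝ}
    (hS : ∀ w : (X × ℝ) × ℝ, S ≤ |w.1.2| ∨ S ≤ |w.2| → A w = 0) (hR : S ^ 2 ≤ R) {κ : ℝ → ℝ}
    (hκ : ContDiff ℝ ∞ κ) (hκ1 : ∀ t, |t| ≤ R → κ t = 1) (hκ0 : ∀ t, 2 * R ≤ |t| → κ t = 0)
    {l K : ℕ} (hK : 2 * l + 2 ≤ K) :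
    ∃ U : X × ℝ → G, ContDiff ℝ l U ∧ ∀ x t, t ≠ 0 → hypInt p q A (x, t) = U (x, t) +
      ∑ i ∈ Finset.range K, ∑ j ∈ Finset.range K,
        modelInt (p + i) (q + j) κ t • tcoeff (tcoeff A i) j x := by
  have hR0 : 0 ≤ R := (sq_nonneg S).trans hR
  let c : (X × ℝ) × ℝ → ℝ := fun w => κ (w.2 ^ 2) * κ (w.1.2 ^ 2)
  have hc : ContDiff ℝ ∞ c :=
    (hκ.comp (by fun_prop : ContDiff ℝ ∞ fun w : (X × ℝ) × ℝ => w.2 ^ 2)).mul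
      (hκ.comp (by fun_prop : ContDiff ℝ ∞ fun w : (X × ℝ) × ℝ => w.1.2 ^ 2))
  have habs : ∀ s, 1 + 2 * R ≤ s → κ (s ^ 2) = 0 := by
    intro s hs
    refine hκ0 _ ?_
    rw [abs_of_nonneg (sq_nonneg s)]
    nlinarith
  have hcS : ∀ w : (X × ℝ) × ℝ, 1 + 2 * R ≤ w.1.2 → c w = 0 := fun w hw => by
    simp only [c, habs _ hw, mul_zero]
  have hcS' : ∀ w : (X × ℝ) × ℝ, 1 + 2 * R ≤ w.2 → c w = 0 := fun w hw => by
    simp only [c, habs _ hw, zero_mul]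
  have hcA : ∀ w, A w = c w • A w := by
    intro w
    by_cases h : S ≤ |w.1.2| ∨ S ≤ |w.2|
    · rw [hS w h, smul_zero]
    · push Not at h
      have h1 : ∀ s : ℝ, |s| < S → κ (s ^ 2) = 1 := by
        intro s hs
        refine hκ1 _ (le_trans ?_ hR)
        rw [abs_of_nonneg (sq_nonneg s), ← sq_abs s]
        gcongr
      simp only [c, h1 _ h.1, h1 _ h.2, mul_one, one_smul]
  let a : ℕ → X × ℝ → G := fun i => tcoeff A i
  have ha : ∀ i, ContDiff ℝ ∞ (a i) := contDiff_tcoeff hA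
  let B : (X × ℝ) × ℝ → G := hquot^[K] A
  have hB : ContDiff ℝ ∞ B := contDiff_hquot_iterate hA K
  let B' : ℕ → X × ℝ → G := fun i => hquot^[K] (a i)
  have hB' : ∀ i, ContDiff ℝ ∞ (B' i) := fun i => contDiff_hquot_iterate (ha i) K
  let F : ℕ → ℕ → X → G := fun i j => tcoeff (a i) j
  have hF : ∀ i j, ContDiff ℝ ∞ (F i j) := fun i j => contDiff_tcoeff (ha i) j
  -- `A` is split into a part of order `K` in `r`, parts of order `K` in `s`, and cut-off monomials.
  -- The cut-off `c`, which is `1` wherever `A ≠ 0`, keeps every piece bounded in the radii.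
  let h1 : (X × ℝ) × ℝ → G := fun w => w.2 ^ K • (c w • B w)
  let h2 : ℕ → (X × ℝ) × ℝ → G := fun i w => w.1.2 ^ K • ((c w * w.2 ^ i) • B' i w.1)
  let h3 : ℕ → ℕ → (X × ℝ) × ℝ → G := fun i j w => (c w * (w.2 ^ i * w.1.2 ^ j)) • F i j w.1.1
  have c1 : ContDiff ℝ ∞ h1 := by fun_prop
  have c2 : ∀ i, ContDiff ℝ ∞ (h2 i) := fun i => by
    have := hB' i
    fun_prop
  have c3 : ∀ i j, ContDiff ℝ ∞ (h3 i j) := fun i j => by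
    have := hF i j
    fun_prop
  have s1 : ∀ w, 1 + 2 * R ≤ w.1.2 → h1 w = 0 := fun w hw => by simp [h1, hcS w hw]
  have s2 : ∀ i w, 1 + 2 * R ≤ w.1.2 → h2 i w = 0 := fun i w hw => by simp [h2, hcS w hw]
  have s3 : ∀ i j w, 1 + 2 * R ≤ w.1.2 → h3 i j w = 0 := fun i j w hw => by simp [h3, hcS w hw]
  have hdec : A = fun w => h1 w + ∑ i ∈ Finset.range K,
      (h2 i w + ∑ j ∈ Finset.range K, h3 i j w) := by
    funext w
    obtain ⟨⟨x, s⟩, r⟩ := w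
    rw [hcA, eq_sum_tcoeff_add hA K (x, s) r, add_comm, smul_add, smul_comm, Finset.smul_sum]
    congr 1
    refine Finset.sum_congr rfl fun i _ => ?_
    change c ((x, s), r) • r ^ i • a i (x, s) = _
    rw [eq_sum_tcoeff_add (ha i) K x s, add_comm, smul_add, smul_add]
    congr 1
    · simp only [h2, B', smul_smul]
      congr 1
      ring
    · simp only [h3, Finset.smul_sum, smul_smul, F]
  have f2 : ∀ i, ContDiff ℝ l (hypInt p q (h2 i)) := by
    intro i
    have := hB' i
    -- Vanishing to high order in `s` becomes vanishing in the second radius after exchanging the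
    -- two factors.
    have e : hypInt p q (h2 i) = (hypInt q p fun w => h2 i ((w.1.1, w.2), w.1.2)) ∘
        fun z : X × ℝ => (z.1, -z.2) := by
      funext z
      exact hypInt_swap p q (h2 i) z.1 z.2
    rw [e]
    refine ContDiff.comp (contDiff_hypInt_of_flat hq hp
      (R := fun w => (c ((w.1.1, w.2), w.1.2) * w.1.2 ^ i) • B' i (w.1.1, w.2)) (by fun_prop)
      (K := K) (l := l) (by omega) (fun w _ => rfl) (S := 1 + 2 * R) fun w hw => ?_) (by fun_prop)
    simp [h2, hcS' ((w.1.1, w.2), w.1.2) hw]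
  refine ⟨fun z => hypInt p q h1 z + ∑ i ∈ Finset.range K, hypInt p q (h2 i) z,
    (contDiff_hypInt_of_flat hp hq (R := fun w => c w • B w) (by fun_prop) (K := K) (l := l)
      (by omega) (fun w _ => rfl) s1).add (ContDiff.sum fun i _ => f2 i), fun x t ht => ?_⟩
  rw [hdec, hypInt_add hp hq c1.continuous ?_ s1 ?_ (z := (x, t)) ht,
    hypInt_sum hp hq _ (h := fun i w => h2 i w + ∑ j ∈ Finset.range K, h3 i j w) (S := 1 + 2 * R)
      ?_ ?_ (z := (x, t)) ht, add_assoc, ← Finset.sum_add_distrib, ← hdec]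
  · congr 1
    refine Finset.sum_congr rfl fun i _ => ?_
    rw [hypInt_add hp hq (c2 i).continuous ?_ (s2 i) ?_ (z := (x, t)) ht,
      hypInt_sum hp hq _ (h := h3 i) (fun j => (c3 i j).continuous) (s3 i) (z := (x, t)) ht]
    · congr 1
      exact Finset.sum_congr rfl fun j _ => hypInt_monomial hp hq κ i j (F i j) x t
    · exact continuous_finsetSum _ fun j _ => (c3 i j).continuous
    · intro w hw
      exact Finset.sum_eq_zero fun j _ => s3 i j w hw
  · exact fun i => (c2 i).continuous.add (continuous_finsetSum _ fun j _ => (c3 i j).continuous)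
  · intro i w hw
    rw [s2 i w hw, Finset.sum_eq_zero fun j _ => s3 i j w hw, add_zero]
  · exact continuous_finsetSum _ fun i _ => (c2 i).continuous.add
      (continuous_finsetSum _ fun j _ => (c3 i j).continuous)
  · intro w hw
    refine Finset.sum_eq_zero fun i _ => ?_
    rw [s2 i w hw, Finset.sum_eq_zero fun j _ => s3 i j w hw, add_zero]

theorem sum_range_even_eq {M : Type*} [AddCommMonoid M] (L : ℕ) (f : ℕ → M)
    (hf : ∀ i, Odd i → f i = 0) :
    ∑ i ∈ Finset.range (2 * L), f i = ∑ a ∈ Finset.range L, f (2 * a) := by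
  induction L with
  | zero => simp
  | succ L ih =>
    rw [show 2 * (L + 1) = 2 * L + 1 + 1 by ring, Finset.sum_range_succ, Finset.sum_range_succ, ih,
      Finset.sum_range_succ, hf (2 * L + 1) ⟨L, rfl⟩, add_zero]

theorem sum_range_sum_range_eq_antidiagonal {M : Type*} [AddCommMonoid M] (L : ℕ)
    (f : ℕ → ℕ → M) : ∑ a ∈ Finset.range L, ∑ b ∈ Finset.range L, f a b =
      ∑ k ∈ Finset.range L, ∑ ab ∈ Finset.HasAntidiagonal.antidiagonal k, f ab.1 ab.2 +
      ∑ ab ∈ (Finset.range L ×ˢ Finset.range L).filter (fun ab => L ≤ ab.1 + ab.2),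
        f ab.1 ab.2 := by
  rw [← Finset.sum_product', ← Finset.sum_filter_not_add_sum_filter _
    (fun ab : ℕ × ℕ => L ≤ ab.1 + ab.2)]
  congr 1
  rw [← Finset.sum_fiberwise_of_maps_to (t := Finset.range L) (g := fun ab : ℕ × ℕ => ab.1 + ab.2)]
  · refine Finset.sum_congr rfl fun k hk => Finset.sum_congr ?_ fun _ _ => rfl
    ext ⟨a, b⟩
    simp only [Finset.mem_filter, Finset.mem_product, Finset.mem_range,
      Finset.HasAntidiagonal.mem_antidiagonal] at hk ⊢
    omega
  · intro ab h
    simp only [Finset.mem_filter, Finset.mem_product, Finset.mem_range] at h ⊢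
    omega

/-- The coefficients of the singular part of `hypInt p q A` at `t = 0`. -/
noncomputable def hypCoeff (p q : ℕ) (A : (X × ℝ) × ℝ → G) (k : ℕ) (x : X) : G :=
  ∑ ab ∈ Finset.HasAntidiagonal.antidiagonal k, (betaC (p + 2 * ab.1) (q + 2 * ab.2) * etaSign p q ^ k) •
    tcoeff (tcoeff A (2 * ab.1)) (2 * ab.2) x

/-- Evenness leaves only the monomials `r^(2a) s^(2b)`, whose singular part is a constant times
`t^(a+b) η`. Grouping by `k = a + b` gives the displayed sum; the terms with `a + b ≥ l + 2` are of
class `C^l` and go into `U`, together with the smooth parts of the model integrals. -/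
theorem exists_hypInt_expansion [FiniteDimensional ℝ X] [CompleteSpace G] {p q : ℕ} (hp : 0 < p)
    (hq : 0 < q) {A : (X × ℝ) × ℝ → G} (hA : ContDiff ℝ ∞ A) {S : ℝ}
    (hS : ∀ w : (X × ℝ) × ℝ, S ≤ |w.1.2| ∨ S ≤ |w.2| → A w = 0)
    (hr : ∀ y r, A (y, -r) = A (y, r)) (hs : ∀ x s r, A ((x, -s), r) = A ((x, s), r)) (l : ℕ) :
    ∃ U : X × ℝ → G, (∀ z : X × ℝ, |z.2| < 1 → ContDiffAt ℝ l U z) ∧ ∀ x t, t ≠ 0 → |t| < 1 →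
      hypInt p q A (x, t) = U (x, t) +
        eta p q t • ∑ k ∈ Finset.range (l + 2), t ^ k • hypCoeff p q A k x := by
  -- The radius exceeds `S ^ 2`, so the cut-off does not affect `A`, and is at least `2`, as
  -- `modelInt_expansion` requires.
  obtain ⟨κ, hκ, hκ1, hκ0⟩ := exists_cutoff (S ^ 2 + 2) (by positivity)
  obtain ⟨U, hU, hUA⟩ := exists_hypInt_eq_modelInt hp hq hA hS (R := S ^ 2 + 2) (by linarith)
    hκ hκ1 hκ0 (l := l) (K := 2 * (l + 2)) (by omega)
  have hmod : ∀ a b : ℕ, ∃ D : ℝ → ℝ, ContDiffOn ℝ ∞ D (Ioo (-1) 1) ∧ ∀ t, t ≠ 0 → |t| < 1 →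
      modelInt (p + 2 * a) (q + 2 * b) κ t = D t + betaC (p + 2 * a) (q + 2 * b) *
        eta (p + 2 * a) (q + 2 * b) t := fun a b =>
    modelInt_expansion (by omega) (by omega) hκ
      (fun t ht => hκ1 t (ht.trans (by nlinarith [sq_nonneg S]))) hκ0
  choose D hD hDt using hmod
  let F : ℕ → ℕ → X → G := fun a b => tcoeff (tcoeff A (2 * a)) (2 * b)
  have hF : ∀ a b, ContDiff ℝ ∞ (F a b) := fun a b => contDiff_tcoeff (contDiff_tcoeff hA _) _
  refine ⟨fun z => U z + ∑ a ∈ Finset.range (l + 2), ∑ b ∈ Finset.range (l + 2),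
      D a b z.2 • F a b z.1 +
      ∑ ab ∈ (Finset.range (l + 2) ×ˢ Finset.range (l + 2)).filter
        (fun ab => l + 2 ≤ ab.1 + ab.2), ((eta p q z.2 * z.2 ^ (ab.1 + ab.2)) *
          (betaC (p + 2 * ab.1) (q + 2 * ab.2) * etaSign p q ^ (ab.1 + ab.2))) • F ab.1 ab.2 z.1,
    ?_, ?_⟩
  · intro z hz
    refine (hU.contDiffAt.add (ContDiffAt.sum fun a _ => ContDiffAt.sum fun b _ => ?_)).add
      (ContDiffAt.sum fun ab hab => ?_)
    · have h1 : ContDiffAt ℝ l (D a b) z.2 := ((hD a b).contDiffAt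
        (Ioo_mem_nhds (abs_lt.1 hz).1 (abs_lt.1 hz).2)).of_le (mod_cast le_top)
      have h2 : ContDiffAt ℝ l (F a b) z.1 := (hF a b).contDiffAt.of_le (mod_cast le_top)
      exact (h1.comp z contDiffAt_snd).smul (h2.comp z contDiffAt_fst)
    · have h2 : ContDiffAt ℝ l (F ab.1 ab.2) z.1 :=
        (hF ab.1 ab.2).contDiffAt.of_le (mod_cast le_top)
      have h1 : ContDiff ℝ l fun t => eta p q t * t ^ (ab.1 + ab.2) :=
        contDiff_eta_mul_pow hp hq (by
          have := (Finset.mem_filter.1 hab).2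
          omega)
      exact ((h1.contDiffAt.comp z contDiffAt_snd).mul contDiffAt_const).smul
        (h2.comp z contDiffAt_fst)
  · intro x t ht ht1
    have e1 : ∀ a b, modelInt (p + 2 * a) (q + 2 * b) κ t • F a b x = D a b t • F a b x +
        ((eta p q t * t ^ (a + b)) *
          (betaC (p + 2 * a) (q + 2 * b) * etaSign p q ^ (a + b))) • F a b x := by
      intro a b
      rw [hDt a b t ht ht1, ← add_smul, eta_congr_add_even hp hq ht (a + b) (by simp [Nat.even_add])
        (by simp [Nat.even_add]) (by omega)]
      congr 1
      ring
    have e2 : ∑ i ∈ Finset.range (2 * (l + 2)), ∑ j ∈ Finset.range (2 * (l + 2)),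
        modelInt (p + i) (q + j) κ t • tcoeff (tcoeff A i) j x =
        ∑ a ∈ Finset.range (l + 2), ∑ b ∈ Finset.range (l + 2),
          modelInt (p + 2 * a) (q + 2 * b) κ t • F a b x := by
      rw [sum_range_even_eq]
      · refine Finset.sum_congr rfl fun a _ => ?_
        rw [sum_range_even_eq]
        intro j hj
        rw [tcoeff_odd_eq_zero _ hj, smul_zero]
        intro y s
        have hsm : ContDiff ℝ ∞ fun w : (X × ℝ) × ℝ => A ((w.1.1, -w.1.2), w.2) := by fun_prop
        exact tcoeff_congr hA hA (fun r => hs y s r) _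
      · intro i hi
        refine Finset.sum_eq_zero fun j _ => ?_
        have : tcoeff A i = fun _ => 0 := by
          funext y
          exact tcoeff_odd_eq_zero hr hi y
        rw [this, tcoeff_eq_zero contDiff_const fun _ => rfl, smul_zero]
    rw [hUA x t ht, e2]
    simp only [e1, Finset.sum_add_distrib]
    rw [sum_range_sum_range_eq_antidiagonal (l + 2) fun a b => ((eta p q t * t ^ (a + b)) *
          (betaC (p + 2 * a) (q + 2 * b) * etaSign p q ^ (a + b))) • F a b x]
    have e3 : eta p q t • ∑ k ∈ Finset.range (l + 2), t ^ k • hypCoeff p q A k x =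
        ∑ k ∈ Finset.range (l + 2), ∑ ab ∈ Finset.HasAntidiagonal.antidiagonal k, ((eta p q t * t ^ (ab.1 + ab.2)) *
          (betaC (p + 2 * ab.1) (q + 2 * ab.2) * etaSign p q ^ (ab.1 + ab.2))) •
            F ab.1 ab.2 x := by
      simp only [Finset.smul_sum, hypCoeff, smul_smul]
      refine Finset.sum_congr rfl fun k _ => Finset.sum_congr rfl fun ab hab => ?_
      rw [Finset.HasAntidiagonal.mem_antidiagonal.1 hab]
      congr 1
      ring
    rw [e3]
    abel

end Expansion

/-! ### Extension across `t = 0` -/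

section Extension

variable {Y : Type*} [NormedAddCommGroup Y] [NormedSpace ℝ Y]
  {G : Type*} [NormedAddCommGroup G] [NormedSpace ℝ G]

theorem tendsto_prodMk_punctured (y : Y) :
    Filter.Tendsto (fun t : ℝ => (y, t)) (𝓝[≠] 0) (𝓝 (y, 0)) :=
  ((Continuous.prodMk_right y).tendsto 0).mono_left nhdsWithin_le_nhds

theorem eq_of_eq_punctured {u v : Y × ℝ → G} {y : Y} (hu : ContinuousAt u (y, 0))
    (hv : ContinuousAt v (y, 0)) (h : ∀ᶠ t : ℝ in 𝓝[≠] 0, u (y, t) = v (y, t)) :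
    u (y, 0) = v (y, 0) :=
  tendsto_nhds_unique_of_eventuallyEq (hu.tendsto.comp (tendsto_prodMk_punctured y))
    (hv.tendsto.comp (tendsto_prodMk_punctured y)) h

theorem eventually_abs_lt_one : ∀ᶠ t : ℝ in 𝓝[≠] 0, t ≠ 0 ∧ |t| < 1 := by
  refine Filter.Eventually.and self_mem_nhdsWithin (nhdsWithin_le_nhds ?_)
  filter_upwards [Metric.ball_mem_nhds (0 : ℝ) one_pos] with t ht
  simpa using ht

/-- A function smooth off `t = 0` with `C^l` extensions across `t = 0` for all `l` has a smooth
extension. -/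
theorem exists_contDiff_extension {W : Y × ℝ → G} (hW : ∀ z : Y × ℝ, z.2 ≠ 0 → ContDiffAt ℝ ∞ W z)
    (h : ∀ l : ℕ, ∃ U : Y × ℝ → G, (∀ z : Y × ℝ, |z.2| < 1 → ContDiffAt ℝ l U z) ∧
      ∀ y t, t ≠ 0 → |t| < 1 → W (y, t) = U (y, t)) :
    ∃ V : Y × ℝ → G, ContDiff ℝ ∞ V ∧ ∀ y t, t ≠ 0 → V (y, t) = W (y, t) := by
  classical
  choose U hU hUW using h
  let V : Y × ℝ → G := fun z => if z.2 = 0 then U 0 z else W z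
  have hVW : ∀ z : Y × ℝ, z.2 ≠ 0 → V z = W z := fun z hz => if_neg hz
  have hVU : ∀ l, ∀ z : Y × ℝ, |z.2| < 1 → V z = U l z := by
    rintro l ⟨y, t⟩ hz
    by_cases ht : t = 0
    · subst ht
      have : V (y, 0) = U 0 (y, 0) := if_pos rfl
      rw [this]
      refine eq_of_eq_punctured (hU 0 _ hz).continuousAt (hU l _ hz).continuousAt ?_
      filter_upwards [eventually_abs_lt_one] with t ht
      rw [← hUW 0 y t ht.1 ht.2, hUW l y t ht.1 ht.2]
    · rw [hVW _ ht, hUW l y t ht hz]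
  refine ⟨V, contDiff_iff_contDiffAt.2 fun z => ?_, fun y t ht => hVW _ ht⟩
  by_cases hz : z.2 = 0
  · refine contDiffAt_infty.2 fun l => (hU l z (by simp [hz])).congr_of_eventuallyEq ?_
    have : ∀ᶠ z' : Y × ℝ in 𝓝 z, |z'.2| < 1 := by
      have hc : Continuous fun z' : Y × ℝ => |z'.2| := by fun_prop
      exact hc.continuousAt.eventually_lt_const (by simp [hz])
    filter_upwards [this] with z' hz' using hVU l z' hz'
  · refine (hW z hz).congr_of_eventuallyEq ?_
    have : ∀ᶠ z' : Y × ℝ in 𝓝 z, z'.2 ≠ 0 := continuous_snd.continuousAt.eventually_ne hz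
    filter_upwards [this] with z' hz' using hVW z' hz'

theorem eq_zero_of_punctured {V : Y × ℝ → G} (hV : Continuous V) {K : Set (Y × ℝ)}
    (hK : IsClosed K) (h : ∀ y t, t ≠ 0 → (y, t) ∉ K → V (y, t) = 0) (z : Y × ℝ) (hz : z ∉ K) :
    V z = 0 := by
  obtain ⟨y, t⟩ := z
  by_cases ht : t = 0
  · subst ht
    refine eq_of_eq_punctured (v := fun _ => 0) hV.continuousAt continuousAt_const ?_
    filter_upwards [self_mem_nhdsWithin,
      (tendsto_prodMk_punctured y).eventually (hK.isOpen_compl.mem_nhds hz)] with t ht ht'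
    exact h y t ht ht'
  · exact h y t ht hz

/-- Uniqueness of Taylor coefficients: cancel the earlier ones, divide by `t^k` and let `t → 0`. It
identifies the coefficients of the function built by Borel's lemma. -/
theorem tcoeff_eq_of_expansion {Y : Type} [NormedAddCommGroup Y] [NormedSpace ℝ Y]
    [FiniteDimensional ℝ Y] [CompleteSpace G] {g : Y × ℝ → G}
    (hg : ContDiff ℝ ∞ g) (c : ℕ → Y → G) (h : ∀ N, ∃ ψ : Y × ℝ → G, ContDiff ℝ ∞ ψ ∧
      ∀ y t, g (y, t) = ∑ k ∈ Finset.range N, t ^ k • c k y + t ^ N • ψ (y, t)) (k : ℕ) :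
    ∀ y, tcoeff g k y = c k y := by
  induction k using Nat.strong_induction_on with
  | _ k ih =>
    intro y
    obtain ⟨ψ, hψ, hgψ⟩ := h (k + 1)
    have h1 : ContinuousAt (fun z : Y × ℝ => tcoeff g k z.1 + z.2 • (hquot^[k + 1] g) z) (y, 0) := by
      have h1 := (contDiff_tcoeff hg k).continuous
      have h2 := (contDiff_hquot_iterate hg (k + 1)).continuous
      fun_prop
    have h2 : ContinuousAt (fun z : Y × ℝ => c k y + z.2 • ψ z) (y, 0) := by
      have := hψ.continuous
      fun_prop
    have h3 := eq_of_eq_punctured h1 h2 ?_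
    · simpa using h3
    · filter_upwards [self_mem_nhdsWithin] with t ht
      have ht0 : t ≠ 0 := ht
      have e1 := eq_sum_tcoeff_add hg (k + 1) y t
      rw [hgψ y t, Finset.sum_range_succ, Finset.sum_range_succ, add_assoc, add_assoc,
        Finset.sum_congr rfl fun j hj => by rw [← ih j (Finset.mem_range.1 hj) y]] at e1
      have e2 := add_left_cancel e1
      rw [pow_succ, mul_smul, mul_smul, ← smul_add, ← smul_add] at e2
      exact (smul_right_injective G (pow_ne_zero k ht0) e2).symm

end Extension

/-! ### The mean function lies in `H` -/

section Membership

variable {𝕜 : Type*} [RCLike 𝕜] {m p q : ℕ}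

/-- A smooth function vanishing off a compact set, as a test function. -/
def mkTestFn {E F : Type*} [NormedAddCommGroup E] [NormedSpace ℝ E] [NormedAddCommGroup F]
    [NormedSpace ℝ F] (f : E → F) (hf : ContDiff ℝ ∞ f) (hc : HasCompactSupport f) : TestFn E F :=
  ⟨f, hf, hc, fun _ _ => trivial⟩

theorem mkTestFn_apply {E F : Type*} [NormedAddCommGroup E] [NormedSpace ℝ E]
    [NormedAddCommGroup F] [NormedSpace ℝ F] (f : E → F) (hf : ContDiff ℝ ∞ f)
    (hc : HasCompactSupport f) (z : E) : mkTestFn f hf hc z = f z := rfl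

/-- The coefficients of the singular part of `meanFn p q f` at `t = 0`. -/
noncomputable def meanCoeff {X : Type} [NormedAddCommGroup X] [NormedSpace ℝ X] (p q : ℕ)
    (f : X × Euc (p + q) → 𝕜) (k : ℕ) (x : X) : 𝕜 :=
  (1 / 4 : ℝ) • hypCoeff p q (sphAvg p q f) k x

theorem contDiff_meanCoeff {X : Type} [NormedAddCommGroup X] [NormedSpace ℝ X]
    [FiniteDimensional ℝ X] {f : X × Euc (p + q) → 𝕜} (hf : ContDiff ℝ ∞ f) (k : ℕ) :
    ContDiff ℝ ∞ (meanCoeff p q f k) := by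
  unfold meanCoeff hypCoeff
  have h : ∀ i j, ContDiff ℝ ∞ (tcoeff (tcoeff (sphAvg p q f) i) j) := fun i j =>
    contDiff_tcoeff (contDiff_tcoeff (contDiff_sphAvg hf) i) j
  refine ContDiff.const_smul _ (ContDiff.sum fun ab _ => ContDiff.const_smul _ ?_)
  exact h (2 * ab.1) (2 * ab.2)

theorem meanCoeff_eq_zero {X : Type} [NormedAddCommGroup X] [NormedSpace ℝ X]
    [FiniteDimensional ℝ X] {f : X × Euc (p + q) → 𝕜} (hf : ContDiff ℝ ∞ f) {x : X}
    (h : ∀ y, f (x, y) = 0) (k : ℕ) : meanCoeff p q f k x = 0 := by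
  refine smul_eq_zero_of_right _ (Finset.sum_eq_zero fun ab _ => smul_eq_zero_of_right _ ?_)
  exact tcoeff_eq_zero (contDiff_tcoeff (contDiff_sphAvg hf) _) (fun s =>
    tcoeff_eq_zero (contDiff_sphAvg hf) (fun r => sphAvg_eq_zero _ fun y _ _ => h y) _) _

theorem continuous_quadForm (p q : ℕ) : Continuous (quadForm p q) := by
  unfold quadForm
  fun_prop

/-- The image of `K` under `(x, y) ↦ (x, Q(y))`. -/
def imageCompacts (p q : ℕ) (K : Compacts (Euc m × Euc (p + q))) : Compacts (Euc m × ℝ) :=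
  K.map (fun z => (z.1, quadForm p q z.2))
    (continuous_fst.prodMk ((continuous_quadForm p q).comp continuous_snd))

theorem meanFn_eq_zero_of_notMem (hp : 0 < p) (hq : 0 < q) {K : Compacts (Euc m × Euc (p + q))}
    {f : Euc m × Euc (p + q) → 𝕜} (hf : ∀ z ∉ K, f z = 0) {z : Euc m × ℝ}
    (hz : z ∉ imageCompacts p q K) : meanFn p q f z = 0 := by
  refine meanFn_eq_zero hp hq fun y hy => hf _ fun hK => hz ?_
  exact ⟨(z.1, y), hK, by simp [hy]⟩

/-- Borel's lemma realises the singular coefficients as Taylor coefficients of `φ₁`. Then `M - η φ₁`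
is, for every `l`, a `C^l` function minus `t^(l+2) η ψ`, hence extends smoothly, and the extension
is `φ₀`. -/
theorem exists_meanFn_eq (hp : 0 < p) (hq : 0 < q) (f : TestFn (Euc m × Euc (p + q)) 𝕜) :
    ∃ φ₀ φ₁ : TestFn (Euc m × ℝ) 𝕜,
      (∀ x t, t ≠ 0 → meanFn p q f (x, t) = φ₀ (x, t) + eta p q t • φ₁ (x, t)) ∧
      ∀ k x, tcoeff φ₁ k x = meanCoeff p q f k x := by
  obtain ⟨S, hS0, hS⟩ := exists_bound_of_testFn f
  have hf : ContDiff ℝ ∞ f := f.contDiff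
  let K : Compacts (Euc m × Euc (p + q)) := ⟨tsupport f, f.hasCompactSupport⟩
  have hfK : ∀ z ∉ K, f z = 0 := fun z hz => image_eq_zero_of_notMem_tsupport hz
  let Kx : Set (Euc m) := Prod.fst '' tsupport f
  have hKx : IsCompact Kx := f.hasCompactSupport.image continuous_fst
  obtain ⟨φ, hφ, hφ0, hφN⟩ := exists_contDiff_expansion (meanCoeff p q f)
    (contDiff_meanCoeff hf) hKx fun k x hx => meanCoeff_eq_zero hf (fun y => hfK _ fun hK =>
      hx ⟨(x, y), hK, rfl⟩) k
  let W : Euc m × ℝ → 𝕜 := fun z => meanFn p q f z - eta p q z.2 • φ z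
  have hW : ∀ z : Euc m × ℝ, z.2 ≠ 0 → ContDiffAt ℝ ∞ W z := fun z hz =>
    (contDiffAt_meanFn hp hq hf hS0.le hS hz).sub
      (((contDiffAt_eta p q hz).comp z contDiffAt_snd).smul hφ.contDiffAt)
  obtain ⟨V, hV, hVW⟩ := exists_contDiff_extension hW fun l => by
    obtain ⟨U, hU, hUA⟩ := exists_hypInt_expansion hp hq (contDiff_sphAvg (p := p) (q := q) hf)
      (sphAvg_eq_zero_of_le hS0.le hS) (sphAvg_neg_right f) (sphAvg_neg_left f) l
    obtain ⟨ψ, hψ, hφψ⟩ := hφN (l + 2)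
    refine ⟨fun z => (1 / 4 : ℝ) • U z - (eta p q z.2 * z.2 ^ (l + 2)) • ψ z, fun z hz => ?_,
      fun x t ht ht1 => ?_⟩
    · have h1 : ContDiff ℝ l fun t => eta p q t * t ^ (l + 2) :=
        contDiff_eta_mul_pow hp hq (by omega)
      exact ((contDiffAt_const (c := (1 / 4 : ℝ))).smul (hU z hz)).sub
        ((h1.contDiffAt.comp z contDiffAt_snd).smul (hψ.contDiffAt.of_le (mod_cast le_top)))
    · simp only [W, meanFn]
      rw [hUA x t ht ht1, hφψ x t]
      simp only [smul_add, Finset.smul_sum, meanCoeff, smul_smul]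
      rw [add_sub_assoc, sub_eq_add_neg, sub_eq_add_neg, add_right_inj, neg_add, ← add_assoc,
        add_eq_right, add_neg_eq_zero]
      refine Finset.sum_congr rfl fun k _ => ?_
      congr 1
      ring
  -- The mean function vanishes off the image of the support under `(x, y) ↦ (x, Q(y))`, and `φ`
  -- vanishes off the second compact set.
  have hV0 := eq_zero_of_punctured hV.continuous (K := (imageCompacts p q K : Set _) ∪
      Kx ×ˢ Icc (-1) 1) ((imageCompacts p q K).isCompact.union (hKx.prod isCompact_Icc)).isClosed
      fun x t ht hz => by
    rw [hVW x t ht]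
    simp only [W]
    rw [meanFn_eq_zero_of_notMem hp hq hfK fun h => hz (Or.inl h),
      hφ0 _ fun h => hz (Or.inr h), smul_zero, sub_zero]
  refine ⟨mkTestFn V hV (HasCompactSupport.intro ((imageCompacts p q K).isCompact.union
    (hKx.prod isCompact_Icc)) hV0), mkTestFn φ hφ (HasCompactSupport.intro
    (hKx.prod isCompact_Icc) hφ0), fun x t ht => ?_, fun k x => ?_⟩
  · rw [mkTestFn_apply, mkTestFn_apply, hVW x t ht]
    exact (sub_add_cancel _ _).symm
  · exact tcoeff_eq_of_expansion hφ _ hφN k x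

theorem meanMap_mem (hp : 0 < p) (hq : 0 < q) (f : TestFn (Euc m × Euc (p + q)) 𝕜) :
    meanMap m p q f ∈ H 𝕜 m p q := by
  obtain ⟨φ₀, φ₁, h, -⟩ := exists_meanFn_eq hp hq f
  refine ⟨φ₀, φ₁, fun z => ?_⟩
  rw [meanMap_eq hp hq, h _ _ z.2.2, RCLike.real_smul_eq_coe_mul]

end Membership

/-! ### Sharpness of the regularity of `η` -/

section NoExtension

theorem deriv_eq_of_eqOn_Ioi {g h : ℝ → ℝ} (hgh : ∀ t, 0 < t → g t = h t) {t : ℝ} (ht : 0 < t) :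
    deriv g t = deriv h t :=
  Filter.EventuallyEq.deriv_eq (by filter_upwards [lt_mem_nhds ht] with s hs using hgh s hs)

theorem contDiff_deriv_nat {g : ℝ → ℝ} {l : ℕ} (hg : ContDiff ℝ (l + 1 : ℕ) g) :
    ContDiff ℝ l (deriv g) := by
  rw [Nat.cast_succ] at hg
  exact (contDiff_succ_iff_deriv.1 hg).2.2

/-- Differentiating lowers the power and reproduces the same form, the smooth `Q` absorbing the
polynomial by-products; in the end `log` would have a finite limit at `0⁺`. -/
theorem not_contDiff_pow_mul_log (l : ℕ) : ∀ {c : ℝ} {Q g : ℝ → ℝ}, c ≠ 0 → ContDiff ℝ ∞ Q →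
    ContDiff ℝ l g → ¬ ∀ t, 0 < t → g t = c * (t ^ l * Real.log t) + Q t := by
  induction l with
  | zero =>
    intro c Q g hc hQ hg h
    have h1 : Filter.Tendsto (fun t => c⁻¹ * (g t - Q t)) (𝓝[>] 0) (𝓝 (c⁻¹ * (g 0 - Q 0))) := by
      have := hg.continuous
      have := hQ.continuous
      exact ((by fun_prop : Continuous fun t => c⁻¹ * (g t - Q t)).tendsto 0).mono_left
        nhdsWithin_le_nhds
    refine not_tendsto_nhds_of_tendsto_atBot Real.tendsto_log_nhdsGT_zero _ (h1.congr' ?_)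
    filter_upwards [self_mem_nhdsWithin] with t ht
    rw [h t ht]
    field_simp
    ring
  | succ l ih =>
    intro c Q g hc hQ hg h
    refine ih (c := c * (l + 1)) (Q := fun t => c * t ^ l + deriv Q t) (g := deriv g)
      (mul_ne_zero hc (by positivity)) ?_ (contDiff_deriv_nat hg) fun t ht => ?_
    · have : ContDiff ℝ ∞ (deriv Q) := (contDiff_infty_iff_deriv.1 hQ).2
      fun_prop
    · rw [deriv_eq_of_eqOn_Ioi h ht]
      refine (HasDerivAt.congr_deriv ((((hasDerivAt_pow (l + 1) t).mul
        (Real.hasDerivAt_log ht.ne')).const_mul c).add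
        (hQ.differentiable (by simp) t).hasDerivAt) ?_).deriv
      push_cast
      field_simp
      ring

theorem not_contDiff_rpow (l : ℕ) : ∀ {c : ℝ} {g : ℝ → ℝ}, c ≠ 0 →
    ContDiff ℝ l g → ¬ ∀ t, 0 < t → g t = c * t ^ ((l : ℝ) - 1 / 2) := by
  induction l with
  | zero =>
    intro c g hc hg h
    have h1 : Filter.Tendsto (fun t => c⁻¹ * g t) (𝓝[>] 0) (𝓝 (c⁻¹ * g 0)) := by
      have := hg.continuous
      exact ((by fun_prop : Continuous fun t => c⁻¹ * g t).tendsto 0).mono_left nhdsWithin_le_nhds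
    refine not_tendsto_nhds_of_tendsto_atTop
      (tendsto_rpow_neg_nhdsGT_zero (y := -(1 / 2)) (by norm_num)) _ (h1.congr' ?_)
    filter_upwards [self_mem_nhdsWithin] with t ht
    rw [h t ht, inv_mul_cancel_left₀ hc, Nat.cast_zero, zero_sub]
  | succ l ih =>
    intro c g hc hg h
    have hl : (l : ℝ) + 1 / 2 ≠ 0 := by positivity
    refine ih (c := c * (l + 1 / 2)) (g := deriv g) (mul_ne_zero hc hl) (contDiff_deriv_nat hg)
      fun t ht => ?_
    rw [deriv_eq_of_eqOn_Ioi h ht]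
    refine (HasDerivAt.congr_deriv ((Real.hasDerivAt_rpow_const (Or.inl ht.ne')).const_mul c)
      ?_).deriv
    push_cast
    rw [show (l : ℝ) + 1 - 1 / 2 - 1 = l - 1 / 2 by ring]
    ring

/-- The two one-sided derivatives of order `l` at `0` are `l! c` and `l! c'`. -/
theorem eq_of_contDiff_pow (l : ℕ) : ∀ {c c' : ℝ} {g : ℝ → ℝ}, ContDiff ℝ l g →
    (∀ t, 0 < t → g t = c * t ^ l) → (∀ t, t < 0 → g t = c' * t ^ l) → c = c' := by
  induction l with
  | zero =>
    intro c c' g hg h h'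
    have h1 : Filter.Tendsto (fun _ => c) (𝓝[>] (0 : ℝ)) (𝓝 (g 0)) := by
      refine ((hg.continuous.tendsto 0).mono_left nhdsWithin_le_nhds).congr' ?_
      filter_upwards [self_mem_nhdsWithin] with t ht
      rw [h t ht, pow_zero, mul_one]
    have h2 : Filter.Tendsto (fun _ => c') (𝓝[<] (0 : ℝ)) (𝓝 (g 0)) := by
      refine ((hg.continuous.tendsto 0).mono_left nhdsWithin_le_nhds).congr' ?_
      filter_upwards [self_mem_nhdsWithin] with t ht
      rw [h' t ht, pow_zero, mul_one]
    rw [tendsto_nhds_unique tendsto_const_nhds h1, tendsto_nhds_unique tendsto_const_nhds h2]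
  | succ l ih =>
    intro c c' g hg h h'
    have key : ∀ (c : ℝ) t, deriv (fun t => c * t ^ (l + 1)) t = c * (l + 1) * t ^ l := by
      intro c t
      refine (HasDerivAt.congr_deriv ((hasDerivAt_pow (l + 1) t).const_mul c) ?_).deriv
      push_cast
      ring
    have h1 := ih (c := c * (l + 1)) (c' := c' * (l + 1)) (contDiff_deriv_nat hg)
      (fun t ht => by rw [deriv_eq_of_eqOn_Ioi h ht, key]) fun t ht => by
        rw [← key]
        exact Filter.EventuallyEq.deriv_eq
          (by filter_upwards [gt_mem_nhds ht] with s hs using h' s hs)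
    exact mul_right_cancel₀ (by positivity) h1

theorem not_contDiff_eta {p q l : ℕ} (hp : 0 < p) (hq : 0 < q) (hl : p + q ≤ 2 * l + 2)
    {g : ℝ → ℝ} (hg : ContDiff ℝ l g) : ¬ ∀ t, t ≠ 0 → g t = eta p q t := by
  intro h
  -- The least integer `≥ n/2 - 1`, where the regularity of `η` first fails.
  obtain ⟨l', hl', hn⟩ : ∃ l' ≤ l, p + q = 2 * l' + 1 ∨ p + q = 2 * l' + 2 :=
    ⟨(p + q - 1) / 2, by omega, by omega⟩
  replace hg : ContDiff ℝ l' g := hg.of_le (mod_cast hl')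
  rcases Nat.even_or_odd p with hpe | hpo <;> rcases Nat.even_or_odd q with hqe | hqo
  · have hd : (p + q) / 2 - 1 = l' := by
      rcases hpe with ⟨a, ha⟩
      rcases hqe with ⟨b, hb⟩
      omega
    simp only [eta, Nat.not_odd_iff_even.2 hpe, Nat.not_odd_iff_even.2 hqe, hpe, hqe, false_and,
      and_false, if_false, and_self, if_true, hd] at h
    have := eq_of_contDiff_pow l' (c := 1 / 2) (c' := -1 / 2) hg
      (fun t ht => by rw [h t ht.ne', Real.sign_of_pos ht]; ring)
      (fun t ht => by rw [h t ht.ne, Real.sign_of_neg ht]; ring)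
    norm_num at this
  · have hd : ((p + q : ℕ) : ℝ) / 2 - 1 = l' - 1 / 2 := by
      have : p + q = 2 * l' + 1 := by
        rcases hpe with ⟨a, ha⟩
        rcases hqo with ⟨b, hb⟩
        omega
      rw [this]
      push_cast
      ring
    simp only [eta, Nat.not_odd_iff_even.2 hpe, hpe, hqo, false_and, and_self, if_false, if_true,
      hd] at h
    refine not_contDiff_rpow l' one_ne_zero (hg.comp contDiff_neg) fun t ht => ?_
    simp [h (-t) (by linarith), ht]
  · have hd : ((p + q : ℕ) : ℝ) / 2 - 1 = l' - 1 / 2 := by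
      have : p + q = 2 * l' + 1 := by
        rcases hpo with ⟨a, ha⟩
        rcases hqe with ⟨b, hb⟩
        omega
      rw [this]
      push_cast
      ring
    simp only [eta, hpo, hqe, and_self, if_true, hd] at h
    refine not_contDiff_rpow l' one_ne_zero hg fun t ht => ?_
    simp [h t ht.ne', ht]
  · have hd : (p + q) / 2 - 1 = l' := by
      rcases hpo with ⟨a, ha⟩
      rcases hqo with ⟨b, hb⟩
      omega
    simp only [eta, Nat.not_even_iff_odd.2 hpo, Nat.not_even_iff_odd.2 hqo, false_and, and_false,
      if_false, Real.log_abs, hd] at h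
    refine not_contDiff_pow_mul_log l' one_ne_zero (contDiff_const (c := (0 : ℝ))) hg
      fun t ht => ?_
    rw [h t ht.ne']
    ring

end NoExtension

/-! ### Existence and uniqueness of the singular coefficients -/

section SingularCoeff

variable {𝕜 : Type*} [RCLike 𝕜] {m p q : ℕ}

/-- The half-open interval from `k + n/2 - 1` to `k + n/2` contains an integer. At this `l` a `C^l`
extension is still demanded of the remainder of order `k`, while `t^k η` no longer has one. -/
theorem exists_lt_le_of_eta (p q k : ℕ) (hpq : 0 < p + q) : ∃ l : ℕ,
    (l : ℝ) < k + ((p + q : ℕ) : ℝ) / 2 ∧ p + q + 2 * k ≤ 2 * l + 2 := by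
  refine ⟨(p + q + 2 * k - 1) / 2, ?_, by omega⟩
  have : 2 * ((p + q + 2 * k - 1) / 2) < p + q + 2 * k := by omega
  have h : (2 * ((p + q + 2 * k - 1) / 2 : ℕ) : ℝ) < p + q + 2 * k := by exact_mod_cast this
  push_cast
  linarith

theorem eq_zero_of_contDiff_eta_mul_pow (hp : 0 < p) (hq : 0 < q) {k l : ℕ}
    (hl : p + q + 2 * k ≤ 2 * l + 2) {g : ℝ → 𝕜} (hg : ContDiff ℝ l g) {d : 𝕜}
    (h : ∀ t, t ≠ 0 → g t = (eta p q t : 𝕜) * (d * (t : 𝕜) ^ k)) : d = 0 := by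
  by_contra hd
  have hs : etaSign p q ^ k * etaSign p q ^ k = 1 := by
    rw [← mul_pow, etaSign_mul_self, one_pow]
  refine not_contDiff_eta (p := p + 2 * k) (q := q) (l := l) (by omega) hq (by omega)
    (g := fun t => etaSign p q ^ k * RCLike.re (d⁻¹ * g t)) ?_ fun t ht => ?_
  · exact contDiff_const.mul ((RCLike.reCLM (K := 𝕜)).contDiff.comp (contDiff_const.mul hg))
  · rw [eta_congr_add_even hp hq ht k (by simp [Nat.even_add]) Iff.rfl (by omega), h t ht]
    have : d⁻¹ * ((eta p q t : 𝕜) * (d * (t : 𝕜) ^ k)) = ((eta p q t * t ^ k : ℝ) : 𝕜) := by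
      push_cast
      field_simp
    rw [this, RCLike.ofReal_re]
    ring

/-- Once the earlier coefficients agree, the two extensions of order `k` differ by `η t^k` times the
difference of the `k`-th coefficients, which must then be zero. -/
theorem IsSingularCoeff.unique (hp : 0 < p) (hq : 0 < q) {φ : PuncturedProd m → 𝕜}
    {c c' : ℕ → TestFn (Euc m) 𝕜} (h : IsSingularCoeff p q φ c) (h' : IsSingularCoeff p q φ c') :
    c = c' := by
  funext k
  induction k using Nat.strong_induction_on with
  | _ k ih =>
    ext x
    obtain ⟨l, hl, hl'⟩ := exists_lt_le_of_eta p q k (by omega)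
    obtain ⟨g, hg, hgφ⟩ := h.2 k l hl
    obtain ⟨g', hg', hgφ'⟩ := h'.2 k l hl
    refine sub_eq_zero.1 (eq_zero_of_contDiff_eta_mul_pow hp hq hl'
      (g := fun t => g' (x, t) - g (x, t)) (by fun_prop) fun t ht => ?_)
    have h1 := hgφ (x, ⟨t, ht⟩)
    have h2 := hgφ' (x, ⟨t, ht⟩)
    simp only at h1 h2
    rw [h1, h2, Finset.sum_range_succ, Finset.sum_range_succ,
      Finset.sum_congr rfl fun j hj => by rw [← ih j (Finset.mem_range.1 hj)]]
    ring

theorem IsSingularCoeff.sub {φ ψ : PuncturedProd m → 𝕜} {c d : ℕ → TestFn (Euc m) 𝕜}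
    (h : IsSingularCoeff p q φ c) (h' : IsSingularCoeff p q ψ d) :
    IsSingularCoeff p q (φ - ψ) (fun k => c k - d k) := by
  obtain ⟨⟨K, hK⟩, h⟩ := h
  obtain ⟨⟨K', hK'⟩, h'⟩ := h'
  refine ⟨⟨K ⊔ K', fun k => ?_⟩, fun N l hl => ?_⟩
  · have : tsupport (c k - d k) ⊆ tsupport (c k) ∪ tsupport (d k) := tsupport_sub _ _
    exact this.trans (union_subset_union (hK k) (hK' k))
  · obtain ⟨g, hg, hgφ⟩ := h N l hl
    obtain ⟨g', hg', hgφ'⟩ := h' N l hl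
    refine ⟨g - g', hg.sub hg', fun z => ?_⟩
    simp only [Pi.sub_apply, hgφ, hgφ', FunLike.coe_sub, sub_mul, Finset.sum_sub_distrib]
    ring

theorem singularCoeff_eq (hp : 0 < p) (hq : 0 < q) {φ : PuncturedProd m → 𝕜}
    {c : ℕ → TestFn (Euc m) 𝕜} (h : IsSingularCoeff p q φ c) : singularCoeff p q φ = c := by
  have hex : ∃ c, IsSingularCoeff p q φ c := ⟨c, h⟩
  rw [singularCoeff, dif_pos hex]
  exact (Classical.choose_spec hex).unique hp hq h

theorem hasCompactSupport_tcoeff (φ : TestFn (Euc m × ℝ) 𝕜) (k : ℕ) :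
    ∀ x ∉ Prod.fst '' tsupport φ, tcoeff φ k x = 0 := fun x hx =>
  tcoeff_eq_zero φ.contDiff (fun t => image_eq_zero_of_notMem_tsupport fun h =>
    hx ⟨(x, t), h, rfl⟩) k

/-- The Taylor coefficients of a test function at `t = 0`, as test functions. -/
noncomputable def tcoeffFn (φ : TestFn (Euc m × ℝ) 𝕜) (k : ℕ) : TestFn (Euc m) 𝕜 :=
  mkTestFn (tcoeff φ k) (contDiff_tcoeff φ.contDiff k)
    (HasCompactSupport.intro (φ.hasCompactSupport.image continuous_fst)
      (hasCompactSupport_tcoeff φ k))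

/-- The error is `φ₀` plus `η t^(N+1)` times the Taylor remainder of `φ₁`, and `η t^(N+1)` is `C^l`
exactly in the range `l < N + n/2`. -/
theorem isSingularCoeff_of_eq (hp : 0 < p) (hq : 0 < q) {φ : PuncturedProd m → 𝕜}
    {φ₀ φ₁ : TestFn (Euc m × ℝ) 𝕜} (h : ∀ z : PuncturedProd m,
      φ z = φ₀ (z.1, (z.2 : ℝ)) + (eta p q z.2 : 𝕜) * φ₁ (z.1, (z.2 : ℝ))) :
    IsSingularCoeff p q φ (tcoeffFn φ₁) := by
  have hc : IsCompact (Prod.fst '' tsupport φ₁) := φ₁.hasCompactSupport.image continuous_fst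
  refine ⟨⟨⟨_, hc⟩, fun k => closure_minimal (fun x hx => ?_) hc.isClosed⟩, fun N l hl => ?_⟩
  · by_contra hx'
    exact hx (hasCompactSupport_tcoeff φ₁ k x hx')
  · have hl' : 2 * l + 2 < 2 * (N + 1) + p + q := by
      have : (2 * l : ℝ) < 2 * N + (p + q : ℕ) := by linarith
      have : 2 * l < 2 * N + (p + q) := by exact_mod_cast this
      omega
    refine ⟨fun z => φ₀ z + (eta p q z.2 * z.2 ^ (N + 1)) • (hquot^[N + 1] φ₁) z, ?_, fun z => ?_⟩
    · exact (φ₀.contDiff.of_le (mod_cast le_top)).add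
        (((contDiff_eta_mul_pow hp hq hl').comp contDiff_snd).smul
          ((contDiff_hquot_iterate φ₁.contDiff (N + 1)).of_le (mod_cast le_top)))
    · rw [h z, eq_sum_tcoeff_add φ₁.contDiff (N + 1) z.1 z.2]
      simp only [RCLike.real_smul_eq_coe_mul, tcoeffFn, mkTestFn_apply]
      push_cast
      simp only [mul_comm (((z.2 : ℝ) : 𝕜) ^ _) (tcoeff _ _ _)]
      ring

theorem singularCoeff_sub (hp : 0 < p) (hq : 0 < q) {φ ψ : PuncturedProd m → 𝕜}
    (hφ : φ ∈ H 𝕜 m p q) (hψ : ψ ∈ H 𝕜 m p q) (k : ℕ) :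
    singularCoeff p q (φ - ψ) k = singularCoeff p q φ k - singularCoeff p q ψ k := by
  obtain ⟨φ₀, φ₁, h⟩ := hφ
  obtain ⟨ψ₀, ψ₁, h'⟩ := hψ
  have h1 := isSingularCoeff_of_eq hp hq h
  have h2 := isSingularCoeff_of_eq hp hq h'
  rw [singularCoeff_eq hp hq h1, singularCoeff_eq hp hq h2, singularCoeff_eq hp hq (h1.sub h2)]

theorem singularCoeff_meanMap (hp : 0 < p) (hq : 0 < q) (f : TestFn (Euc m × Euc (p + q)) 𝕜)
    (k : ℕ) (x : Euc m) : singularCoeff p q (meanMap m p q f) k x = meanCoeff p q f k x := by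
  obtain ⟨φ₀, φ₁, h, h'⟩ := exists_meanFn_eq hp hq f
  have h1 : ∀ z : PuncturedProd m, meanMap m p q f z =
      φ₀ (z.1, (z.2 : ℝ)) + (eta p q z.2 : 𝕜) * φ₁ (z.1, (z.2 : ℝ)) := fun z => by
    rw [meanMap_eq hp hq, h _ _ z.2.2, RCLike.real_smul_eq_coe_mul]
  rw [singularCoeff_eq hp hq (isSingularCoeff_of_eq hp hq h1), ← h' k x]
  rfl

end SingularCoeff

/-! ### Linearity of the explicit mean function -/

section Additivity

variable {X : Type} [NormedAddCommGroup X] [NormedSpace ℝ X]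
  {G : Type*} [NormedAddCommGroup G] [NormedSpace ℝ G] {p q : ℕ}

theorem integrable_sphAvg {f : X × Euc (p + q) → G} (hf : Continuous f) (w : (X × ℝ) × ℝ) :
    Integrable (fun o : Sph p × Sph q => f (w.1.1, join p q (w.2 • (o.1 : Euc p),
      w.1.2 • (o.2 : Euc q)))) ((sphMeas p).prod (sphMeas q)) := by
  have hc : Continuous fun o : Sph p × Sph q => f (w.1.1, join p q (w.2 • (o.1 : Euc p),
      w.1.2 • (o.2 : Euc q))) := by fun_prop
  exact hc.integrable_of_hasCompactSupport (HasCompactSupport.of_compactSpace _)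

theorem sphAvg_add {f g : X × Euc (p + q) → G} (hf : Continuous f) (hg : Continuous g) :
    sphAvg p q (fun z => f z + g z) = fun w => sphAvg p q f w + sphAvg p q g w := by
  funext w
  simp only [sphAvg, one_smul]
  exact integral_add (integrable_sphAvg hf w) (integrable_sphAvg hg w)

theorem sphAvg_smul (c : ℝ) (f : X × Euc (p + q) → G) :
    sphAvg p q (fun z => c • f z) = fun w => c • sphAvg p q f w := by
  funext w
  simp only [sphAvg, one_smul]
  exact integral_smul _ _

theorem meanFn_smul (c : ℝ) (f : X × Euc (p + q) → G) (z : X × ℝ) :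
    meanFn p q (fun z => c • f z) z = c • meanFn p q f z := by
  simp only [meanFn, sphAvg_smul, hypInt, smul_comm _ c]
  rw [integral_smul, smul_comm]

theorem meanFn_add [FiniteDimensional ℝ X] [CompleteSpace G] (hp : 0 < p) (hq : 0 < q)
    {f g : X × Euc (p + q) → G} (hf : ContDiff ℝ ∞ f) (hg : ContDiff ℝ ∞ g) {S : ℝ} (hS0 : 0 ≤ S)
    (hS : ∀ x y, S ≤ ‖y‖ → f (x, y) = 0) (hS' : ∀ x y, S ≤ ‖y‖ → g (x, y) = 0) {z : X × ℝ}
    (hz : z.2 ≠ 0) : meanFn p q (fun z => f z + g z) z = meanFn p q f z + meanFn p q g z := by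
  simp only [meanFn, sphAvg_add hf.continuous hg.continuous]
  rw [hypInt_add hp hq (contDiff_sphAvg hf).continuous (contDiff_sphAvg hg).continuous
    (fun w hw => sphAvg_eq_zero_of_le hS0 hS w (Or.inl (hw.trans (le_abs_self _))))
    (fun w hw => sphAvg_eq_zero_of_le hS0 hS' w (Or.inl (hw.trans (le_abs_self _)))) hz, smul_add]

end Additivity

/-! ### Mean functions of bi-radial functions -/

section Radial

variable {p q : ℕ}

/-- The squared norm of the first `p` coordinates. -/
def sqFst (p q : ℕ) (y : Euc (p + q)) : ℝ := ∑ i : Fin p, y (Fin.castAdd q i) ^ 2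

/-- The squared norm of the last `q` coordinates. -/
def sqSnd (p q : ℕ) (y : Euc (p + q)) : ℝ := ∑ i : Fin q, y (Fin.natAdd p i) ^ 2

theorem sqFst_join (y : Euc p × Euc q) : sqFst p q (join p q y) = ‖y.1‖ ^ 2 := by
  simp [sqFst, EuclideanSpace.real_norm_sq_eq]

theorem sqSnd_join (y : Euc p × Euc q) : sqSnd p q (join p q y) = ‖y.2‖ ^ 2 := by
  simp [sqSnd, EuclideanSpace.real_norm_sq_eq]

theorem contDiff_coord {n : ℕ} (i : Fin n) : ContDiff ℝ ∞ fun y : Euc n => y i :=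
  (EuclideanSpace.proj (𝕜 := ℝ) i).contDiff

theorem contDiff_sqFst : ContDiff ℝ ∞ (sqFst p q) :=
  ContDiff.sum fun i _ => (contDiff_coord (Fin.castAdd q i)).pow 2

theorem contDiff_sqSnd : ContDiff ℝ ∞ (sqSnd p q) :=
  ContDiff.sum fun i _ => (contDiff_coord (Fin.natAdd p i)).pow 2

theorem contDiff_quadForm : ContDiff ℝ ∞ (quadForm p q) := contDiff_sqFst.sub contDiff_sqSnd

theorem norm_sq_eq_sqFst_add_sqSnd (y : Euc (p + q)) : ‖y‖ ^ 2 = sqFst p q y + sqSnd p q y := by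
  simp [sqFst, sqSnd, EuclideanSpace.real_norm_sq_eq, Fin.sum_univ_add]

/-- The total mass of the product of the two spheres. -/
noncomputable def sphMass (p q : ℕ) : ℝ := ((sphMeas p).prod (sphMeas q)).real univ

theorem sphMass_ne_zero (hp : 0 < p) (hq : 0 < q) : sphMass p q ≠ 0 := by
  have h : ∀ {d : ℕ}, 0 < d → sphMeas d univ ≠ 0 := by
    intro d hd
    have : Nonempty (Fin d) := ⟨⟨0, hd⟩⟩
    rw [Ne, Measure.measure_univ_eq_zero]
    exact Measure.toSphere_ne_zero _
  rw [sphMass, measureReal_def, ENNReal.toReal_ne_zero]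
  refine ⟨?_, measure_ne_top _ _⟩
  rw [← univ_prod_univ, Measure.prod_prod]
  exact mul_ne_zero (h hp) (h hq)

/-- The mean function of a function of the form `u(x, Q(y)) h(|y'|², |y''|²)`. -/
theorem meanFn_radial {X : Type} [NormedAddCommGroup X] [NormedSpace ℝ X]
    {G : Type*} [NormedAddCommGroup G] [NormedSpace ℝ G] [CompleteSpace G] (hp : 0 < p)
    (hq : 0 < q) (u : X × ℝ → G) (h : ℝ → ℝ → ℝ) (x : X) (t : ℝ) :
    meanFn p q (fun z => h (sqFst p q z.2) (sqSnd p q z.2) • u (z.1, quadForm p q z.2)) (x, t) =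
      (1 / 4 * sphMass p q * ∫ b, wt q b * wt p (b + t) * h (b + t) b) • u (x, t) := by
  rw [meanFn, hypInt, mul_assoc, mul_smul, ← integral_const_mul, ← integral_smul_const]
  congr 2
  funext b
  rcases le_or_gt b 0 with hb | hb
  · simp [wt_nonpos hq hb]
  rcases le_or_gt (b + t) 0 with hbt | hbt
  · simp [wt_nonpos hp hbt]
  have h1 : ∀ o : Sph p × Sph q, (1 : ℝ) • (h (sqFst p q (join p q (√(b + t) • (o.1 : Euc p),
      √b • (o.2 : Euc q)))) (sqSnd p q (join p q (√(b + t) • (o.1 : Euc p),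
      √b • (o.2 : Euc q)))) • u (x, quadForm p q (join p q (√(b + t) • (o.1 : Euc p),
      √b • (o.2 : Euc q))))) = h (b + t) b • u (x, t) := by
    intro o
    rw [one_smul, sqFst_join, sqSnd_join, quadForm_join]
    simp [norm_smul, Real.sq_sqrt hb.le, Real.sq_sqrt hbt.le, mul_pow]
  simp only [sphAvg, h1, integral_const, smul_smul]
  congr 1
  rw [sphMass]
  ring

end Radial

/-! ### Surjectivity -/

section Surjectivity

variable {𝕜 : Type*} [RCLike 𝕜] {m p q : ℕ}

/-- With `a = |y'|²` and `b = |y''|²` one has `Q = a - b` and `‖y‖² = a + b`. A bound on `a + b` is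
needed because the level sets of `Q` are not compact. -/
theorem exists_meanFn_radial (hp : 0 < p) (hq : 0 < q) {u : Euc m × ℝ → 𝕜} (hu : ContDiff ℝ ∞ u)
    (huc : HasCompactSupport u) {h : ℝ → ℝ → ℝ} (hh : ContDiff ℝ ∞ fun a : ℝ × ℝ => h a.1 a.2)
    {B : ℝ} (hB : ∀ x a b, u (x, a - b) ≠ 0 → h a b ≠ 0 → a + b ≤ B) :
    ∃ f : TestFn (Euc m × Euc (p + q)) 𝕜, ∀ x t, meanFn p q f (x, t) =
      (1 / 4 * sphMass p q * ∫ b, wt q b * wt p (b + t) * h (b + t) b) • u (x, t) := by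
  refine ⟨mkTestFn (fun z => h (sqFst p q z.2) (sqSnd p q z.2) • u (z.1, quadForm p q z.2))
    ?_ ?_, meanFn_radial hp hq u h⟩
  · exact (hh.comp ((contDiff_sqFst.comp contDiff_snd).prodMk
      (contDiff_sqSnd.comp contDiff_snd))).smul
      (hu.comp (contDiff_fst.prodMk (contDiff_quadForm.comp contDiff_snd)))
  · refine HasCompactSupport.intro ((huc.isCompact.image continuous_fst).prod
      (isCompact_closedBall (0 : Euc (p + q)) √B)) fun z hz => ?_
    by_contra hne
    rw [smul_eq_zero, not_or] at hne
    refine hz ⟨⟨(z.1, quadForm p q z.2), subset_tsupport _ hne.2, rfl⟩, ?_⟩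
    rw [mem_closedBall_zero_iff]
    refine Real.le_sqrt_of_sq_le ?_
    rw [norm_sq_eq_sqFst_add_sqSnd]
    exact hB z.1 _ _ hne.2 hne.1

/-- A smooth function equal to `1 / wt p` on `[1 / 2, ∞)`. -/
theorem exists_contDiff_mul_wt_eq_one (hp : 0 < p) :
    ∃ v : ℝ → ℝ, ContDiff ℝ ∞ v ∧ ∀ a, 1 / 2 ≤ a → wt p a * v a = 1 := by
  obtain ⟨κ, hκ, hκ1, hκ0⟩ := exists_cutoff (1 / 4) (by norm_num)
  refine ⟨fun a => (1 - κ a) * (wt p a)⁻¹, contDiff_inv_mul_of_eventuallyEq_zero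
    (contDiff_const.sub hκ) ?_ _ fun t ht => ?_, fun a ha => ?_⟩
  · filter_upwards [Metric.ball_mem_nhds (0 : ℝ) (by norm_num : (0 : ℝ) < 1 / 4)] with r hr
    rw [mem_ball_zero_iff, Real.norm_eq_abs] at hr
    simp [hκ1 r hr.le]
  · rcases lt_or_gt_of_ne ht with h | h
    · refine (contDiffAt_const (c := (0 : ℝ))).congr_of_eventuallyEq ?_
      filter_upwards [gt_mem_nhds h] with s hs
      rw [wt_nonpos hp hs.le, inv_zero]
    · refine (contDiffAt_wt p h).inv ?_
      rw [wt]
      positivity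
  · have h0 : 0 < a := by linarith
    have : wt p a ≠ 0 := by
      rw [wt]
      positivity
    simp only [hκ0 a (by rw [abs_of_pos h0]; linarith), sub_zero, one_mul]
    exact mul_inv_cancel₀ this

/-- Both weights are divided out in `h`, leaving a bump in `b` of integral `1`; the constant `4 /
sphMass p q` then normalises the factor in front of `u` to `1`. -/
theorem exists_meanFn_eq_smooth (hp : 0 < p) (hq : 0 < q) {u : Euc m × ℝ → 𝕜}
    (hu : ContDiff ℝ ∞ u) (huc : HasCompactSupport u) :
    ∃ f : TestFn (Euc m × Euc (p + q)) 𝕜, ∀ x t, meanFn p q f (x, t) = u (x, t) := by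
  obtain ⟨R, hR⟩ := huc.isCompact.isBounded.exists_norm_le
  have hR' : ∀ x t, u (x, t) ≠ 0 → |t| ≤ R := fun x t h =>
    (norm_snd_le (x, t)).trans (hR _ (subset_tsupport _ h))
  obtain ⟨v, hv, hv1⟩ := exists_contDiff_mul_wt_eq_one hp
  obtain ⟨v', hv', hv1'⟩ := exists_contDiff_mul_wt_eq_one hq
  -- On the support `|R| + 1 ≤ b ≤ |R| + 3`, so for `|t| ≤ |R|` both `b` and `b + t` are at least
  -- `1`, where the reciprocal weights are valid; the same bounds give `a + b ≤ 3|R| + 6`.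
  let g : ContDiffBump (|R| + 2) := ⟨1 / 4, 1 / 2, by norm_num, by norm_num⟩
  let n : ℝ → ℝ := g.normed volume
  have hn : ContDiff ℝ ∞ n := g.contDiff_normed
  have hn0 : ∀ b, n b ≠ 0 → |R| + 1 ≤ b ∧ b ≤ |R| + 3 := by
    intro b hb
    have h1 : b ∈ Function.support (g.normed volume) := hb
    rw [g.support_normed_eq, Metric.mem_ball, Real.dist_eq] at h1
    have hg : g.rOut = 1 / 2 := rfl
    rw [hg] at h1
    have h2 := abs_lt.1 h1
    constructor
    · linarith [h2.1]
    · linarith [h2.2]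
  have hM := sphMass_ne_zero hp hq
  obtain ⟨f, hf⟩ := exists_meanFn_radial hp hq (contDiff_const (c := 4 * (sphMass p q)⁻¹)|>.smul hu)
    (huc.smul_left (f := fun _ => 4 * (sphMass p q)⁻¹))
    (h := fun a b => v a * (v' b * n b)) (B := 3 * |R| + 6) (by fun_prop) (by
      intro x a b h1 h2
      have h3 := hn0 b (right_ne_zero_of_mul (right_ne_zero_of_mul h2))
      have h4 := abs_le.1 ((hR' x _ (right_ne_zero_of_smul h1)).trans (le_abs_self R))
      linarith [h3.2, h4.2])
  refine ⟨f, fun x t => ?_⟩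
  rw [hf]
  by_cases h0 : u (x, t) = 0
  · simp [h0]
  have ht := abs_le.1 ((hR' x t h0).trans (le_abs_self R))
  have hint : ∫ b, wt q b * wt p (b + t) * (v (b + t) * (v' b * n b)) = 1 := by
    rw [← g.integral_normed (μ := volume)]
    congr 1
    funext b
    change _ = n b
    by_cases hb : n b = 0
    · simp [hb]
    · have h1 := hn0 b hb
      have h2 := hv1 (b + t) (by linarith [h1.1, ht.1])
      have h3 := hv1' b (by linarith [h1.1, abs_nonneg R])
      linear_combination (wt q b * v' b * n b) * h2 + n b * h3
  rw [hint]
  simp only [Pi.smul_apply', smul_smul]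
  convert one_smul ℝ (u (x, t)) using 2
  field_simp

theorem contDiff_one_sub_mul_eta (p q : ℕ) {ζ : ℝ → ℝ} (hζ : ContDiff ℝ ∞ ζ)
    (hζ1 : ∀ t, |t| ≤ 1 / 4 → ζ t = 1) : ContDiff ℝ ∞ fun t => (1 - ζ t) * eta p q t := by
  refine contDiff_inv_mul_of_eventuallyEq_zero (contDiff_const.sub hζ) ?_ _
    fun t ht => contDiffAt_eta p q ht
  filter_upwards [Metric.ball_mem_nhds (0 : ℝ) (by norm_num : (0 : ℝ) < 1 / 4)] with r hr
  rw [mem_ball_zero_iff, Real.norm_eq_abs] at hr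
  simp [hζ1 r hr.le]

theorem contDiff_cutoff_mul {ζ A : ℝ → ℝ} (hζ : ContDiff ℝ ∞ ζ)
    (hζ0 : ∀ t, 2 * (1 / 4) ≤ |t| → ζ t = 0) (hA : ContDiffOn ℝ ∞ A (Ioo (-1) 1)) :
    ContDiff ℝ ∞ fun t => ζ t * A t := by
  refine contDiff_iff_contDiffAt.2 fun t => ?_
  by_cases ht : |t| < 1
  · exact hζ.contDiffAt.mul (hA.contDiffAt (Ioo_mem_nhds (abs_lt.1 ht).1 (abs_lt.1 ht).2))
  · refine (contDiffAt_const (c := (0 : ℝ))).congr_of_eventuallyEq ?_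
    have : ∀ᶠ s : ℝ in 𝓝 t, 1 / 2 < |s| :=
      continuous_abs.continuousAt.eventually_const_lt (by linarith)
    filter_upwards [this] with s hs
    rw [hζ0 s (by linarith), zero_mul]

/-- The function built from `d ζ φ₁` and the cut-offs `κ` has mean `ζ η φ₁ + C⁻¹ ζ A φ₁`; here `C ≠
0` is indispensable. What is missing, `φ₀ + (1 - ζ) η φ₁ - C⁻¹ ζ A φ₁`, is smooth with compact
support and is supplied by `exists_meanFn_eq_smooth`. The support of `ζ` lies inside `|t| < 1`,
where the model expansion holds. -/
theorem exists_meanMap_eq (hp : 0 < p) (hq : 0 < q) {φ : PuncturedProd m → 𝕜}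
    (hφ : φ ∈ H 𝕜 m p q) : ∃ f : TestFn (Euc m × Euc (p + q)) 𝕜, meanMap m p q f = φ := by
  obtain ⟨φ₀, φ₁, hφ⟩ := hφ
  obtain ⟨κ, hκ, hκ1, hκ0⟩ := exists_cutoff 2 (by norm_num)
  obtain ⟨ζ, hζ, hζ1, hζ0⟩ := exists_cutoff (1 / 4) (by norm_num)
  obtain ⟨A, hA, hAt⟩ := modelInt_expansion hp hq hκ hκ1 (B := 4)
    fun t ht => hκ0 t (by linarith)
  have hM := sphMass_ne_zero hp hq
  have hC := (betaC_spec hp hq).1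
  set C := betaC p q
  let d : ℝ := 4 * (sphMass p q)⁻¹ * C⁻¹
  have hφ₀ : ContDiff ℝ ∞ φ₀ := φ₀.contDiff
  have hφ₁ : ContDiff ℝ ∞ φ₁ := φ₁.contDiff
  have hu₁ : ContDiff ℝ ∞ fun z => (d * ζ z.2) • φ₁ z :=
    (contDiff_const.mul (hζ.comp contDiff_snd)).smul hφ₁
  have huc₁ : HasCompactSupport fun z => (d * ζ z.2) • φ₁ z :=
    φ₁.hasCompactSupport.smul_left (f := fun z : Euc m × ℝ => d * ζ z.2)
  have hκκ : ContDiff ℝ ∞ fun a : ℝ × ℝ => κ a.1 * κ a.2 := by fun_prop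
  have hκ8 : ∀ a b, κ a * κ b ≠ 0 → a + b ≤ 8 := by
    intro a b h
    have key : ∀ a, κ a ≠ 0 → a ≤ 4 := by
      intro a ha
      by_contra! h
      exact ha (hκ0 a (by linarith [le_abs_self a]))
    linarith [key a (left_ne_zero_of_mul h), key b (right_ne_zero_of_mul h)]
  obtain ⟨f₁, hf₁⟩ := exists_meanFn_radial (h := fun a b => κ a * κ b) hp hq hu₁ huc₁ hκκ
    fun _ a b _ h => hκ8 a b h
  have hη := contDiff_one_sub_mul_eta p q hζ hζ1
  have hζA := contDiff_cutoff_mul hζ hζ0 hA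
  obtain ⟨f₂, hf₂⟩ := exists_meanFn_eq_smooth hp hq
    (u := fun z => φ₀ z + ((1 - ζ z.2) * eta p q z.2 - C⁻¹ * (ζ z.2 * A z.2)) • φ₁ z)
    (hφ₀.add (((hη.comp contDiff_snd).sub (contDiff_const.mul (hζA.comp contDiff_snd))).smul hφ₁))
    (φ₀.hasCompactSupport.add (φ₁.hasCompactSupport.smul_left
      (f := fun z : Euc m × ℝ => (1 - ζ z.2) * eta p q z.2 - C⁻¹ * (ζ z.2 * A z.2))))
  refine ⟨f₁ + f₂, funext fun z => ?_⟩
  obtain ⟨x, t, ht⟩ := z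
  obtain ⟨S₁, hS₁, hf₁S⟩ := exists_bound_of_testFn f₁
  obtain ⟨S₂, hS₂, hf₂S⟩ := exists_bound_of_testFn f₂
  rw [meanMap_eq hp hq, hφ]
  have hadd := meanFn_add hp hq f₁.contDiff f₂.contDiff (S := max S₁ S₂) (by positivity)
    (fun x y h => hf₁S x y ((le_max_left _ _).trans h))
    (fun x y h => hf₂S x y ((le_max_right _ _).trans h)) (z := (x, t)) ht
  have hadd' : (⇑(f₁ + f₂)) = fun z => f₁ z + f₂ z := rfl
  rw [hadd', hadd, hf₁, hf₂]
  have hmod : ∫ b, wt q b * wt p (b + t) * (κ (b + t) * κ b) = modelInt p q κ t := by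
    rw [modelInt]
    exact integral_congr_ae (Filter.Eventually.of_forall fun b => by ring)
  rw [hmod]
  rw [add_left_comm, smul_smul, ← add_smul, ← RCLike.real_smul_eq_coe_mul]
  congr 2
  by_cases ht1 : |t| < 1
  · rw [hAt t ht ht1]
    simp only [d]
    field_simp
    ring
  · simp [hζ0 t (by linarith)]

end Surjectivity

/-! ### `𝓓_K` is a Baire space -/

section Complete

variable {E F : Type*} [NormedAddCommGroup E] [NormedSpace ℝ E] [NormedAddCommGroup F]
  [NormedSpace ℝ F] {K : Compacts E}

/-- If all derivatives converge uniformly, the limits form the Taylor series of the limit function.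
Sequences suffice because the target is a countable product of normed spaces. -/
theorem isClosed_range_structureMap : IsClosed (range (ContinuousLinearMap.pi
    (ContDiffMapSupportedIn.structureMapCLM ℝ ⊤) : ContDiffMapSupportedIn E F ⊤ K →L[ℝ]
      Π i, BoundedContinuousFunction E (E [×i]→L[ℝ] F))) := by
  refine IsSeqClosed.isClosed fun u g hu hg => ?_
  choose f hf using hu
  have hfi : ∀ n i x, u n i x = iteratedFDeriv ℝ i (f n) x := fun n i x => by
    rw [← hf n, ← ContDiffMapSupportedIn.structureMapCLM_top_apply ℝ (f n)]
    rfl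
  have hunif : ∀ i, TendstoUniformly (fun n x => iteratedFDeriv ℝ i (f n) x) (g i)
      Filter.atTop := by
    intro i
    have h1 := BoundedContinuousFunction.tendsto_iff_tendstoUniformly.1 ((tendsto_pi_nhds.1 hg) i)
    have h2 : (fun n x => iteratedFDeriv ℝ i (f n) x) = fun n => ⇑(u n i) := by
      funext n x
      exact (hfi n i x).symm
    rw [h2]
    exact h1
  let f₀ : E → F := fun x => (g 0 x).curry0
  have hser : HasFTaylorSeriesUpTo ∞ f₀ fun x i => g i x := by
    refine ⟨fun x => rfl, fun m _ => ?_, fun m _ => (g m).continuous⟩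
    let L := continuousMultilinearCurryLeftEquiv ℝ (fun _ : Fin (m + 1) => E) F
    have h1 : TendstoUniformly (fun n x => L (iteratedFDeriv ℝ (m + 1) (f n) x))
        (fun x => L (g (m + 1) x)) Filter.atTop :=
      L.isometry.uniformContinuous.comp_tendstoUniformly (hunif (m + 1))
    refine hasFDerivAt_of_tendstoUniformly h1 (fun n x => ?_) fun x =>
      (hunif m).tendsto_at x
    have h2 : HasFTaylorSeriesUpTo ∞ (f n) (ftaylorSeries ℝ (f n)) :=
      (f n).contDiff.ftaylorSeries
    exact h2.fderiv m (mod_cast ENat.natCast_lt_top m) x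
  have hzero : ∀ x ∉ K, f₀ x = 0 := by
    intro x hx
    have h1 := (hunif 0).tendsto_at x
    have h2 : (fun n => iteratedFDeriv ℝ 0 (f n) x) = fun _ => 0 := by
      funext n
      exact (f n).iteratedFDeriv_zero_on_compl hx
    rw [h2] at h1
    have h3 : g 0 x = 0 := tendsto_nhds_unique h1 tendsto_const_nhds
    simp [f₀, h3]
  have hf₀ : ContDiff ℝ ∞ f₀ := hser.contDiff
  refine ⟨⟨f₀, hf₀, fun x hx => hzero x hx⟩, ?_⟩
  funext i
  ext1 x
  have h1 : g i x = iteratedFDeriv ℝ i f₀ x :=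
    hser.eq_iteratedFDeriv (m := i) (mod_cast le_top) x
  rw [h1]
  exact congrFun (ContDiffMapSupportedIn.structureMapCLM_top_apply ℝ _) x

/-- A closed embedding into a countable product of Banach spaces gives complete metrizability, hence
the Baire property; barrelledness of `𝓓_K` rests on this. -/
instance instBaireSpaceSupportedIn [CompleteSpace F] :
    BaireSpace (ContDiffMapSupportedIn E F ⊤ K) := by
  have h : IsClosedEmbedding (ContinuousLinearMap.pi
      (ContDiffMapSupportedIn.structureMapCLM ℝ ⊤) : ContDiffMapSupportedIn E F ⊤ K →L[ℝ]
        Π i, BoundedContinuousFunction E (E [×i]→L[ℝ] F)) :=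
    ⟨(ContDiffMapSupportedIn.isUniformEmbedding_pi_structureMapCLM ℝ).isEmbedding,
      isClosed_range_structureMap⟩
  have := h.IsCompletelyPseudoMetrizableSpace
  infer_instance

end Complete

/-! ### Families of functionals on a barrelled space -/

section Barrelled

variable {E : Type*} [AddCommGroup E] [Module ℝ E] [UniformSpace E] [IsUniformAddGroup E]
  [ContinuousSMul ℝ E] {G : Type*} [NormedAddCommGroup G] [NormedSpace ℝ G]
  {Y : Type*} [NormedAddCommGroup Y] [NormedSpace ℝ Y]

/-- `Λ` is a continuous real linear map. -/
def IsCLin (Λ : E → G) : Prop := ∃ L : E →L[ℝ] G, ∀ f, L f = Λ f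

theorem IsCLin.add {Λ Λ' : E → G} (h : IsCLin Λ) (h' : IsCLin Λ') :
    IsCLin fun f => Λ f + Λ' f := by
  obtain ⟨L, hL⟩ := h
  obtain ⟨L', hL'⟩ := h'
  exact ⟨L + L', fun f => by simp [hL, hL']⟩

theorem IsCLin.sub {Λ Λ' : E → G} (h : IsCLin Λ) (h' : IsCLin Λ') :
    IsCLin fun f => Λ f - Λ' f := by
  obtain ⟨L, hL⟩ := h
  obtain ⟨L', hL'⟩ := h'
  exact ⟨L - L', fun f => by simp [hL, hL']⟩

theorem IsCLin.smul {Λ : E → G} (h : IsCLin Λ) (c : ℝ) : IsCLin fun f => c • Λ f := by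
  obtain ⟨L, hL⟩ := h
  exact ⟨c • L, fun f => by simp [hL]⟩

theorem IsCLin.sum {ι : Type*} (s : Finset ι) {Λ : ι → E → G} (h : ∀ i, IsCLin (Λ i)) :
    IsCLin fun f => ∑ i ∈ s, Λ i f := by
  choose L hL using h
  exact ⟨∑ i ∈ s, L i, fun f => by simp [hL]⟩

/-- Banach–Steinhaus, after shifting the sequence past the finitely many exceptional terms. -/
theorem IsCLin.of_tendsto [BarrelledSpace ℝ E] {Λ : ℕ → E → G} {Λ' : E → G}
    (h : ∀ᶠ n in Filter.atTop, IsCLin (Λ n))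
    (hlim : ∀ f, Filter.Tendsto (fun n => Λ n f) Filter.atTop (𝓝 (Λ' f))) : IsCLin Λ' := by
  obtain ⟨N, hN⟩ := Filter.eventually_atTop.1 h
  choose L hL using fun n : ℕ => hN (n + N) (by omega)
  refine ⟨continuousLinearMapOfTendsto (l := Filter.atTop) L (f := Λ') ?_, fun f => rfl⟩
  refine tendsto_pi_nhds.2 fun f => ?_
  simp only [hL]
  exact (Filter.tendsto_add_atTop_iff_nat N).2 (hlim f)

/-- A family of functions, smooth on `O`, whose values on `O` depend linearly and continuously on
the parameter. -/
structure GoodOn (O : Set Y) (Φ : E → Y → G) : Prop where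
  contDiffAt : ∀ f, ∀ z ∈ O, ContDiffAt ℝ ∞ (Φ f) z
  isCLin : ∀ z ∈ O, IsCLin fun f => Φ f z

theorem contDiffAt_lineDeriv {O : Set Y} (hO : IsOpen O) {u : Y → G}
    (hu : ∀ z ∈ O, ContDiffAt ℝ ∞ u z) (v : Y) : ∀ z ∈ O,
    ContDiffAt ℝ ∞ (fun z => lineDeriv ℝ u z v) z := by
  intro z hz
  have h1 : ContDiffAt ℝ ∞ (fun z => fderiv ℝ u z v) z :=
    ((hu z hz).fderiv_right (m := ∞) (by simp)).clm_apply contDiffAt_const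
  refine h1.congr_of_eventuallyEq ?_
  filter_upwards [hO.mem_nhds hz] with z' hz'
  exact ((hu z' hz').differentiableAt (by simp)).lineDeriv_eq_fderiv

/-- A derivative in `z` is a pointwise limit of difference quotients, each continuous and linear in
the parameter; no estimate of derivatives in terms of `f` is required. -/
theorem GoodOn.lineDeriv [BarrelledSpace ℝ E] {O : Set Y} (hO : IsOpen O) {Φ : E → Y → G}
    (h : GoodOn O Φ) (v : Y) : GoodOn O fun f z => lineDeriv ℝ (Φ f) z v := by
  refine ⟨fun f => contDiffAt_lineDeriv hO (h.contDiffAt f) v, fun z hz => ?_⟩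
  have h0 : Filter.Tendsto (fun n : ℕ => 1 / ((n : ℝ) + 1)) Filter.atTop (𝓝[≠] 0) :=
    tendsto_nhdsWithin_iff.2 ⟨tendsto_one_div_add_atTop_nhds_zero_nat,
      Filter.Eventually.of_forall fun n => (by positivity : (1 / ((n : ℝ) + 1)) ≠ 0)⟩
  refine IsCLin.of_tendsto (Λ := fun n f => (1 / ((n : ℝ) + 1))⁻¹ •
    (Φ f (z + (1 / ((n : ℝ) + 1)) • v) - Φ f z)) ?_ fun f => ?_
  · have hc : Continuous fun t : ℝ => z + t • v := by fun_prop
    have h1 : ∀ᶠ t : ℝ in 𝓝 0, z + t • v ∈ O :=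
      hc.continuousAt.eventually_mem (hO.mem_nhds (by simpa using hz))
    filter_upwards [(h0.mono_right nhdsWithin_le_nhds).eventually h1] with n hn
    exact ((h.isCLin _ hn).sub (h.isCLin z hz)).smul _
  · have h1 := ((h.contDiffAt f z hz).differentiableAt (by simp)).lineDifferentiableAt (v := v)
    exact h1.hasLineDerivAt.tendsto_slope_zero.comp h0

/-- Iterated derivatives in the directions of a list. -/
noncomputable def iterD (L : List Y) (u : Y → G) : Y → G :=
  L.foldr (fun v w z => lineDeriv ℝ w z v) u

theorem contDiffAt_iterD {O : Set Y} (hO : IsOpen O) (L : List Y) {u : Y → G}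
    (hu : ∀ z ∈ O, ContDiffAt ℝ ∞ u z) : ∀ z ∈ O, ContDiffAt ℝ ∞ (iterD L u) z := by
  induction L with
  | nil => exact hu
  | cons v L ih => exact contDiffAt_lineDeriv hO ih v

theorem GoodOn.iterD [BarrelledSpace ℝ E] {O : Set Y} (hO : IsOpen O) {Φ : E → Y → G}
    (h : GoodOn O Φ) (L : List Y) : GoodOn O fun f => MeanFunction.iterD L (Φ f) := by
  induction L with
  | nil => exact h
  | cons v L ih => exact ih.lineDeriv hO v

theorem lineDeriv_congr_on {O : Set Y} (hO : IsOpen O) {u w : Y → G} (h : ∀ z ∈ O, u z = w z)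
    (v : Y) {z : Y} (hz : z ∈ O) : lineDeriv ℝ u z v = lineDeriv ℝ w z v := by
  refine Filter.EventuallyEq.lineDeriv_eq ?_
  filter_upwards [hO.mem_nhds hz] with z' hz' using h z' hz'

theorem iterD_congr {O : Set Y} (hO : IsOpen O) (L : List Y) {u w : Y → G}
    (h : ∀ z ∈ O, u z = w z) : ∀ z ∈ O, MeanFunction.iterD L u z = MeanFunction.iterD L w z := by
  induction L with
  | nil => exact h
  | cons v L ih => exact fun z hz => lineDeriv_congr_on hO ih v hz

theorem iterD_sub {O : Set Y} (hO : IsOpen O) (L : List Y) {u w : Y → G}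
    (hu : ∀ z ∈ O, ContDiffAt ℝ ∞ u z) (hw : ∀ z ∈ O, ContDiffAt ℝ ∞ w z) : ∀ z ∈ O,
    MeanFunction.iterD L (fun z => u z - w z) z =
      MeanFunction.iterD L u z - MeanFunction.iterD L w z := by
  induction L with
  | nil => exact fun z _ => rfl
  | cons v L ih =>
    intro z hz
    have h1 : ∀ {g : Y → G}, (∀ z ∈ O, ContDiffAt ℝ ∞ g z) →
        LineDifferentiableAt ℝ (MeanFunction.iterD L g) z v := fun hg =>
      ((contDiffAt_iterD hO L hg z hz).differentiableAt (by simp)).lineDifferentiableAt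
    refine (lineDeriv_congr_on hO ih v hz).trans ?_
    have h2 : HasLineDerivAt ℝ
        (fun z => MeanFunction.iterD L u z - MeanFunction.iterD L w z) _ z v :=
      HasDerivAt.sub (h1 hu).hasLineDerivAt (h1 hw).hasLineDerivAt
    exact h2.lineDeriv

/-- The supremum of a pointwise bounded family of continuous linear maps on a barrelled space,
translated pointwise, is continuous. -/
theorem continuous_iSup_sub [BarrelledSpace ℝ E] {ι : Type*} {Λ : ι → E → G}
    (h : ∀ i, IsCLin (Λ i)) (hb : ∀ f, BddAbove (range fun i => ‖Λ i f‖)) (a : ι → G) :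
    Continuous fun f => ⨆ i, ‖Λ i f - a i‖ₑ := by
  choose L hL using h
  let p : ι → Seminorm ℝ E := fun i => (normSeminorm ℝ G).comp (L i).toLinearMap
  have hp : ∀ i f, p i f = ‖Λ i f‖ := fun i f => by simp [p, hL]
  have hbdd : BddAbove (range p) := by
    rw [Seminorm.bddAbove_range_iff]
    intro f
    simpa only [hp] using hb f
  -- The pointwise supremum of the seminorms is a finite lower semicontinuous seminorm, and
  -- barrelledness makes it continuous.
  obtain ⟨P, hP, hle⟩ : ∃ P : Seminorm ℝ E, Continuous P ∧ ∀ i f, p i f ≤ P f := by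
    refine ⟨⨆ i, p i, ?_, fun i f => (le_ciSup hbdd i) f⟩
    rw [Seminorm.coe_iSup_eq hbdd]
    exact Seminorm.continuous_iSup p (fun i => (L i).continuous.norm) hbdd
  have key : ∀ f g, ⨆ i, ‖Λ i f - a i‖ₑ ≤
      (⨆ i, ‖Λ i g - a i‖ₑ) + ENNReal.ofReal (P (f - g)) := by
    intro f g
    refine iSup_le fun i => ?_
    have e1 : Λ i f - a i = (Λ i g - a i) + (Λ i f - Λ i g) := by abel
    rw [e1]
    refine (enorm_add_le _ _).trans (add_le_add (le_iSup (fun i => ‖Λ i g - a i‖ₑ) i) ?_)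
    rw [← ofReal_norm]
    refine ENNReal.ofReal_le_ofReal (le_trans ?_ (hle i (f - g)))
    rw [hp, ← hL, ← hL, ← hL, map_sub]
  refine continuous_iff_continuousAt.2 fun f₀ => ?_
  have h0 : Filter.Tendsto (fun f => ENNReal.ofReal (P (f - f₀))) (𝓝 f₀) (𝓝 0) := by
    have : Continuous fun f => ENNReal.ofReal (P (f - f₀)) :=
      ENNReal.continuous_ofReal.comp (hP.comp (continuous_id.sub continuous_const))
    simpa using this.tendsto f₀
  -- Truncated subtraction in `ℝ≥0∞` keeps the squeeze valid even when the supremum is infinite.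
  refine tendsto_of_tendsto_of_tendsto_of_le_of_le
    (g := fun f => (⨆ i, ‖Λ i f₀ - a i‖ₑ) - ENNReal.ofReal (P (f - f₀)))
    (h := fun f => (⨆ i, ‖Λ i f₀ - a i‖ₑ) + ENNReal.ofReal (P (f - f₀))) ?_ ?_ ?_ ?_
  · simpa using ENNReal.Tendsto.sub tendsto_const_nhds h0 (Or.inr ENNReal.zero_ne_top)
  · simpa using tendsto_const_nhds.add h0
  · intro f
    refine tsub_le_iff_right.2 ((key f₀ f).trans_eq ?_)
    rw [← neg_sub f f₀, map_neg_eq_map]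
  · exact fun f => key f f₀

theorem GoodOn.continuous_iSup_iterD [BarrelledSpace ℝ E] {O : Set Y} (hO : IsOpen O)
    {Φ : E → Y → G} (h : GoodOn O Φ) (L : List Y) {ι : Type*} {ζ : ι → Y} (hζ : ∀ i, ζ i ∈ O)
    (hb : ∀ f, BddAbove (range fun i => ‖MeanFunction.iterD L (Φ f) (ζ i)‖)) {ψ : Y → G}
    (hψ : ∀ z ∈ O, ContDiffAt ℝ ∞ ψ z) :
    Continuous fun f => ⨆ i, ‖MeanFunction.iterD L (fun z => Φ f z - ψ z) (ζ i)‖ₑ := by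
  have h1 := continuous_iSup_sub (fun i => (h.iterD hO L).isCLin (ζ i) (hζ i)) hb
    fun i => MeanFunction.iterD L ψ (ζ i)
  convert h1 using 4 with f i
  congr 1
  exact iterD_sub hO L (h.contDiffAt f) hψ _ (hζ i)

end Barrelled

/-! ### Mixed partial derivatives as iterated directional derivatives -/

section Directions

variable {G : Type*} [NormedAddCommGroup G] [NormedSpace ℝ G]
  {Y : Type*} [NormedAddCommGroup Y] [NormedSpace ℝ Y]

theorem iterD_append (L L' : List Y) (u : Y → G) : iterD (L ++ L') u = iterD L (iterD L' u) := by
  simp [iterD]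

theorem iterD_map_inl (L : List Y) (u : Y × ℝ → G) (y : Y) (t : ℝ) :
    iterD (L.map fun v => (v, (0 : ℝ))) u (y, t) = iterD L (fun y => u (y, t)) y := by
  induction L generalizing y with
  | nil => rfl
  | cons v L ih =>
    change lineDeriv ℝ (iterD (L.map fun v => (v, (0 : ℝ))) u) (y, t) (v, 0) =
      lineDeriv ℝ (iterD L fun y => u (y, t)) y v
    simp [lineDeriv, ih]

theorem iterD_replicate_inr (l : ℕ) (u : Y × ℝ → G) (y : Y) (t : ℝ) :
    iterD (List.replicate l ((0 : Y), (1 : ℝ))) u (y, t) =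
      iteratedDeriv l (fun t => u (y, t)) t := by
  induction l generalizing t with
  | zero => rfl
  | succ l ih =>
    rw [List.replicate_succ, iteratedDeriv_succ]
    change lineDeriv ℝ (iterD (List.replicate l ((0 : Y), (1 : ℝ))) u) (y, t) (0, 1) = _
    simp only [lineDeriv, Prod.smul_mk, smul_zero, smul_eq_mul, mul_one, Prod.mk_add_mk, add_zero,
      ih]
    rw [deriv_comp_const_add (f := iteratedDeriv l fun t => u (y, t)), add_zero]

variable {𝕜 : Type*} [RCLike 𝕜] {m : ℕ}

/-- The list of directions of the derivative `∂^i`. -/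
noncomputable def dirs (i : Fin m → ℕ) : List (Euc m) :=
  (List.finRange m).flatMap fun j => List.replicate (i j) (EuclideanSpace.single j (1 : ℝ))

theorem partialX_eq_iterD (i : Fin m → ℕ) (g : Euc m → 𝕜) : partialX i g = iterD (dirs i) g := by
  have h1 : ∀ (j : Fin m) (k : ℕ) (u : Euc m → 𝕜),
      (fun v x => lineDeriv ℝ v x (EuclideanSpace.single j (1 : ℝ)))^[k] u =
        iterD (List.replicate k (EuclideanSpace.single j (1 : ℝ))) u := by
    intro j k u
    induction k with
    | zero => rfl
    | succ k ih => rw [Function.iterate_succ_apply', ih, List.replicate_succ]; rfl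
  have h2 : ∀ l : List (Fin m), l.foldr (fun j u =>
      (fun v x => lineDeriv ℝ v x (EuclideanSpace.single j (1 : ℝ)))^[i j] u) g =
      iterD (l.flatMap fun j => List.replicate (i j) (EuclideanSpace.single j (1 : ℝ))) g := by
    intro l
    induction l with
    | nil => rfl
    | cons j l ih => rw [List.foldr_cons, ih, h1, List.flatMap_cons, iterD_append]
  exact h2 _

theorem partialX_iteratedDeriv_eq_iterD (i : Fin m → ℕ) (l : ℕ) (u : Euc m × ℝ → 𝕜) (x : Euc m)
    (t : ℝ) : partialX i (fun x => iteratedDeriv l (fun t => u (x, t)) t) x =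
      iterD ((dirs i).map (fun v => (v, (0 : ℝ))) ++ List.replicate l (0, 1)) u (x, t) := by
  rw [partialX_eq_iterD, iterD_append, iterD_map_inl]
  simp only [iterD_replicate_inr]

end Directions

/-! ### Boundedness of derivatives with limited regularity in `t` -/

section Bounded

variable {G : Type*} [NormedAddCommGroup G] [NormedSpace ℝ G]
  {Y : Type*} [NormedAddCommGroup Y] [NormedSpace ℝ Y]

theorem lineDeriv_mem_of_mem_span {A : Set (Y → G)} {B : Submodule ℝ (Y → G)} {v : Y}
    (h : ∀ u ∈ A, (∀ z, LineDifferentiableAt ℝ u z v) ∧ (fun z => lineDeriv ℝ u z v) ∈ B)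
    {u : Y → G} (hu : u ∈ Submodule.span ℝ A) :
    (∀ z, LineDifferentiableAt ℝ u z v) ∧ (fun z => lineDeriv ℝ u z v) ∈ B := by
  induction hu using Submodule.span_induction with
  | mem u hu => exact h u hu
  | zero =>
    refine ⟨fun z => differentiableAt_const (c := (0 : G)), ?_⟩
    have : (fun z => lineDeriv ℝ (0 : Y → G) z v) = 0 := by
      funext z
      exact deriv_const 0 (0 : G)
    rw [this]
    exact B.zero_mem
  | add u w _ _ hu hw =>
    refine ⟨fun z => (hu.1 z).add (hw.1 z), ?_⟩
    have : (fun z => lineDeriv ℝ (u + w) z v) =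
        (fun z => lineDeriv ℝ u z v) + fun z => lineDeriv ℝ w z v := by
      funext z
      exact deriv_add (hu.1 z) (hw.1 z)
    rw [this]
    exact B.add_mem hu.2 hw.2
  | smul c u _ hu =>
    refine ⟨fun z => (hu.1 z).const_smul c, ?_⟩
    have : (fun z => lineDeriv ℝ (c • u) z v) = c • fun z => lineDeriv ℝ u z v := by
      funext z
      exact deriv_const_smul c (hu.1 z)
    rw [this]
    exact B.smul_mem c hu.2

/-- The span of the functions `e(t) ψ(y, t)` with `e` of class `C^r` and `ψ` a smooth function with
compact support. -/
def prodSpan (Y G : Type*) [NormedAddCommGroup Y] [NormedSpace ℝ Y] [NormedAddCommGroup G]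
    [NormedSpace ℝ G] (r : ℕ) : Submodule ℝ (Y × ℝ → G) :=
  Submodule.span ℝ {u | ∃ (e : ℝ → ℝ) (ψ : Y × ℝ → G), ContDiff ℝ r e ∧ ContDiff ℝ ∞ ψ ∧
    HasCompactSupport ψ ∧ u = fun z => e z.2 • ψ z}

theorem mem_prodSpan {r : ℕ} {e : ℝ → ℝ} {ψ : Y × ℝ → G} (he : ContDiff ℝ r e)
    (hψ : ContDiff ℝ ∞ ψ) (hc : HasCompactSupport ψ) :
    (fun z => e z.2 • ψ z) ∈ prodSpan Y G r :=
  Submodule.subset_span ⟨e, ψ, he, hψ, hc, rfl⟩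

theorem contDiff_lineDeriv {u : Y → G} (hu : ContDiff ℝ ∞ u) (v : Y) :
    ContDiff ℝ ∞ fun z => lineDeriv ℝ u z v :=
  contDiff_iff_contDiffAt.2 fun z =>
    contDiffAt_lineDeriv isOpen_univ (fun z _ => hu.contDiffAt) v z (mem_univ z)

theorem hasCompactSupport_lineDeriv {u : Y → G} (hu : ContDiff ℝ ∞ u) (hc : HasCompactSupport u)
    (v : Y) : HasCompactSupport fun z => lineDeriv ℝ u z v := by
  have : (fun z => lineDeriv ℝ u z v) = fun z => fderiv ℝ u z v := by
    funext z
    exact (hu.differentiable (by simp) z).lineDeriv_eq_fderiv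
  rw [this]
  exact hc.fderiv_apply ℝ v

theorem exists_bound_iterD (L : List Y) {u : Y → G} (hu : ContDiff ℝ ∞ u)
    (hc : HasCompactSupport u) : ∃ C, ∀ z, ‖iterD L u z‖ ≤ C := by
  have h : ContDiff ℝ ∞ (iterD L u) ∧ HasCompactSupport (iterD L u) := by
    induction L with
    | nil => exact ⟨hu, hc⟩
    | cons v L ih => exact ⟨contDiff_lineDeriv ih.1 v, hasCompactSupport_lineDeriv ih.1 ih.2 v⟩
  exact h.1.continuous.bounded_above_of_compact_support h.2

/-- The rough factor `e` depends on `t` only, so derivatives in `Y` fall on `ψ` alone and cost no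
regularity. -/
theorem lineDeriv_inl_mem_prodSpan {r : ℕ} (v : Y) {u : Y × ℝ → G} (hu : u ∈ prodSpan Y G r) :
    (fun z => lineDeriv ℝ u z (v, (0 : ℝ))) ∈ prodSpan Y G r := by
  refine (lineDeriv_mem_of_mem_span ?_ hu).2
  rintro u ⟨e, ψ, he, hψ, hc, rfl⟩
  have hd : ∀ z, HasLineDerivAt ℝ (fun z : Y × ℝ => e z.2 • ψ z)
      (e z.2 • lineDeriv ℝ ψ z (v, (0 : ℝ))) z (v, (0 : ℝ)) := by
    intro z
    have h1 : HasLineDerivAt ℝ ψ (lineDeriv ℝ ψ z (v, (0 : ℝ))) z (v, (0 : ℝ)) :=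
      (hψ.differentiable (by simp) z).lineDifferentiableAt.hasLineDerivAt
    have h2 := HasDerivAt.const_smul (e z.2) h1
    have h3 : (fun t : ℝ => e (z + t • (v, (0 : ℝ))).2 • ψ (z + t • (v, (0 : ℝ)))) =
        e z.2 • fun t : ℝ => ψ (z + t • (v, (0 : ℝ))) := by
      funext t
      simp
    rw [HasLineDerivAt, h3]
    exact h2
  refine ⟨fun z => (hd z).lineDifferentiableAt, ?_⟩
  rw [funext fun z => (hd z).lineDeriv]
  exact mem_prodSpan he (contDiff_lineDeriv hψ _) (hasCompactSupport_lineDeriv hψ hc _)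

theorem lineDeriv_inr_mem_prodSpan {r : ℕ} {u : Y × ℝ → G} (hu : u ∈ prodSpan Y G (r + 1)) :
    (fun z => lineDeriv ℝ u z ((0 : Y), (1 : ℝ))) ∈ prodSpan Y G r := by
  refine (lineDeriv_mem_of_mem_span ?_ hu).2
  rintro u ⟨e, ψ, he, hψ, hc, rfl⟩
  have hd : ∀ z, HasLineDerivAt ℝ (fun z : Y × ℝ => e z.2 • ψ z)
      (e z.2 • lineDeriv ℝ ψ z ((0 : Y), (1 : ℝ)) + deriv e z.2 • ψ z) z ((0 : Y), (1 : ℝ)) := by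
    intro z
    have h1 : HasLineDerivAt ℝ ψ (lineDeriv ℝ ψ z ((0 : Y), (1 : ℝ))) z ((0 : Y), (1 : ℝ)) :=
      (hψ.differentiable (by simp) z).lineDifferentiableAt.hasLineDerivAt
    have h2 : HasDerivAt (fun h : ℝ => e (z.2 + h)) (deriv e z.2) 0 := by
      have h3 : HasDerivAt e (deriv e z.2) (z.2 + 0) := by
        rw [add_zero]
        exact (he.differentiable (by simp) z.2).hasDerivAt
      simpa using h3.comp_const_add z.2 0
    have h4 := HasDerivAt.smul h2 h1
    have h5 : (fun t : ℝ => e (z + t • ((0 : Y), (1 : ℝ))).2 • ψ (z + t • ((0 : Y), (1 : ℝ)))) =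
        (fun h : ℝ => e (z.2 + h)) • fun t : ℝ => ψ (z + t • ((0 : Y), (1 : ℝ))) := by
      funext t
      simp
    rw [HasLineDerivAt, h5]
    simpa using h4
  refine ⟨fun z => (hd z).lineDifferentiableAt, ?_⟩
  rw [funext fun z => (hd z).lineDeriv]
  rw [Nat.cast_succ] at he
  have he' := contDiff_succ_iff_deriv.1 he
  exact Submodule.add_mem _ (mem_prodSpan (he.of_le (by simp)) (contDiff_lineDeriv hψ _)
    (hasCompactSupport_lineDeriv hψ hc _)) (mem_prodSpan he'.2.2 hψ hc)

theorem exists_bound_of_mem_prodSpan {r : ℕ} {u : Y × ℝ → G} (hu : u ∈ prodSpan Y G r) :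
    ∃ C, ∀ z, ‖u z‖ ≤ C := by
  induction hu using Submodule.span_induction with
  | mem u hu =>
    obtain ⟨e, ψ, he, hψ, hc, rfl⟩ := hu
    refine Continuous.bounded_above_of_compact_support ?_
      (hc.smul_left (f := fun z : Y × ℝ => e z.2))
    exact (he.continuous.comp continuous_snd).smul hψ.continuous
  | zero => exact ⟨0, fun z => by simp⟩
  | add u w _ _ hu hw =>
    obtain ⟨C, hC⟩ := hu
    obtain ⟨D, hD⟩ := hw
    exact ⟨C + D, fun z => (norm_add_le _ _).trans (add_le_add (hC z) (hD z))⟩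
  | smul c u _ hu =>
    obtain ⟨C, hC⟩ := hu
    refine ⟨‖c‖ * C, fun z => ?_⟩
    rw [Pi.smul_apply, norm_smul]
    exact mul_le_mul_of_nonneg_left (hC z) (norm_nonneg c)

/-- The `l` derivatives in `t` are innermost and use up the regularity of `e`; any number of
derivatives in `Y` may follow. -/
theorem exists_bound_iterD_of_mem_prodSpan (L : List Y) {l : ℕ} {u : Y × ℝ → G}
    (hu : u ∈ prodSpan Y G l) : ∃ C, ∀ z,
      ‖iterD (L.map (fun v => (v, (0 : ℝ))) ++ List.replicate l ((0 : Y), (1 : ℝ))) u z‖ ≤ C := by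
  have h1 : ∀ l r, u ∈ prodSpan Y G (r + l) →
      iterD (List.replicate l ((0 : Y), (1 : ℝ))) u ∈ prodSpan Y G r := by
    intro l
    induction l with
    | zero => exact fun r h => h
    | succ l ih =>
      intro r h
      exact lineDeriv_inr_mem_prodSpan (ih (r + 1) (by rwa [add_right_comm, add_assoc]))
  have h2 : ∀ L : List Y, iterD (L.map fun v => (v, (0 : ℝ)))
      (iterD (List.replicate l ((0 : Y), (1 : ℝ))) u) ∈ prodSpan Y G 0 := by
    intro L
    induction L with
    | nil => exact h1 l 0 (by rwa [zero_add])
    | cons v L ih => exact lineDeriv_inl_mem_prodSpan v ih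
  rw [iterD_append]
  exact exists_bound_of_mem_prodSpan (h2 L)

end Bounded

/-! ### Structure of the remainders `T_N φ` -/

section Remainder

variable {𝕜 : Type*} [RCLike 𝕜] {m p q : ℕ}

theorem isOpen_punctured (m : ℕ) : IsOpen {z : Euc m × ℝ | z.2 ≠ 0} :=
  isOpen_ne_fun continuous_snd continuous_const

theorem singularCoeff_of_eq (hp : 0 < p) (hq : 0 < q) {φ : PuncturedProd m → 𝕜}
    {φ₀ φ₁ : TestFn (Euc m × ℝ) 𝕜} (h : ∀ z : PuncturedProd m,
      φ z = φ₀ (z.1, (z.2 : ℝ)) + (eta p q z.2 : 𝕜) * φ₁ (z.1, (z.2 : ℝ))) (k : ℕ) (x : Euc m) :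
    singularCoeff p q φ k x = tcoeff φ₁ k x := by
  rw [singularCoeff_eq hp hq (isSingularCoeff_of_eq hp hq h)]
  rfl

theorem remainder_eq_of_ne (χ : ℝ → ℝ) (N : ℕ) (φ : PuncturedProd m → 𝕜) {z : Euc m × ℝ}
    (hz : z.2 ≠ 0) : remainder p q χ N φ z = φ (z.1, ⟨z.2, hz⟩) - (χ z.2 * eta p q z.2) •
      ∑ k ∈ Finset.range (N + 1), z.2 ^ k • singularCoeff p q φ k z.1 := by
  simp only [remainder, extendZero, dif_pos hz, RCLike.real_smul_eq_coe_mul]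
  push_cast
  simp only [mul_comm]

theorem remainder_sub (hp : 0 < p) (hq : 0 < q) (χ : ℝ → ℝ) (N : ℕ) {φ ψ : PuncturedProd m → 𝕜}
    (hφ : φ ∈ H 𝕜 m p q) (hψ : ψ ∈ H 𝕜 m p q) {z : Euc m × ℝ} (hz : z.2 ≠ 0) :
    remainder p q χ N (φ - ψ) z = remainder p q χ N φ z - remainder p q χ N ψ z := by
  simp only [remainder_eq_of_ne χ N _ hz, singularCoeff_sub hp hq hφ hψ, FunLike.coe_sub,
    Pi.sub_apply, smul_sub, Finset.sum_sub_distrib]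
  ring

theorem contDiffAt_remainder {χ : ℝ → ℝ} (hχ : ContDiff ℝ ∞ χ)
    (N : ℕ) {φ : PuncturedProd m → 𝕜} (hφ : φ ∈ H 𝕜 m p q) :
    ∀ z ∈ {z : Euc m × ℝ | z.2 ≠ 0}, ContDiffAt ℝ ∞ (remainder p q χ N φ) z := by
  intro z hz
  obtain ⟨φ₀, φ₁, h⟩ := hφ
  have hη : ContDiffAt ℝ ∞ (fun z : Euc m × ℝ => eta p q z.2) z :=
    (contDiffAt_eta p q hz).comp z contDiffAt_snd
  have hχ' : ContDiffAt ℝ ∞ (fun z : Euc m × ℝ => χ z.2) z := (hχ.comp contDiff_snd).contDiffAt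
  have hc : ∀ k, ContDiffAt ℝ ∞ (fun z : Euc m × ℝ => singularCoeff p q φ k z.1) z := fun k =>
    ((singularCoeff p q φ k).contDiff.comp contDiff_fst).contDiffAt
  have h1 : ContDiffAt ℝ ∞ (fun z : Euc m × ℝ => (φ₀ z + eta p q z.2 • φ₁ z) -
      (χ z.2 * eta p q z.2) • ∑ k ∈ Finset.range (N + 1),
        z.2 ^ k • singularCoeff p q φ k z.1) z :=
    (φ₀.contDiff.contDiffAt.add (hη.smul φ₁.contDiff.contDiffAt)).sub ((hχ'.mul hη).smul
      (ContDiffAt.sum fun k _ => (contDiffAt_snd.pow k).smul (hc k)))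
  refine h1.congr_of_eventuallyEq ?_
  filter_upwards [(isOpen_punctured m).mem_nhds hz] with z' hz'
  simp only [remainder_eq_of_ne χ N φ hz', h, RCLike.real_smul_eq_coe_mul]

/-- With `R` the Taylor remainder of `φ₁`, the identity is `T_N φ = φ₀ + η t^(N+1) ((1 - χ) t^(-N-1)
φ₁ + χ R)`. The first term in the bracket is smooth since `χ = 1` near `0`, and `χ` supplies the
compact support in `t` that `R` may lack. -/
theorem exists_remainder_eq (hp : 0 < p) (hq : 0 < q) {χ : ℝ → ℝ} (hχ : ContDiff ℝ ∞ χ)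
    (hχc : HasCompactSupport χ) (hχ1 : χ =ᶠ[𝓝 0] 1) {N l : ℕ}
    (hl : (l : ℝ) < N + ((p + q : ℕ) : ℝ) / 2) {φ : PuncturedProd m → 𝕜} (hφ : φ ∈ H 𝕜 m p q) :
    ∃ u ∈ prodSpan (Euc m) 𝕜 l, ∀ z : Euc m × ℝ, z.2 ≠ 0 → remainder p q χ N φ z = u z := by
  obtain ⟨φ₀, φ₁, h⟩ := hφ
  have hl' : 2 * l + 2 < 2 * (N + 1) + p + q := by
    have : (2 * l : ℝ) < 2 * N + (p + q : ℕ) := by linarith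
    have : 2 * l < 2 * N + (p + q) := by exact_mod_cast this
    omega
  have he := contDiff_eta_mul_pow hp hq hl'
  have hζ : ContDiff ℝ ∞ fun t => (1 - χ t) / t ^ (N + 1) := by
    refine contDiff_div_pow_of_eventuallyEq_zero (contDiff_const.sub hχ) ?_ (N + 1)
    filter_upwards [hχ1] with t ht
    simp [ht]
  let R : Euc m × ℝ → 𝕜 := hquot^[N + 1] φ₁
  have hR : ContDiff ℝ ∞ R := contDiff_hquot_iterate φ₁.contDiff (N + 1)
  have hR0 : ∀ x ∉ Prod.fst '' tsupport φ₁, ∀ t, R (x, t) = 0 := by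
    intro x hx t
    by_cases ht : t = 0
    · subst ht
      exact hasCompactSupport_tcoeff φ₁ (N + 1) x hx
    · have h1 := eq_sum_tcoeff_add φ₁.contDiff (N + 1) x t
      rw [image_eq_zero_of_notMem_tsupport fun h => hx ⟨(x, t), h, rfl⟩,
        Finset.sum_eq_zero fun k _ => by rw [hasCompactSupport_tcoeff φ₁ k x hx, smul_zero],
        zero_add] at h1
      exact (smul_eq_zero.1 h1.symm).resolve_left (pow_ne_zero _ ht)
  have hχR : HasCompactSupport fun z : Euc m × ℝ => χ z.2 • R z := by
    refine HasCompactSupport.intro ((φ₁.hasCompactSupport.image continuous_fst).prod hχc)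
      fun z hz => ?_
    by_cases hz1 : z.1 ∈ Prod.fst '' tsupport φ₁
    · rw [image_eq_zero_of_notMem_tsupport fun h => hz ⟨hz1, h⟩, zero_smul]
    · rw [show z = (z.1, z.2) from rfl, hR0 z.1 hz1, smul_zero]
  refine ⟨_, Submodule.add_mem _ (Submodule.add_mem _
    (mem_prodSpan (contDiff_const (c := (1 : ℝ))) φ₀.contDiff φ₀.hasCompactSupport)
    (mem_prodSpan he ((hζ.comp contDiff_snd).smul φ₁.contDiff)
      (φ₁.hasCompactSupport.smul_left (f := fun z : Euc m × ℝ => (1 - χ z.2) / z.2 ^ (N + 1)))))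
    (mem_prodSpan he ((hχ.comp contDiff_snd).smul hR) hχR), fun z hz => ?_⟩
  rw [remainder_eq_of_ne χ N φ hz, h]
  simp only [singularCoeff_of_eq hp hq h]
  have h1 := eq_sum_tcoeff_add φ₁.contDiff (N + 1) z.1 z.2
  have h2 : ∑ k ∈ Finset.range (N + 1), z.2 ^ k • tcoeff φ₁ k z.1 =
      φ₁ z - z.2 ^ (N + 1) • R z := eq_sub_of_add_eq h1.symm
  rw [h2]
  simp only [Pi.add_apply, Pi.smul_apply', Function.comp_apply, ← RCLike.real_smul_eq_coe_mul,
    smul_sub, smul_smul, one_smul]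
  have h3 : eta p q z.2 * z.2 ^ (N + 1) * ((1 - χ z.2) / z.2 ^ (N + 1)) =
      eta p q z.2 - χ z.2 * eta p q z.2 := by
    field_simp
  rw [h3, sub_smul, show χ z.2 * eta p q z.2 * z.2 ^ (N + 1) =
    eta p q z.2 * z.2 ^ (N + 1) * χ z.2 by ring]
  abel

end Remainder

/-! ### Taylor coefficients of families -/

section Families

variable {E : Type*} [AddCommGroup E] [Module ℝ E] [UniformSpace E] [IsUniformAddGroup E]
  [ContinuousSMul ℝ E] [BarrelledSpace ℝ E] {G : Type*} [NormedAddCommGroup G] [NormedSpace ℝ G]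
  [CompleteSpace G] {Y : Type} [NormedAddCommGroup Y] [NormedSpace ℝ Y] [FiniteDimensional ℝ Y]

theorem isCLin_of_bound {Λ : E → G} (hadd : ∀ f g, Λ (f + g) = Λ f + Λ g)
    (hsmul : ∀ (c : ℝ) f, Λ (c • f) = c • Λ f) {P : E → ℝ} (hP : Continuous P) (hP0 : P 0 = 0)
    (hb : ∀ f, ‖Λ f‖ ≤ P f) : IsCLin Λ := by
  let L : E →ₗ[ℝ] G := { toFun := Λ, map_add' := hadd, map_smul' := hsmul }
  refine ⟨⟨L, continuous_of_continuousAt_zero L ?_⟩, fun f => rfl⟩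
  have h0 : Filter.Tendsto P (𝓝 0) (𝓝 0) := by simpa [hP0] using hP.tendsto 0
  rw [ContinuousAt, map_zero]
  exact squeeze_zero_norm hb h0

/-- For `t ≠ 0` the quotient is explicitly `(Φ f (y, t) - Φ f (y, 0)) / t`; the value at `t = 0` is
a limit of these, so Banach–Steinhaus applies. -/
theorem GoodOn.hquot {Φ : E → Y × ℝ → G} (h : GoodOn univ Φ) :
    GoodOn univ fun f => MeanFunction.hquot (Φ f) := by
  have hsm : ∀ f, ContDiff ℝ ∞ (Φ f) := fun f =>
    contDiff_iff_contDiffAt.2 fun z => h.contDiffAt f z (mem_univ z)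
  have hne : ∀ y t, t ≠ 0 → IsCLin fun f => MeanFunction.hquot (Φ f) (y, t) := by
    intro y t ht
    have h1 := ((h.isCLin (y, t) (mem_univ _)).sub (h.isCLin (y, 0) (mem_univ _))).smul t⁻¹
    have h2 : (fun f => MeanFunction.hquot (Φ f) (y, t)) =
        fun f => t⁻¹ • (Φ f (y, t) - Φ f (y, 0)) := by
      funext f
      rw [eq_add_smul_hquot (hsm f) y t, add_sub_cancel_left, inv_smul_smul₀ ht]
    rw [h2]
    exact h1
  refine ⟨fun f z _ => (contDiff_hquot (hsm f)).contDiffAt, fun z _ => ?_⟩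
  obtain ⟨y, t⟩ := z
  by_cases ht : t = 0
  · subst ht
    refine IsCLin.of_tendsto (Λ := fun n f => MeanFunction.hquot (Φ f) (y, 1 / ((n : ℝ) + 1)))
      (Filter.Eventually.of_forall fun n => hne y _ (by positivity)) fun f => ?_
    have hc : Continuous fun t : ℝ => MeanFunction.hquot (Φ f) (y, t) := by
      have := (contDiff_hquot (hsm f)).continuous
      fun_prop
    exact (hc.tendsto 0).comp tendsto_one_div_add_atTop_nhds_zero_nat
  · exact hne y t ht

theorem GoodOn.tcoeff {Φ : E → Y × ℝ → G} (h : GoodOn univ Φ) (k : ℕ) :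
    GoodOn univ fun f => MeanFunction.tcoeff (Φ f) k := by
  have h1 : GoodOn univ fun f => MeanFunction.hquot^[k] (Φ f) := by
    induction k with
    | zero => exact h
    | succ k ih =>
      simp only [Function.iterate_succ_apply']
      exact ih.hquot
  refine ⟨fun f z _ => (contDiff_tcoeff (contDiff_iff_contDiffAt.2 fun z =>
    h.contDiffAt f z (mem_univ z)) k).contDiffAt, fun z _ => h1.isCLin (z, 0) (mem_univ _)⟩

end Families

/-! ### Values and coefficients as functionals on `𝓓_K` -/

section MeanFamilies

variable {𝕜 : Type*} [RCLike 𝕜] {m p q : ℕ} {K : Compacts (Euc m × Euc (p + q))}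

/-- The supremum norm on `𝓓_K`. -/
noncomputable def supNorm (f : ContDiffMapSupportedIn (Euc m × Euc (p + q)) 𝕜 ⊤ K) : ℝ :=
  ‖ContDiffMapSupportedIn.toBoundedContinuousFunctionCLM ℝ f‖

theorem continuous_supNorm : Continuous (supNorm : ContDiffMapSupportedIn
    (Euc m × Euc (p + q)) 𝕜 ⊤ K → ℝ) :=
  (ContDiffMapSupportedIn.toBoundedContinuousFunctionCLM ℝ).continuous.norm

theorem supNorm_zero : supNorm (0 : ContDiffMapSupportedIn (Euc m × Euc (p + q)) 𝕜 ⊤ K) = 0 := by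
  rw [supNorm, map_zero, norm_zero]

theorem norm_le_supNorm (f : ContDiffMapSupportedIn (Euc m × Euc (p + q)) 𝕜 ⊤ K)
    (z : Euc m × Euc (p + q)) : ‖f z‖ ≤ supNorm f :=
  BoundedContinuousFunction.norm_coe_le_norm
    (ContDiffMapSupportedIn.toBoundedContinuousFunctionCLM ℝ f) z

theorem norm_sphAvg_le (f : ContDiffMapSupportedIn (Euc m × Euc (p + q)) 𝕜 ⊤ K)
    (w : (Euc m × ℝ) × ℝ) : ‖sphAvg p q f w‖ ≤ supNorm f * sphMass p q := by
  refine norm_integral_le_of_norm_le_const (Filter.Eventually.of_forall fun o => ?_)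
  rw [one_smul]
  exact norm_le_supNorm f _

theorem goodOn_sphAvg : GoodOn univ fun f : ContDiffMapSupportedIn
    (Euc m × Euc (p + q)) 𝕜 ⊤ K => sphAvg p q f := by
  refine ⟨fun f z _ => (contDiff_sphAvg f.contDiff).contDiffAt, fun w _ => ?_⟩
  refine isCLin_of_bound (P := fun f => supNorm f * sphMass p q) (fun f g => ?_) (fun c f => ?_)
    (continuous_supNorm.mul continuous_const) (by simp [supNorm_zero]) fun f => norm_sphAvg_le f w
  · exact congrFun (sphAvg_add f.continuous g.continuous) w
  · exact congrFun (sphAvg_smul c f) w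

theorem isCLin_meanCoeff (k : ℕ) (x : Euc m) : IsCLin fun f : ContDiffMapSupportedIn
    (Euc m × Euc (p + q)) 𝕜 ⊤ K => meanCoeff p q f k x :=
  IsCLin.smul (IsCLin.sum _ fun _ =>
    ((((goodOn_sphAvg (K := K)).tcoeff _).tcoeff _).isCLin x (mem_univ x)).smul _) _

theorem goodOn_meanCoeff (k : ℕ) : GoodOn univ fun f : ContDiffMapSupportedIn
    (Euc m × Euc (p + q)) 𝕜 ⊤ K => meanCoeff p q f k :=
  ⟨fun f _ _ => (contDiff_meanCoeff f.contDiff k).contDiffAt, fun x _ => isCLin_meanCoeff k x⟩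

theorem exists_bound_of_compacts (K : Compacts (Euc m × Euc (p + q))) : ∃ S : ℝ, 0 < S ∧
    ∀ f : ContDiffMapSupportedIn (Euc m × Euc (p + q)) 𝕜 ⊤ K, ∀ x y, S ≤ ‖y‖ → f (x, y) = 0 := by
  obtain ⟨R, hR⟩ := K.isCompact.isBounded.exists_norm_le
  refine ⟨|R| + 1, by positivity, fun f x y hy => f.zero_on_compl fun h => ?_⟩
  have h1 := hR (x, y) h
  have h2 : ‖y‖ ≤ ‖(x, y)‖ := norm_snd_le (x, y)
  linarith [le_abs_self R]

/-- For fixed `t ≠ 0` the integrand vanishes beyond `b = S ^ 2`, and the weights are integrable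
below it, so the value is bounded by a multiple of the supremum norm of `f`. -/
theorem isCLin_meanFn (hp : 0 < p) (hq : 0 < q) {z : Euc m × ℝ} (hz : z.2 ≠ 0) :
    IsCLin fun f : ContDiffMapSupportedIn (Euc m × Euc (p + q)) 𝕜 ⊤ K => meanFn p q f z := by
  obtain ⟨S, hS0, hS⟩ := exists_bound_of_compacts (𝕜 := 𝕜) K
  have hint := integrableOn_wt_mul_wt hp hq hz (S ^ 2)
  let I : ℝ := ∫ b in Iic (S ^ 2), wt q b * wt p (b + z.2)
  refine isCLin_of_bound (P := fun f => 1 / 4 * (I * (supNorm f * sphMass p q)))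
    (fun f g => ?_) (fun c f => ?_) ?_ (by simp [supNorm_zero]) fun f => ?_
  · exact meanFn_add hp hq f.contDiff g.contDiff hS0.le (hS f) (hS g) hz
  · exact meanFn_smul c f z
  · have := continuous_supNorm (𝕜 := 𝕜) (K := K)
    fun_prop
  · rw [meanFn, norm_smul, Real.norm_of_nonneg (by norm_num)]
    refine mul_le_mul_of_nonneg_left ?_ (by norm_num)
    rw [← integral_mul_const, ← integral_indicator measurableSet_Iic]
    refine norm_integral_le_of_norm_le ?_ (Filter.Eventually.of_forall fun b => ?_)
    · exact (integrable_indicator_iff measurableSet_Iic).2 (hint.mul_const _)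
    · have hw : 0 ≤ wt q b * wt p (b + z.2) := mul_nonneg (wt_nonneg hq _) (wt_nonneg hp _)
      by_cases hb : b ∈ Iic (S ^ 2)
      · rw [indicator_of_mem hb, norm_smul, Real.norm_of_nonneg hw]
        exact mul_le_mul_of_nonneg_left (norm_sphAvg_le f _) hw
      · have hb' : S ≤ √b := Real.le_sqrt_of_sq_le (not_le.1 hb).le
        rw [indicator_of_notMem hb, sphAvg_eq_zero_of_le hS0.le (hS f) _
          (Or.inl (hb'.trans (le_abs_self _))), smul_zero, norm_zero]

end MeanFamilies

/-! ### Continuity of the mean map -/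

section Continuity

variable {𝕜 : Type*} [RCLike 𝕜] {m p q : ℕ}

/-- An element of `𝓓_K` as a test function. -/
noncomputable def toTestFn {K : Compacts (Euc m × Euc (p + q))}
    (f : ContDiffMapSupportedIn (Euc m × Euc (p + q)) 𝕜 ⊤ K) :
    TestFn (Euc m × Euc (p + q)) 𝕜 :=
  TestFunction.ofSupportedIn (Ω := ⊤) (fun _ _ => trivial) f

theorem goodOn_remainder (hp : 0 < p) (hq : 0 < q) {χ : ℝ → ℝ} (hχ : ContDiff ℝ ∞ χ) (N : ℕ)
    (K : Compacts (Euc m × Euc (p + q))) : GoodOn {z : Euc m × ℝ | z.2 ≠ 0}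
      fun f : ContDiffMapSupportedIn (Euc m × Euc (p + q)) 𝕜 ⊤ K =>
        remainder p q χ N (meanMap m p q (toTestFn f)) := by
  refine ⟨fun f => contDiffAt_remainder hχ N (meanMap_mem hp hq _), fun z hz => ?_⟩
  have h1 : (fun f : ContDiffMapSupportedIn (Euc m × Euc (p + q)) 𝕜 ⊤ K =>
      remainder p q χ N (meanMap m p q (toTestFn f)) z) = fun f : ContDiffMapSupportedIn
        (Euc m × Euc (p + q)) 𝕜 ⊤ K => meanFn p q f z -
        (χ z.2 * eta p q z.2) •
          ∑ k ∈ Finset.range (N + 1), z.2 ^ k • meanCoeff p q f k z.1 := by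
    funext f
    rw [remainder_eq_of_ne χ N _ hz, meanMap_eq hp hq]
    simp only [singularCoeff_meanMap hp hq]
    rfl
  rw [h1]
  exact (isCLin_meanFn hp hq hz).sub
    ((IsCLin.sum _ fun k => (isCLin_meanCoeff k z.1).smul _).smul _)

/-- The seminorm is a supremum of functionals of the family in `goodOn_remainder`, bounded for each
`f` by `exists_remainder_eq`. The translation by `ψ` matches the maps generating the topology of the
target. -/
theorem continuous_normT_comp (hp : 0 < p) (hq : 0 < q) {χ : ℝ → ℝ} (hχ : ContDiff ℝ ∞ χ)
    (hχc : HasCompactSupport χ) (hχ1 : χ =ᶠ[𝓝 0] 1) {N l : ℕ} (i : Fin m → ℕ)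
    (hl : (l : ℝ) < N + ((p + q : ℕ) : ℝ) / 2) (K : Compacts (Euc m × Euc (p + q)))
    {ψ : PuncturedProd m → 𝕜} (hψ : ψ ∈ H 𝕜 m p q) :
    Continuous fun f : ContDiffMapSupportedIn (Euc m × Euc (p + q)) 𝕜 ⊤ K =>
      normT p q χ N l i (meanMap m p q (toTestFn f) - ψ) := by
  have hO := isOpen_punctured m
  have h1 := (goodOn_remainder (𝕜 := 𝕜) hp hq hχ N K).continuous_iSup_iterD hO
    ((dirs i).map (fun v => (v, (0 : ℝ))) ++ List.replicate l (0, 1))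
    (ζ := fun z : PuncturedProd m => (z.1, (z.2 : ℝ))) (fun z => z.2.2) (fun f => ?_)
    (contDiffAt_remainder hχ N hψ)
  · refine (continuous_congr fun f => ?_).2 h1
    unfold normT
    refine iSup_congr fun z => ?_
    rw [partialX_iteratedDeriv_eq_iterD]
    congr 1
    exact iterD_congr hO _ (fun z hz => remainder_sub hp hq χ N (meanMap_mem hp hq _) hψ hz)
      (z.1, (z.2 : ℝ)) z.2.2
  · obtain ⟨u, hu, hru⟩ := exists_remainder_eq hp hq hχ hχc hχ1 hl
      (meanMap_mem hp hq (toTestFn f))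
    obtain ⟨C, hC⟩ := exists_bound_iterD_of_mem_prodSpan (dirs i) hu
    refine ⟨C, ?_⟩
    rintro _ ⟨z, rfl⟩
    simp only
    rw [iterD_congr hO _ hru (z.1, (z.2 : ℝ)) z.2.2]
    exact hC _

theorem continuous_normB_comp (hp : 0 < p) (hq : 0 < q) (k : ℕ) (i : Fin m → ℕ)
    (K : Compacts (Euc m × Euc (p + q))) {ψ : PuncturedProd m → 𝕜} (hψ : ψ ∈ H 𝕜 m p q) :
    Continuous fun f : ContDiffMapSupportedIn (Euc m × Euc (p + q)) 𝕜 ⊤ K =>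
      normB p q k i (meanMap m p q (toTestFn f) - ψ) := by
  have hco : ∀ f : ContDiffMapSupportedIn (Euc m × Euc (p + q)) 𝕜 ⊤ K,
      ⇑(singularCoeff p q (meanMap m p q (toTestFn f)) k) = meanCoeff p q f k := fun f =>
    funext fun x => singularCoeff_meanMap hp hq _ k x
  have h1 := (goodOn_meanCoeff (𝕜 := 𝕜) (K := K) k).continuous_iSup_iterD isOpen_univ
    (dirs i) (ζ := fun x : Euc m => x) (fun x => mem_univ x) (fun f => ?_)
    (ψ := singularCoeff p q ψ k) (fun x _ => (singularCoeff p q ψ k).contDiff.contDiffAt)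
  · refine (continuous_congr fun f => ?_).2 h1
    unfold normB
    refine iSup_congr fun x => ?_
    rw [partialX_eq_iterD, singularCoeff_sub hp hq (meanMap_mem hp hq _) hψ]
    congr 2
    funext x
    rw [← hco]
    rfl
  · rw [← hco]
    obtain ⟨C, hC⟩ := exists_bound_iterD (dirs i)
      (singularCoeff p q (meanMap m p q (toTestFn f)) k).contDiff
      (singularCoeff p q (meanMap m p q (toTestFn f)) k).hasCompactSupport
    refine ⟨C, ?_⟩
    rintro _ ⟨x, rfl⟩
    exact hC x

/-- The mean map, from `𝓓_K` to the space of functions supported in the image of `K`. -/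
noncomputable def meanMapK (hp : 0 < p) (hq : 0 < q) (K : Compacts (Euc m × Euc (p + q)))
    (f : ContDiffMapSupportedIn (Euc m × Euc (p + q)) 𝕜 ⊤ K) :
    HK 𝕜 m p q (imageCompacts p q K) :=
  ⟨⟨meanMap m p q (toTestFn f), meanMap_mem hp hq _⟩, fun z hz => by
    change meanMap m p q (toTestFn f) z = 0
    rw [meanMap_eq hp hq]
    exact meanFn_eq_zero_of_notMem hp hq (fun z hz => f.zero_on_compl hz) hz⟩

theorem continuous_meanMapK (hp : 0 < p) (hq : 0 < q) {χ : ℝ → ℝ} (hχ : ContDiff ℝ ∞ χ)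
    (hχc : HasCompactSupport χ) (hχ1 : χ =ᶠ[𝓝 0] 1) (K : Compacts (Euc m × Euc (p + q))) :
    Continuous[_, topHK 𝕜 m p q χ (imageCompacts p q K)] (meanMapK (𝕜 := 𝕜) hp hq K) := by
  rw [continuous_iff_coinduced_le]
  refine le_inf ?_ ?_
  · refine le_iInf fun ψ => le_iInf fun N => le_iInf fun l => le_iInf fun i => le_iInf fun hl => ?_
    refine continuous_iff_coinduced_le.1 (continuous_induced_rng.2 ?_)
    exact continuous_normT_comp hp hq hχ hχc hχ1 i hl K ψ.1.2
  · refine le_iInf fun ψ => le_iInf fun k => le_iInf fun i => ?_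
    refine continuous_iff_coinduced_le.1 (continuous_induced_rng.2 ?_)
    exact continuous_normB_comp hp hq k i K ψ.1.2

/-- The mean map as a linear map. -/
noncomputable def meanLin (hp : 0 < p) (hq : 0 < q) :
    TestFn (Euc m × Euc (p + q)) 𝕜 →ₗ[ℝ] H 𝕜 m p q where
  toFun f := ⟨meanMap m p q f, meanMap_mem hp hq f⟩
  map_add' f g := by
    refine Subtype.ext (funext fun z => ?_)
    obtain ⟨S, hS0, hS⟩ := exists_bound_of_testFn f
    obtain ⟨S', hS0', hS'⟩ := exists_bound_of_testFn g
    change meanMap m p q (f + g) z = meanMap m p q f z + meanMap m p q g z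
    simp only [meanMap_eq hp hq]
    exact meanFn_add hp hq f.contDiff g.contDiff (S := max S S') (by positivity)
      (fun x y h => hS x y ((le_max_left _ _).trans h))
      (fun x y h => hS' x y ((le_max_right _ _).trans h)) z.2.2
  map_smul' c f := by
    refine Subtype.ext (funext fun z => ?_)
    change meanMap m p q (c • f) z = c • meanMap m p q f z
    simp only [meanMap_eq hp hq]
    exact meanFn_smul c f _

/-- Every topology competing in the infimum is locally convex, so continuity into it can be tested
on each `𝓓_K`; there the map factors through the functions supported in the image of `K`. -/
theorem continuous_meanLin (hp : 0 < p) (hq : 0 < q) {χ : ℝ → ℝ} (hχ : ContDiff ℝ ∞ χ)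
    (hχc : HasCompactSupport χ) (hχ1 : χ =ᶠ[𝓝 0] 1) :
    Continuous[TestFunction.topologicalSpace _ _ _, topH 𝕜 m p q χ]
      (meanLin (𝕜 := 𝕜) (m := m) hp hq) := by
  refine continuous_sInf_rng.2 fun τ hτ => ?_
  obtain ⟨h1, h2, h3, h4⟩ := hτ
  let _ : TopologicalSpace (H 𝕜 m p q) := τ
  have : IsTopologicalAddGroup (H 𝕜 m p q) := h2
  have : ContinuousSMul ℝ (H 𝕜 m p q) := h3
  have : LocallyConvexSpace ℝ (H 𝕜 m p q) := h4
  refine (TestFunction.continuous_iff_continuous_comp (𝕜 := ℝ) (V := H 𝕜 m p q) (meanLin hp hq)).2 fun K hK => ?_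
  exact @Continuous.comp _ _ _ _ (topHK 𝕜 m p q χ (imageCompacts p q K)) _ _ _
    (h1 (imageCompacts p q K)) (continuous_meanMapK hp hq hχ hχc hχ1 K)

end Continuity

end MeanFunction

/-! ### The theorem -/

theorem mainTheorem6 (𝕜 : Type*) [RCLike 𝕜] (m p q : ℕ) (hp : 0 < p) (hq : 0 < q)
    (χ : ℝ → ℝ) (hχ : ContDiff ℝ ∞ χ) (hχc : HasCompactSupport χ) (hχ1 : χ =ᶠ[𝓝 0] 1) :
    (∀ g : MeanFunction.TestFn (MeanFunction.Euc (p + q)) 𝕜,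
      MeanFunction.IsMeanFunction p q g (MeanFunction.mean p q g)) ∧
    ∃ hmem : ∀ f : MeanFunction.TestFn (MeanFunction.Euc m × MeanFunction.Euc (p + q)) 𝕜,
        MeanFunction.meanMap m p q f ∈ MeanFunction.H 𝕜 m p q,
      Continuous[TestFunction.topologicalSpace _ _ _, MeanFunction.topH 𝕜 m p q χ]
        (fun f => (⟨MeanFunction.meanMap m p q f, hmem f⟩ : MeanFunction.H 𝕜 m p q)) ∧
      Function.Surjective
        (fun f => (⟨MeanFunction.meanMap m p q f, hmem f⟩ : MeanFunction.H 𝕜 m p q)) := by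
  refine ⟨MeanFunction.isMeanFunction_mean hp hq, MeanFunction.meanMap_mem hp hq,
    MeanFunction.continuous_meanLin hp hq hχ hχc hχ1, fun φ => ?_⟩
  obtain ⟨f, hf⟩ := MeanFunction.exists_meanMap_eq hp hq φ.2
  exact ⟨f, Subtype.ext hf⟩
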